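/- **Model.** For $n\ge 3$ let $\mathcal R_n$ be the ring with nodes $v_0,\dots,v_{n-1}$ and an edge between $v_i$ and $v_{i+1 \bmod n}$ for each $i$. Three robots are placed on arbitrary (not necessarily distinct) nodes. Nodes are anonymous. Every robot executes the same deterministic (computable) algorithm; initially it knows only its own ID, a string of $k$ bits, and in particular neither $n$ nor a bound on $n$. The three IDs are pairwise distinct and of the same length $k$. Each robot has a fixed private notion of left and right, and these notions may differ between the robots (no common chirality). Time proceeds in synchronous rounds. In each round (i) every robot that has not terminated performs a local computation and decides to terminate, to stay, or to try to move left or right; (ii) an adversary that knows the algorithm and the entire current configuration removes at most one edge for this round (1-interval connectivity); (iii) a robot that tries to move does so if the edge concerned is present, and otherwise stays. The input of a robot's local computation consists of its memory, whether it moved in the previous round, the memory contents of the robots that have not terminated and are currently at its node, and the memory contents of the robots that traversed the same edge as it did in the opposite direction in the previous round (edge crossing detection). The execution *explores the ring with explicit termination in $T$ rounds* if after at most $T$ rounds every node has been visited by some robot (initial positions count as visited) and all three robots have terminated, and no robot ever terminates before every node has been visited. **Corollary.** There is a single algorithm with the following property. For every $k$ there are constants $C, M$ depending only on $k$ such that for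 every $n\ge 3$, all pairwise distinct IDs of length $k$, all private orientations, all initial positions and every adversary, the three robots explore $\mathcal R_n$ with explicit termination in at most $C\,n$ rounds, and each robot uses at most $M\lfloor\log_2 n\rfloor$ bits of memory at all times. In particular, for IDs of $O(1)$ bits the ring is explored in $O(n)$ rounds with $O(\log n)$ bits of memory per robot. This time bound is asymptotically optimal: there are constants $c>0$ and $N$ such that for every algorithm in this model, every $n\ge N$, all IDs, orientations, initial positions and every adversary, if every node of $\mathcal R_n$ has been visited after $T$ rounds, then $T\ge c\,n$. -/

import Mathlib

namespace DynamicRing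

/-- A deterministic algorithm executed by every robot. All robots run the same one; the only thing a
robot knows at the start is its own ID, a bit string. -/
structure RobotAlgorithm where
  /-- possible contents of the memory of a robot -/
  State : Type
  [primcodable : Primcodable State]
  /-- initial memory content of a robot with the given ID -/
  init : List Bool → State
  /-- Local computation of one round. The inputs are: the robot's memory; whether it traversed an
  edge in the previous round; the (unordered) memory contents of the other robots at its node; and
  the (unordered) memory contents of the robots that it crossed on an edge in the previous round.
  The value `none` means that the robot terminates. Otherwise the value is the new memory content,
  with `none` (stay), `some false` (try to move left) or `some true` (try to move right), where
  left and right are the robot's private ones. -/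
  step : State → Bool → Multiset State → Multiset State → Option (State × Option Bool)
  computable_init : Computable init
  computable_step : Computable fun o : State × Bool × List State × List State =>
    step o.1 o.2.1 (o.2.2.1 : Multiset State) (o.2.2.2 : Multiset State)

attribute [instance] RobotAlgorithm.primcodable

/-- Global state at the beginning of a round, for three robots on the ring with node set `ZMod n`.
Edge number `e : ZMod n` joins the nodes `e` and `e + 1`. -/
structure Config (S : Type) (n : ℕ) where
  /-- current node of each robot -/
  pos : Fin 3 → ZMod n
  /-- memory content of each robot; `none` once it has terminated -/
  mem : Fin 3 → Option S
  /-- the edge that each robot traversed in the previous round, if any, with the sense of the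
  traversal: `true` for `e` to `e + 1`, `false` for `e + 1` to `e` -/
  trav : Fin 3 → Option (ZMod n × Bool)

namespace Config

variable {S : Type} {n : ℕ}

/-- Memory contents of the other (not terminated) robots at the node of robot `i`. -/
def here (c : Config S n) (i : Fin 3) : Multiset S :=
  (Finset.univ.filter fun j => j ≠ i ∧ c.pos j = c.pos i).val.filterMap c.mem

/-- Memory contents of the robots that traversed, in the previous round, the same edge as robot `i`
in the opposite sense. -/
def crossed (c : Config S n) (i : Fin 3) : Multiset S :=
  (Finset.univ.filter fun j =>
    c.trav i ≠ none ∧ c.trav j = (c.trav i).map fun x => (x.1, !x.2)).val.filterMap c.mem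

end Config

variable (P : RobotAlgorithm) {n : ℕ}

/-- The result of the local computation of robot `i`; a terminated robot does nothing. -/
def decision (c : Config P.State n) (i : Fin 3) : Option (P.State × Option Bool) :=
  (c.mem i).bind fun s => P.step s (c.trav i).isSome (c.here i) (c.crossed i)

/-- The traversal that robot `i` makes in this round. Its private right is the sense from `e` to
`e + 1` if `chir i = true` and the other sense if `chir i = false`. The move fails if the edge is
the removed one. -/
def traversal (chir : Fin 3 → Bool) (removed : Option (ZMod n)) (c : Config P.State n)
    (i : Fin 3) : Option (ZMod n × Bool) :=
  match (decision P c i).bind Prod.snd with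
  | none => none
  | some d =>
    let sense : Bool := d == chir i
    let e : ZMod n := if sense then c.pos i else c.pos i - 1
    if removed = some e then none else some (e, sense)

/-- One synchronous round: local computations, removal of at most one edge, moves. -/
def next (chir : Fin 3 → Bool) (removed : Option (ZMod n)) (c : Config P.State n) :
    Config P.State n where
  pos i := match traversal P chir removed c i with
    | none => c.pos i
    | some (e, sense) => if sense then e + 1 else e
  mem i := (decision P c i).map Prod.fst
  trav := traversal P chir removed c

/-- The configuration after `t` rounds. `adv t` is the edge that is missing in round `t`, if any. -/
def run (id : Fin 3 → List Bool) (chir : Fin 3 → Bool) (start : Fin 3 → ZMod n)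
    (adv : ℕ → Option (ZMod n)) : ℕ → Config P.State n
  | 0 => { pos := start, mem := fun i => some (P.init (id i)), trav := fun _ => none }
  | t + 1 => next P chir (adv t) (run id chir start adv t)

/-- Every node has been visited by some robot within the first `t` rounds. -/
def Explored {S : Type} (E : ℕ → Config S n) (t : ℕ) : Prop :=
  ∀ v : ZMod n, ∃ s ≤ t, ∃ i, (E s).pos i = v

/-- Robot `i` has terminated within the first `t` rounds. -/
def Terminated {S : Type} (E : ℕ → Config S n) (t : ℕ) (i : Fin 3) : Prop :=
  (E t).mem i = none

/-- The execution `E` explores the ring with explicit termination in at most `T` rounds: after some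
`t ≤ T` rounds every node has been visited and all robots have terminated, and no robot ever
terminates before every node has been visited. -/
def ExploresWithTermination {S : Type} (E : ℕ → Config S n) (T : ℕ) : Prop :=
  (∃ t ≤ T, Explored E t ∧ ∀ i, Terminated E t i) ∧
    ∀ t i, Terminated E t i → Explored E t

/-- Every robot uses at most `b` bits of memory at all times in the execution `E`. -/
def UsesMemory {S : Type} [Encodable S] (E : ℕ → Config S n) (b : ℕ) : Prop :=
  ∀ t i, ∀ s ∈ (E t).mem i, Nat.size (Encodable.encode s) ≤ b

end DynamicRing

/-! ### The algorithm -/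

namespace DynamicRing

/-! Rounds are used in pairs, called double rounds here: the even round decides and moves
(`Mem.settle`), the odd round only looks at what happened (`Mem.observe`).

First encounter. In the double rounds from `2 ^ m` to `2 ^ (m + 1)` a robot that is still alone
keeps the private direction given by bit `m % (k + 1)` of its ID. Bit `k` is `0` in every ID, so if
two orientations differ, that bit sends two robots in opposite senses; if they agree, a bit in which
two IDs differ does so (`exists_bit`). Two robots with the same sense at distinct nodes use distinct
edges, so the adversary cannot block both. Hence during a phase longer than `2 * n` the sum of two
gaps between approaching robots shrinks until robots meet or cross (`not_unmet_of_sched`).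

Sweep. Two robots that have met become walkers that go away from each other for ever, and each
counts its successful moves `x` and failed moves `y`. As long as their outward edges differ, at most
one of them is blocked, so each failure of one is matched by a success of the other: `y` of one is
at most `x` of the other. If this fails, both were once blocked at the two ends of the same edge,
and the arc between them holds all nodes. The third robot becomes a messenger that carries the
values of `y`; a walker that hears of a `y` above its own `x` knows that the ring is explored. The
other certificate is that the walkers meet or cross on the far side. Soundness is the invariant
`Walk`. Conversely, if the walkers stay stuck at one edge, `y` grows while `x < n`, and the
messenger commutes between them within `n` double rounds, so a certificate appears in linear time
(`exists_done`).

Termination. A robot that learns at clock `c` that the ring is explored fixes the deadline `64 * (c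
+ 1)`. By `all_done` everybody knows at most `n + 1` double rounds after the first: walkers that
have met squeeze the third robot between them, and otherwise the messenger informs the other walker
or the walkers cross. Visiting `n` nodes takes about `n / 3` rounds, so the factor 64 keeps all
deadlines beyond that moment. All counters are then linear in `n` for fixed `k`, which gives
logarithmic memory.

Optimality: three robots occupy at most three new nodes per round. -/

/-- Memory of a robot. Roles: `0` has not met anybody, `1` has met another robot and does not know
their relative orientation yet, `2` is a walker (moves away from the meeting point for ever), `3` is a
messenger (bounces between the two walkers). -/
structure Mem where
  /-- number of the round -/
  clock : ℕ
  /-- the ID, read as a binary number -/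
  code : ℕ
  /-- the length of the ID -/
  len : ℕ
  /-- the role -/
  role : ℕ
  /-- the two walkers have different sides -/
  side : Bool
  /-- the direction of the last attempted move -/
  dir : Bool
  /-- walker: number of successful moves; messenger: largest known number of failed moves of the
  walker of side `false` -/
  x : ℕ
  /-- walker: number of failed moves; messenger: largest known number of failed moves of the
  walker of side `true` -/
  y : ℕ
  /-- the round in which to terminate, `0` while it is not known that the ring is explored -/
  dl : ℕ

namespace Mem

/-- A memory as a tuple. -/
def equivTuple : Mem ≃ ℕ × ℕ × ℕ × ℕ × Bool × Bool × ℕ × ℕ × ℕ where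
  toFun s := (s.clock, s.code, s.len, s.role, s.side, s.dir, s.x, s.y, s.dl)
  invFun p := ⟨p.1, p.2.1, p.2.2.1, p.2.2.2.1, p.2.2.2.2.1, p.2.2.2.2.2.1, p.2.2.2.2.2.2.1,
    p.2.2.2.2.2.2.2.1, p.2.2.2.2.2.2.2.2⟩
  left_inv _ := rfl
  right_inv _ := rfl

instance : Primcodable Mem := Primcodable.ofEquiv _ equivTuple

/-- The number of failed moves that a messenger knows of the walker of the given side. -/
def known (s : Mem) (b : Bool) : ℕ := if b then s.y else s.x

/-- The direction of a robot that has not met anybody. -/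
def sched (code len s : ℕ) : Bool := code.testBit (Nat.log 2 s % (len + 1))

/-- The largest number of failed moves of a robot of the given side. -/
def maxBlocks (h : Multiset Mem) (b : Bool) : ℕ :=
  (h.map fun a => if a.side = b then a.y else 0).sup

open Classical in
/-- Computation in an even round, before moving; `h` are the other robots at the node. -/
noncomputable def settle (s : Mem) (h : Multiset Mem) : Mem where
  clock := s.clock + 1
  code := s.code
  len := s.len
  role :=
    if s.role = 0 then
      if (∃ a ∈ h, a.role ≠ 0) ∨ ((∃ a ∈ h, a.code < s.code) ∧ ∃ a ∈ h, a.code > s.code) then 3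
      else if (∃ a ∈ h, a.code < s.code) ∨ ∃ a ∈ h, a.code > s.code then 1 else 0
    else s.role
  side := if s.role = 0 then decide (∃ a ∈ h, a.code < s.code) else s.side
  dir :=
    if s.role = 0 then sched s.code s.len (s.clock / 2)
    else if s.role = 3 ∧ ∃ a ∈ h, a.role ≠ 0 then !s.dir else s.dir
  x := if s.role = 3 then max s.x (maxBlocks h false) else s.x
  y := if s.role = 3 then max s.y (maxBlocks h true) else s.y
  dl := if s.dl = 0 ∧ ∃ a ∈ h, a.dl ≠ 0 then 64 * (s.clock + 1) else s.dl

open Classical in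
/-- Computation in an odd round, after moving; `m` tells whether the move succeeded, `h` are the
other robots at the node and `c` are the robots that were crossed. -/
noncomputable def observe (s : Mem) (m : Bool) (h c : Multiset Mem) : Mem where
  clock := s.clock + 1
  code := s.code
  len := s.len
  role :=
    if s.role = 0 then
      if ∃ a ∈ c, a.role = 0 then 2 else if ∃ a ∈ c, a.role ≠ 0 then 3 else 0
    else if s.role = 1 then if ∃ a ∈ h, a.role = 1 then 1 else 2
    else s.role
  side := if s.role = 0 then decide (∃ a ∈ c, a.code < s.code) else s.side
  dir := if s.role = 1 ∧ ∃ a ∈ h, a.role = 1 then xor s.dir s.side else s.dir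
  x := if s.role = 2 then s.x + m.toNat else s.x
  y := if s.role = 2 then s.y + (!m).toNat else s.y
  dl :=
    if s.dl = 0 ∧ ((∃ a ∈ h, a.dl ≠ 0) ∨ (∃ a ∈ c, a.dl ≠ 0) ∨
      (s.role = 2 ∧ ((∃ a ∈ h, a.role = 2) ∨ (∃ a ∈ c, a.role = 2) ∨
        ∃ a ∈ h, a.role = 3 ∧ s.x + m.toNat < a.known (!s.side))))
    then 64 * (s.clock + 1) else s.dl

open Classical in
/-- The local computation of a robot. -/
noncomputable def step (s : Mem) (m : Bool) (h c : Multiset Mem) : Option (Mem × Option Bool) :=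
  if s.clock % 2 = 0 then
    if s.dl ≠ 0 ∧ s.dl ≤ s.clock then none else some (s.settle h, some (s.settle h).dir)
  else some (s.observe m h c, none)

/-- The initial memory. -/
def start (id : List Bool) : Mem where
  clock := 0
  code := id.foldr (fun b a => b.toNat + 2 * a) 0
  len := id.length
  role := 0
  side := false
  dir := false
  x := 0
  y := 0
  dl := 0

/-! ### The local computation is primitive recursive -/

theorem primrec_tuple : Primrec equivTuple := Primrec.of_equiv

theorem primrec_clock : Primrec clock := (Primrec.fst.comp primrec_tuple).of_eq fun _ => rfl

theorem primrec_code : Primrec code :=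
  (Primrec.fst.comp (Primrec.snd.comp primrec_tuple)).of_eq fun _ => rfl

theorem primrec_len : Primrec len :=
  (Primrec.fst.comp (Primrec.snd.comp (Primrec.snd.comp primrec_tuple))).of_eq fun _ => rfl

theorem primrec_tail : Primrec fun s : Mem => (s.role, s.side, s.dir, s.x, s.y, s.dl) :=
  (Primrec.snd.comp (Primrec.snd.comp (Primrec.snd.comp primrec_tuple))).of_eq fun _ => rfl

theorem primrec_role : Primrec role := (Primrec.fst.comp primrec_tail).of_eq fun _ => rfl

theorem primrec_side : Primrec side :=
  (Primrec.fst.comp (Primrec.snd.comp primrec_tail)).of_eq fun _ => rfl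

theorem primrec_dir : Primrec dir :=
  (Primrec.fst.comp (Primrec.snd.comp (Primrec.snd.comp primrec_tail))).of_eq fun _ => rfl

theorem primrec_tail' : Primrec fun s : Mem => (s.x, s.y, s.dl) :=
  (Primrec.snd.comp (Primrec.snd.comp (Primrec.snd.comp primrec_tail))).of_eq fun _ => rfl

theorem primrec_x : Primrec x := (Primrec.fst.comp primrec_tail').of_eq fun _ => rfl

theorem primrec_y : Primrec y :=
  (Primrec.fst.comp (Primrec.snd.comp primrec_tail')).of_eq fun _ => rfl

theorem primrec_dl : Primrec dl :=
  (Primrec.snd.comp (Primrec.snd.comp primrec_tail')).of_eq fun _ => rfl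

theorem primrec_mk {α : Type*} [Primcodable α] {f₁ f₂ f₃ f₄ f₇ f₈ f₉ : α → ℕ} {f₅ f₆ : α → Bool}
    (h₁ : Primrec f₁) (h₂ : Primrec f₂) (h₃ : Primrec f₃) (h₄ : Primrec f₄) (h₅ : Primrec f₅)
    (h₆ : Primrec f₆) (h₇ : Primrec f₇) (h₈ : Primrec f₈) (h₉ : Primrec f₉) :
    Primrec fun a => Mem.mk (f₁ a) (f₂ a) (f₃ a) (f₄ a) (f₅ a) (f₆ a) (f₇ a) (f₈ a) (f₉ a) :=
  (Primrec.of_equiv_symm (e := equivTuple)).comp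
    (h₁.pair (h₂.pair (h₃.pair (h₄.pair (h₅.pair (h₆.pair (h₇.pair (h₈.pair h₉))))))))

theorem primrec_known : Primrec₂ known :=
  Primrec.ite (Primrec.eq.comp Primrec.snd (Primrec.const true)) (primrec_y.comp Primrec.fst)
    (primrec_x.comp Primrec.fst)

theorem primrec_pow : Primrec₂ ((· ^ ·) : ℕ → ℕ → ℕ) := Primrec₂.unpaired'.1 Nat.Primrec.pow

/-- A bounded search: the logarithm is the largest `i ≤ s` with `2 ^ i ≤ s`. -/
theorem primrec_log : Primrec (Nat.log 2) := by
  have h : Primrec fun s : ℕ => Nat.findGreatest (fun i => 2 ^ i ≤ s ∧ s ≠ 0) s := by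
    apply Primrec.nat_findGreatest Primrec.id
    apply PrimrecPred.primrecRel (p := fun q : ℕ × ℕ => 2 ^ q.2 ≤ q.1 ∧ q.1 ≠ 0)
    exact (Primrec.nat_le.comp (primrec_pow.comp (Primrec.const 2) Primrec.snd) Primrec.fst).and
      (Primrec.eq.comp Primrec.fst (Primrec.const 0)).not
  refine h.of_eq fun s => ?_
  rcases Nat.eq_zero_or_pos s with rfl | hs
  · simp
  · rw [Nat.findGreatest_eq_iff]
    refine ⟨Nat.log_le_self 2 s, fun _ => ⟨Nat.pow_log_le_self 2 hs.ne', hs.ne'⟩, ?_⟩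
    intro i hi _ h
    exact absurd (Nat.le_log_of_pow_le (by norm_num) h.1) (by omega)

theorem primrec_testBit : Primrec₂ Nat.testBit := by
  have h : PrimrecRel fun a i : ℕ => a / 2 ^ i % 2 = 1 :=
    Primrec.eq.comp (Primrec.nat_mod.comp (Primrec.nat_div.comp Primrec.fst
      (primrec_pow.comp (Primrec.const 2) Primrec.snd)) (Primrec.const 2)) (Primrec.const 1)
  exact (primrecRel_iff_primrec_decide.1 h).of_eq fun a i =>
    Nat.testBit_eq_decide_div_mod_eq.symm

section Local

open Classical

variable {α : Type*} [Primcodable α] {s : α → Mem} {h c : α → List Mem} {m : α → Bool}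

/-- Multisets enter only as coerced lists, so every test in the algorithm is a bounded quantifier
over a list. -/
theorem primrec_exists {β : Type*} [Primcodable β] {R : Mem → β → Prop} {f : α → β}
    (hR : PrimrecRel R) (hh : Primrec h) (hf : Primrec f) :
    PrimrecPred fun o => ∃ a ∈ (h o : Multiset Mem), R a (f o) := by
  simpa only [Multiset.mem_coe] using hR.exists_mem_list.comp hh hf

theorem primrec_exists_pred {p : Mem → Prop} (hp : PrimrecPred p) (hh : Primrec h) :
    PrimrecPred fun o => ∃ a ∈ (h o : Multiset Mem), p a := by
  simpa only [Multiset.mem_coe] using hp.exists_mem_list.comp hh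

theorem primrec_sched (hs : Primrec s) :
    Primrec fun o => sched (s o).code (s o).len ((s o).clock / 2) :=
  primrec_testBit.comp (primrec_code.comp hs) (Primrec.nat_mod.comp
    (primrec_log.comp (Primrec.nat_div.comp (primrec_clock.comp hs) (Primrec.const 2)))
    (Primrec.succ.comp (primrec_len.comp hs)))

theorem primrec_maxBlocks (hh : Primrec h) (b : Bool) :
    Primrec fun o => maxBlocks (h o : Multiset Mem) b := by
  have : Primrec fun o => (h o).foldr (fun a r => max (if a.side = b then a.y else 0) r) 0 := by
    have hf : Primrec fun a : Mem => if a.side = b then a.y else 0 :=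
      Primrec.ite (Primrec.eq.comp primrec_side (Primrec.const b)) primrec_y (Primrec.const 0)
    exact Primrec.list_foldr hh (Primrec.const 0) (Primrec.nat_max.comp
      (hf.comp (Primrec.fst.comp Primrec.snd)) (Primrec.snd.comp Primrec.snd)).to₂
  refine this.of_eq fun o => ?_
  unfold maxBlocks
  induction h o with
  | nil => simp
  | cons a l ih =>
    rw [List.foldr_cons, ih]
    simp

theorem primrecPred_role (r : ℕ) : PrimrecPred fun a : Mem => a.role = r :=
  Primrec.eq.comp primrec_role (Primrec.const r)

theorem primrecPred_dl : PrimrecPred fun a : Mem => a.dl = 0 :=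
  Primrec.eq.comp primrec_dl (Primrec.const 0)

theorem primrec_exists_code_lt (hs : Primrec s) (hh : Primrec h) :
    PrimrecPred fun o => ∃ a ∈ (h o : Multiset Mem), a.code < (s o).code :=
  primrec_exists (R := fun (a : Mem) (b : ℕ) => a.code < b)
    (Primrec.nat_lt.comp (primrec_code.comp Primrec.fst) Primrec.snd) hh (primrec_code.comp hs)

theorem primrec_exists_code_gt (hs : Primrec s) (hh : Primrec h) :
    PrimrecPred fun o => ∃ a ∈ (h o : Multiset Mem), a.code > (s o).code :=
  primrec_exists (R := fun (a : Mem) (b : ℕ) => b < a.code)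
    (Primrec.nat_lt.comp Primrec.snd (primrec_code.comp Primrec.fst)) hh (primrec_code.comp hs)

theorem primrec_exists_known (hs : Primrec s) (hm : Primrec m) (hh : Primrec h) :
    PrimrecPred fun o => ∃ a ∈ (h o : Multiset Mem),
      a.role = 3 ∧ (s o).x + (m o).toNat < a.known (!(s o).side) := by
  refine primrec_exists (f := fun o => ((s o).x + (m o).toNat, !(s o).side))
    (R := fun (a : Mem) (b : ℕ × Bool) => a.role = 3 ∧ b.1 < a.known b.2) ?_ hh ?_
  · exact ((primrecPred_role 3).comp Primrec.fst).and (Primrec.nat_lt.comp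
      (Primrec.fst.comp Primrec.snd)
      (primrec_known.comp Primrec.fst (Primrec.snd.comp Primrec.snd)))
  · exact (Primrec.nat_add.comp (primrec_x.comp hs) ((Primrec.dom_bool _).comp hm)).pair
      (Primrec.not.comp (primrec_side.comp hs))

theorem primrec_newDl (hs : Primrec s) :
    Primrec fun o => 64 * ((s o).clock + 1) :=
  Primrec.nat_mul.comp (Primrec.const 64) (Primrec.succ.comp (primrec_clock.comp hs))

theorem primrec_decide {p : α → Prop} (hp : PrimrecPred p) : Primrec fun o => decide (p o) :=
  primrecPred_iff_primrec_decide.1 hp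

theorem primrec_settle (hs : Primrec s) (hh : Primrec h) :
    Primrec fun o => (s o).settle (h o : Multiset Mem) := by
  have hr (r : ℕ) : PrimrecPred fun o => (s o).role = r := (primrecPred_role r).comp hs
  have hw := primrec_exists_pred (primrecPred_role 0).not hh
  have hlt := primrec_exists_code_lt hs hh
  have hgt := primrec_exists_code_gt hs hh
  have hd := primrec_exists_pred primrecPred_dl.not hh
  unfold settle
  refine primrec_mk (Primrec.succ.comp (primrec_clock.comp hs)) (primrec_code.comp hs)
    (primrec_len.comp hs) ?_ ?_ ?_ ?_ ?_ ?_
  · exact Primrec.ite (hr 0) (Primrec.ite (hw.or (hlt.and hgt)) (Primrec.const 3)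
      (Primrec.ite (hlt.or hgt) (Primrec.const 1) (Primrec.const 0))) (primrec_role.comp hs)
  · exact Primrec.ite (hr 0) (primrec_decide hlt) (primrec_side.comp hs)
  · exact Primrec.ite (hr 0) (primrec_sched hs) (Primrec.ite ((hr 3).and hw)
      (Primrec.not.comp (primrec_dir.comp hs)) (primrec_dir.comp hs))
  · exact Primrec.ite (hr 3) (Primrec.nat_max.comp (primrec_x.comp hs)
      (primrec_maxBlocks hh false)) (primrec_x.comp hs)
  · exact Primrec.ite (hr 3) (Primrec.nat_max.comp (primrec_y.comp hs)
      (primrec_maxBlocks hh true)) (primrec_y.comp hs)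
  · exact Primrec.ite ((primrecPred_dl.comp hs).and hd) (primrec_newDl hs) (primrec_dl.comp hs)

theorem primrec_observe (hs : Primrec s) (hm : Primrec m) (hh : Primrec h) (hc : Primrec c) :
    Primrec fun o => (s o).observe (m o) (h o : Multiset Mem) (c o : Multiset Mem) := by
  have hr (r : ℕ) : PrimrecPred fun o => (s o).role = r := (primrecPred_role r).comp hs
  have hw (r : ℕ) := primrec_exists_pred (primrecPred_role r) hh
  have cw (r : ℕ) := primrec_exists_pred (primrecPred_role r) hc
  have cw0 := primrec_exists_pred (primrecPred_role 0).not hc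
  have hlt := primrec_exists_code_lt hs hc
  have hd := primrec_exists_pred primrecPred_dl.not hh
  have cd := primrec_exists_pred primrecPred_dl.not hc
  unfold observe
  refine primrec_mk (Primrec.succ.comp (primrec_clock.comp hs)) (primrec_code.comp hs)
    (primrec_len.comp hs) ?_ ?_ ?_ ?_ ?_ ?_
  · exact Primrec.ite (hr 0) (Primrec.ite (cw 0) (Primrec.const 2)
      (Primrec.ite cw0 (Primrec.const 3) (Primrec.const 0)))
      (Primrec.ite (hr 1) (Primrec.ite (hw 1) (Primrec.const 1) (Primrec.const 2))
        (primrec_role.comp hs))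
  · exact Primrec.ite (hr 0) (primrec_decide hlt) (primrec_side.comp hs)
  · exact Primrec.ite ((hr 1).and (hw 1)) ((Primrec.dom_bool₂ xor).comp (primrec_dir.comp hs)
      (primrec_side.comp hs)) (primrec_dir.comp hs)
  · exact Primrec.ite (hr 2) (Primrec.nat_add.comp (primrec_x.comp hs)
      ((Primrec.dom_bool _).comp hm)) (primrec_x.comp hs)
  · exact Primrec.ite (hr 2) (Primrec.nat_add.comp (primrec_y.comp hs)
      ((Primrec.dom_bool fun b => (!b).toNat).comp hm)) (primrec_y.comp hs)
  · exact Primrec.ite ((primrecPred_dl.comp hs).and (hd.or (cd.or ((hr 2).and ((hw 2).or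
      ((cw 2).or (primrec_exists_known hs hm hh))))))) (primrec_newDl hs) (primrec_dl.comp hs)

theorem primrec_step (hs : Primrec s) (hm : Primrec m) (hh : Primrec h) (hc : Primrec c) :
    Primrec fun o => (s o).step (m o) (h o : Multiset Mem) (c o : Multiset Mem) := by
  have hk := primrec_clock.comp hs
  unfold step
  refine Primrec.ite (Primrec.eq.comp (Primrec.nat_mod.comp hk (Primrec.const 2))
    (Primrec.const 0)) (Primrec.ite ?_ (Primrec.const none) ?_) ?_
  · exact (primrecPred_dl.comp hs).not.and (Primrec.nat_le.comp (primrec_dl.comp hs) hk)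
  · have := primrec_settle hs hh
    exact Primrec.option_some.comp (this.pair (Primrec.option_some.comp (primrec_dir.comp this)))
  · exact Primrec.option_some.comp ((primrec_observe hs hm hh hc).pair (Primrec.const none))

end Local

theorem primrec_start : Primrec start := by
  unfold start
  refine primrec_mk (Primrec.const 0) ?_ Primrec.list_length (Primrec.const 0)
    (Primrec.const false) (Primrec.const false) (Primrec.const 0) (Primrec.const 0)
    (Primrec.const 0)
  exact Primrec.list_foldr Primrec.id (Primrec.const 0) (Primrec.nat_add.comp
    ((Primrec.dom_bool _).comp (Primrec.fst.comp Primrec.snd))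
    (Primrec.nat_mul.comp (Primrec.const 2) (Primrec.snd.comp Primrec.snd))).to₂

end Mem

/-- The exploration algorithm. -/
noncomputable def explorer : RobotAlgorithm where
  State := Mem
  init := Mem.start
  step := Mem.step
  computable_init := Mem.primrec_start.to_comp
  computable_step := (Mem.primrec_step Primrec.fst (Primrec.fst.comp Primrec.snd)
    (Primrec.fst.comp (Primrec.snd.comp Primrec.snd))
    (Primrec.snd.comp (Primrec.snd.comp Primrec.snd))).to_comp

end DynamicRing

/-! ### Double rounds as single steps between snapshots -/

namespace DynamicRing

section

variable {P : RobotAlgorithm} {n : ℕ} {chir : Fin 3 → Bool} {e : Option (ZMod n)}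
  {c : Config P.State n} {i : Fin 3} {a : P.State}

theorem traversal_of_none (h : decision P c i = some (a, none)) :
    traversal P chir e c i = none := by
  simp [traversal, h]

theorem traversal_of_some {d : Bool} (h : decision P c i = some (a, some d)) :
    traversal P chir e c i =
      if e = some (if d == chir i then c.pos i else c.pos i - 1) then none
      else some (if d == chir i then c.pos i else c.pos i - 1, d == chir i) := by
  simp [traversal, h]

theorem next_eq {c' : Config P.State n}
    (hp : ∀ i, (match traversal P chir e c i with
      | none => c.pos i
      | some (e, sense) => if sense then e + 1 else e) = c'.pos i)
    (hm : ∀ i, (decision P c i).map Prod.fst = c'.mem i)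
    (ht : traversal P chir e c = c'.trav) : next P chir e c = c' := by
  obtain ⟨p, m, t⟩ := c'
  simp only [next, Config.mk.injEq]
  exact ⟨funext hp, funext hm, ht⟩

end

/-- Positions and memories of three robots of which none has terminated. -/
structure Snap (n : ℕ) where
  /-- current node of each robot -/
  pos : Fin 3 → ZMod n
  /-- memory of each robot -/
  mem : Fin 3 → Mem

namespace Snap

variable {n : ℕ} (chir : Fin 3 → Bool) (e : Option (ZMod n)) (q : Snap n)

/-- Memories of the other robots at the node of robot `i`. -/
def here (i : Fin 3) : Multiset Mem :=
  (Finset.univ.filter fun j => j ≠ i ∧ q.pos j = q.pos i).val.map q.mem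

/-- All robots do the computation of an even round. -/
noncomputable def settle : Snap n := ⟨q.pos, fun i => (q.mem i).settle (q.here i)⟩

/-- The sense of the next move. -/
def sense (i : Fin 3) : Bool := (q.mem i).dir == chir i

/-- The edge of the next move. -/
def edge (i : Fin 3) : ZMod n := if q.sense chir i then q.pos i else q.pos i - 1

/-- Whether the next move succeeds. -/
def moved (i : Fin 3) : Bool := decide (e ≠ some (q.edge chir i))

/-- All robots move. -/
def move : Snap n where
  pos i := if q.moved chir e i then if q.sense chir i then q.pos i + 1 else q.pos i - 1
    else q.pos i
  mem := q.mem

/-- Memories of the robots that robot `i` crosses in the next move. -/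
def crossed (i : Fin 3) : Multiset Mem :=
  (Finset.univ.filter fun j => q.moved chir e i ∧ q.moved chir e j ∧
    q.edge chir j = q.edge chir i ∧ q.sense chir j = !q.sense chir i).val.map q.mem

/-- All robots move and do the computation of the following odd round. -/
noncomputable def finish : Snap n where
  pos := (q.move chir e).pos
  mem i := (q.mem i).observe (q.moved chir e i) ((q.move chir e).here i) (q.crossed chir e i)

/-- An even round and the following odd round. -/
noncomputable def round : Snap n := q.settle.finish chir e

/-- The traversals of the next move. -/
def trav (i : Fin 3) : Option (ZMod n × Bool) :=
  if q.moved chir e i then some (q.edge chir i, q.sense chir i) else none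

/-- A snapshot as a configuration. -/
def toConfig (t : Fin 3 → Option (ZMod n × Bool)) : Config Mem n :=
  ⟨q.pos, fun i => some (q.mem i), t⟩

theorem here_toConfig (t : Fin 3 → Option (ZMod n × Bool)) (i : Fin 3) :
    (q.toConfig t).here i = q.here i := by
  simp only [Config.here, here, toConfig]
  exact Multiset.filterMap_eq_map q.mem ▸ rfl

theorem crossed_toConfig (i : Fin 3) :
    ((q.move chir e).toConfig (q.trav chir e)).crossed i = q.crossed chir e i := by
  have : ∀ j, ((q.trav chir e) i ≠ none ∧
      (q.trav chir e) j = ((q.trav chir e) i).map fun x => (x.1, !x.2)) ↔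
      (q.moved chir e i ∧ q.moved chir e j ∧
        q.edge chir j = q.edge chir i ∧ q.sense chir j = !q.sense chir i) := by
    intro j
    unfold trav
    cases q.moved chir e i <;> cases q.moved chir e j <;> simp
  simp only [Config.crossed, toConfig, crossed, this]
  exact Multiset.filterMap_eq_map q.mem ▸ rfl

theorem decision_toConfig (t : Fin 3 → Option (ZMod n × Bool)) (i : Fin 3) :
    decision explorer (q.toConfig t) i =
      (q.mem i).step (t i).isSome (q.here i) ((q.toConfig t).crossed i) := by
  rw [← here_toConfig q t]
  rfl

/-- `hd` says that no deadline has passed. The record `t` of earlier traversals is arbitrary because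
`Mem.settle` never looks at it. -/
theorem next_even (t : Fin 3 → Option (ZMod n × Bool)) (hc : ∀ i, (q.mem i).clock % 2 = 0)
    (hd : ∀ i, ¬((q.mem i).dl ≠ 0 ∧ (q.mem i).dl ≤ (q.mem i).clock)) :
    next explorer chir e (q.toConfig t) =
      (q.settle.move chir e).toConfig (q.settle.trav chir e) := by
  have hdec : ∀ i, decision explorer (q.toConfig t) i =
      some (q.settle.mem i, some (q.settle.mem i).dir) := by
    intro i
    rw [decision_toConfig, Mem.step, if_pos (hc i), if_neg (hd i)]
    rfl
  have htr : traversal explorer chir e (q.toConfig t) = q.settle.trav chir e := by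
    funext i
    rw [traversal_of_some (hdec i)]
    simp only [trav, moved, ne_eq, decide_not, Bool.not_eq_true', decide_eq_false_iff_not, ite_not]
    rfl
  refine next_eq ?_ (fun i => by rw [hdec]; rfl) htr
  intro i
  rw [htr]
  simp only [toConfig, move, trav, edge]
  cases q.settle.moved chir e i <;> cases q.settle.sense chir i <;> simp <;> rfl

/-- Nobody moves in an odd round, so the edge `e'` removed there has no effect and only every second
choice of the adversary matters. -/
theorem next_odd (e' : Option (ZMod n)) (hc : ∀ i, (q.mem i).clock % 2 = 1) :
    next explorer chir e' ((q.move chir e).toConfig (q.trav chir e)) =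
      (q.finish chir e).toConfig fun _ => none := by
  have hdec : ∀ i, decision explorer ((q.move chir e).toConfig (q.trav chir e)) i =
      some ((q.finish chir e).mem i, none) := by
    intro i
    have h3 : ((q.trav chir e) i).isSome = q.moved chir e i := by
      unfold trav
      cases q.moved chir e i <;> simp
    have h4 : ¬((q.move chir e).mem i).clock % 2 = 0 := by
      have : ((q.move chir e).mem i).clock % 2 = 1 := hc i
      omega
    rw [decision_toConfig, Mem.step, if_neg h4, h3, crossed_toConfig]
    rfl
  have htr : traversal explorer chir e' ((q.move chir e).toConfig (q.trav chir e)) =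
      fun _ => none := by
    funext i
    exact traversal_of_none (hdec i)
  refine next_eq ?_ (fun i => by rw [hdec]; rfl) htr
  intro i
  rw [htr]
  rfl

theorem exists_mem_here {q : Snap n} {i : Fin 3} {p : Mem → Prop} :
    (∃ a ∈ q.here i, p a) ↔ ∃ j, j ≠ i ∧ q.pos j = q.pos i ∧ p (q.mem j) := by
  simp [here, and_assoc]

/-- The condition `j ≠ i` comes for free, since no robot has the sense opposite to its own. -/
theorem exists_mem_crossed {q : Snap n} {i : Fin 3} {p : Mem → Prop} :
    (∃ a ∈ q.crossed chir e i, p a) ↔ ∃ j, j ≠ i ∧ (q.moved chir e i ∧ q.moved chir e j ∧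
      q.edge chir j = q.edge chir i ∧ q.sense chir j = !q.sense chir i) ∧ p (q.mem j) := by
  simp only [crossed, Multiset.mem_map, Finset.mem_val, Finset.mem_filter, Finset.mem_univ,
    true_and]
  constructor
  · rintro ⟨a, ⟨j, hj, rfl⟩, hp⟩
    refine ⟨j, ?_, hj, hp⟩
    rintro rfl
    simp at hj
  · rintro ⟨j, -, hj, hp⟩
    exact ⟨_, ⟨j, hj, rfl⟩, hp⟩

theorem maxBlocks_here_le {q : Snap n} {i : Fin 3} {b : Bool} {B : ℕ} :
    Mem.maxBlocks (q.here i) b ≤ B ↔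
      ∀ j, j ≠ i → q.pos j = q.pos i → (q.mem j).side = b → (q.mem j).y ≤ B := by
  simp only [Mem.maxBlocks, here, Multiset.map_map, Multiset.sup_le, Multiset.mem_map,
    Finset.mem_val, Finset.mem_filter, Finset.mem_univ, true_and, Function.comp_apply]
  constructor
  · intro h j hj hp hs
    have := h _ ⟨j, ⟨hj, hp⟩, rfl⟩
    simpa [hs] using this
  · rintro h _ ⟨j, ⟨hj, hp⟩, rfl⟩
    split
    · exact h j hj hp ‹_›
    · exact Nat.zero_le _

end Snap

/-- The snapshots at the even rounds if terminated robots continued. -/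
noncomputable def snaps {n : ℕ} (id : Fin 3 → List Bool) (chir : Fin 3 → Bool)
    (start : Fin 3 → ZMod n) (adv : ℕ → Option (ZMod n)) : ℕ → Snap n
  | 0 => ⟨start, fun i => Mem.start (id i)⟩
  | s + 1 => (snaps id chir start adv s).round chir (adv (2 * s))

section

variable {n : ℕ} (id : Fin 3 → List Bool) (chir : Fin 3 → Bool)
  (start : Fin 3 → ZMod n) (adv : ℕ → Option (ZMod n))

theorem snaps_clock (s : ℕ) (i : Fin 3) : ((snaps id chir start adv s).mem i).clock = 2 * s := by
  induction s with
  | zero => rfl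
  | succ s ih =>
    have : ((snaps id chir start adv (s + 1)).mem i).clock =
      ((snaps id chir start adv s).mem i).clock + 1 + 1 := rfl
    omega

theorem snaps_code (s : ℕ) (i : Fin 3) :
    ((snaps id chir start adv s).mem i).code = (Mem.start (id i)).code := by
  induction s with
  | zero => rfl
  | succ s ih => exact ih

theorem snaps_len (s : ℕ) (i : Fin 3) :
    ((snaps id chir start adv s).mem i).len = (id i).length := by
  induction s with
  | zero => rfl
  | succ s ih => exact ih

/-- Snapshots ignore termination, so they describe the real run exactly until a deadline is reached.
The invariants can thus be proved for three robots that are always alive. -/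
theorem run_even (s : ℕ) (h : ∀ s' < s, ∀ i, ((snaps id chir start adv s').mem i).dl ≠ 0 →
    2 * s' < ((snaps id chir start adv s').mem i).dl) :
    run explorer id chir start adv (2 * s) =
      (snaps id chir start adv s).toConfig fun _ => none := by
  induction s with
  | zero => rfl
  | succ s ih =>
    have h1 := ih fun s' hs => h s' (by omega)
    have : 2 * (s + 1) = 2 * s + 1 + 1 := by ring
    rw [this]
    simp only [run]
    rw [h1, Snap.next_even, Snap.next_odd]
    · rfl
    · intro i
      simp only [Snap.settle, Mem.settle, snaps_clock]
      omega
    · intro i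
      rw [snaps_clock]
      omega
    · rintro i ⟨h2, h3⟩
      have := h s (by omega) i h2
      rw [snaps_clock] at h3
      omega

theorem run_odd (s : ℕ) (h : ∀ s' ≤ s, ∀ i, ((snaps id chir start adv s').mem i).dl ≠ 0 →
    2 * s' < ((snaps id chir start adv s').mem i).dl) :
    run explorer id chir start adv (2 * s + 1) =
      ((snaps id chir start adv s).settle.move chir (adv (2 * s))).toConfig
        ((snaps id chir start adv s).settle.trav chir (adv (2 * s))) := by
  simp only [run]
  rw [run_even id chir start adv s fun s' hs => h s' hs.le, Snap.next_even]
  · intro i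
    rw [snaps_clock]
    omega
  · rintro i ⟨h1, h2⟩
    have := h s le_rfl i h1
    rw [snaps_clock] at h2
    omega

end

end DynamicRing

/-! ### Invariants: unmet, paired, walking -/

namespace DynamicRing

theorem fin3_cases {i j l : Fin 3} (h₁ : i ≠ j) (h₂ : i ≠ l) (h₃ : j ≠ l) (m : Fin 3) :
    m = i ∨ m = j ∨ m = l := by
  revert i j l m
  decide

theorem exists_third (i j : Fin 3) : ∃ l, i ≠ l ∧ j ≠ l := by
  revert i j
  decide

/-- Positions are followed through integer lifts; this turns coincidences on the ring into
inequalities for `omega`. -/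
theorem le_of_intCast_eq {n : ℕ} {a b : ℤ} (h : (a : ZMod n) = b) (hlt : a < b) :
    (n : ℤ) ≤ b - a :=
  Int.le_of_dvd (by omega) ((ZMod.intCast_eq_intCast_iff_dvd_sub a b n).1 h)

namespace Snap

variable {n : ℕ} {chir : Fin 3 → Bool} {e : Option (ZMod n)} {q d : Snap n} {V V' : Set (ZMod n)}

/-- The adversary removes a single edge. This is how 1-interval connectivity enters all progress
arguments. -/
theorem edge_eq_of_not_moved {i j : Fin 3} (hi : d.moved chir e i = false)
    (hj : d.moved chir e j = false) : d.edge chir i = d.edge chir j := by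
  simp only [moved, ne_eq, decide_not, Bool.not_eq_false', decide_eq_true_eq] at hi hj
  rw [hi] at hj
  simpa using hj

theorem finish_pos (i : Fin 3) : (d.finish chir e).pos i =
    if d.moved chir e i then if d.sense chir i then d.pos i + 1 else d.pos i - 1 else d.pos i :=
  rfl

theorem finish_pos_left {i : Fin 3} {a : ℤ} (hs : d.sense chir i = false) (hp : d.pos i = a) :
    (d.finish chir e).pos i = ((a - (d.moved chir e i).toNat : ℤ) : ZMod n) := by
  rw [finish_pos, hs, hp]
  cases d.moved chir e i <;> simp

theorem finish_pos_right {i : Fin 3} {a : ℤ} (hs : d.sense chir i = true) (hp : d.pos i = a) :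
    (d.finish chir e).pos i = ((a + (d.moved chir e i).toNat : ℤ) : ZMod n) := by
  rw [finish_pos, hs, hp]
  cases d.moved chir e i <;> simp

theorem edge_left {i : Fin 3} {a : ℤ} (hs : d.sense chir i = false) (hp : d.pos i = a) :
    d.edge chir i = ((a - 1 : ℤ) : ZMod n) := by
  simp [edge, hs, hp]

theorem edge_right {i : Fin 3} {a : ℤ} (hs : d.sense chir i = true) (hp : d.pos i = a) :
    d.edge chir i = (a : ZMod n) := by
  simp [edge, hs, hp]

theorem settle_mem (i : Fin 3) : q.settle.mem i = (q.mem i).settle (q.here i) := rfl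

theorem settle_pos (i : Fin 3) : q.settle.pos i = q.pos i := rfl

theorem finish_mem (i : Fin 3) : (d.finish chir e).mem i = (d.mem i).observe
    (d.moved chir e i) ((d.move chir e).here i) (d.crossed chir e i) := rfl

theorem exists_mem_here_move {i : Fin 3} {p : Mem → Prop} :
    (∃ a ∈ (d.move chir e).here i, p a) ↔
      ∃ j, j ≠ i ∧ (d.finish chir e).pos j = (d.finish chir e).pos i ∧ p (d.mem j) :=
  exists_mem_here

theorem dl_settle {i : Fin 3} (h : (q.settle.mem i).dl ≠ 0) : ∃ j, (q.mem j).dl ≠ 0 := by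
  by_contra! h'
  apply h
  simp only [settle_mem, Mem.settle, exists_mem_here, h']
  simp

theorem dl_settle_ne_zero {i : Fin 3} (h : (q.mem i).dl ≠ 0) : (q.settle.mem i).dl ≠ 0 := by
  simp [settle_mem, Mem.settle, h]

/-- A walker notices that the ring is explored. -/
def Cert (chir : Fin 3 → Bool) (e : Option (ZMod n)) (d : Snap n) (i : Fin 3) : Prop :=
  (d.mem i).role = 2 ∧ ∃ j, j ≠ i ∧
    ((d.finish chir e).pos j = (d.finish chir e).pos i ∧ ((d.mem j).role = 2 ∨
      (d.mem j).role = 3 ∧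
        (d.mem i).x + (d.moved chir e i).toNat < (d.mem j).known (!(d.mem i).side)) ∨
    (d.moved chir e i ∧ d.moved chir e j ∧ d.edge chir j = d.edge chir i ∧
      d.sense chir j = !d.sense chir i) ∧ (d.mem j).role = 2)

/-- The four sources of knowledge: memory, company at the node, a crossed robot, a certificate of
one's own. -/
theorem dl_finish_iff {i : Fin 3} : ((d.finish chir e).mem i).dl ≠ 0 ↔ (d.mem i).dl ≠ 0 ∨
    (∃ j, j ≠ i ∧ (d.finish chir e).pos j = (d.finish chir e).pos i ∧ (d.mem j).dl ≠ 0) ∨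
    (∃ j, j ≠ i ∧ (d.moved chir e i ∧ d.moved chir e j ∧ d.edge chir j = d.edge chir i ∧
      d.sense chir j = !d.sense chir i) ∧ (d.mem j).dl ≠ 0) ∨ Cert chir e d i := by
  simp only [finish_mem, Mem.observe, exists_mem_here_move, exists_mem_crossed, Cert]
  split
  · rename_i h
    simp only [h.1, ne_eq, mul_eq_zero, not_or]
    refine ⟨fun _ => ?_, fun _ => by simp⟩
    rcases h.2 with h | h | ⟨h, h1 | h1 | h1⟩
    · exact Or.inr (Or.inl h)
    · exact Or.inr (Or.inr (Or.inl h))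
    · obtain ⟨j, hj, hp, h1⟩ := h1
      exact Or.inr (Or.inr (Or.inr ⟨h, j, hj, Or.inl ⟨hp, Or.inl h1⟩⟩))
    · obtain ⟨j, hj, hp, h1⟩ := h1
      exact Or.inr (Or.inr (Or.inr ⟨h, j, hj, Or.inr ⟨hp, h1⟩⟩))
    · obtain ⟨j, hj, hp, h1⟩ := h1
      exact Or.inr (Or.inr (Or.inr ⟨h, j, hj, Or.inl ⟨hp, Or.inr h1⟩⟩))
  · rename_i h
    refine ⟨Or.inl, ?_⟩
    rintro (h1 | h1 | h1 | ⟨h1, j, hj, ⟨h2, h3 | h3⟩ | ⟨h2, h3⟩⟩)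
    · exact h1
    · exact fun h0 => h ⟨h0, Or.inl h1⟩
    · exact fun h0 => h ⟨h0, Or.inr (Or.inl h1)⟩
    · exact fun h0 => h ⟨h0, Or.inr (Or.inr ⟨h1, Or.inl ⟨j, hj, h2, h3⟩⟩)⟩
    · exact fun h0 => h ⟨h0, Or.inr (Or.inr ⟨h1, Or.inr (Or.inr ⟨j, hj, h2, h3⟩)⟩)⟩
    · exact fun h0 => h ⟨h0, Or.inr (Or.inr ⟨h1, Or.inr (Or.inl ⟨j, hj, h2, h3⟩)⟩)⟩

theorem known_settle_le {i : Fin 3} {b : Bool} {B : ℕ} (h : (q.mem i).known b ≤ B)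
    (hB : ∀ j, j ≠ i → (q.mem j).side = b → (q.mem j).y ≤ B) :
    (q.settle.mem i).known b ≤ B := by
  have hm : Mem.maxBlocks (q.here i) b ≤ B := maxBlocks_here_le.2 fun j hj _ => hB j hj
  simp only [settle_mem, Mem.settle, Mem.known] at h ⊢
  cases b <;> simp only [if_true, Bool.false_eq_true, if_false] at h ⊢ <;> split <;>
    simp [*]

/-- The state in which two robots walk away from each other. `L` walks to the left and `R` to the
right; `a` and `b` are lifts of their positions. -/
structure Walk (chir : Fin 3 → Bool) (V : Set (ZMod n)) (q : Snap n) (L R X : Fin 3)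
    (a b : ℤ) : Prop where
  LR : L ≠ R
  LX : L ≠ X
  RX : R ≠ X
  roleL : (q.mem L).role = 2
  roleR : (q.mem R).role = 2
  roleX : (q.mem X).role = 0 ∨ (q.mem X).role = 3
  senseL : q.sense chir L = false
  senseR : q.sense chir R = true
  side : (q.mem L).side ≠ (q.mem R).side
  posL : q.pos L = (a : ZMod n)
  posR : q.pos R = (b : ZMod n)
  lt : a < b
  visited : ∀ z : ℤ, a ≤ z → z ≤ b → (z : ZMod n) ∈ V
  width : (∀ i, (q.mem i).dl = 0) → b - a ≤ (n : ℤ) - 1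
  moves : ((q.mem L).x : ℤ) + (q.mem R).x ≤ b - a
  count : (q.mem L).x + (q.mem L).y = (q.mem R).x + (q.mem R).y
  jam : (q.mem L).y ≤ (q.mem R).x ∨ (n : ℤ) - 1 ≤ b - a
  knownL : (q.mem X).known (q.mem L).side ≤ (q.mem L).y
  knownR : (q.mem X).known (q.mem R).side ≤ (q.mem R).y
  done : ∀ i, (q.mem i).dl ≠ 0 → (n : ℤ) - 1 ≤ b - a

namespace Walk

variable {L R X : Fin 3} {a b : ℤ}

theorem sense_settle_of_role_two {i : Fin 3} (h : (q.mem i).role = 2) :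
    q.settle.sense chir i = q.sense chir i := by
  simp [sense, settle_mem, Mem.settle, h]

theorem role_settle_of_two {i : Fin 3} (h : (q.mem i).role = 2) :
    (q.settle.mem i).role = 2 := by
  simp [settle_mem, Mem.settle, h]

/-- The delicate field is `roleX`: the only company a newcomer can find is a walker, so it becomes a
messenger and never starts a second pair. -/
theorem settle (hw : Walk chir V q L R X a b) : Walk chir V q.settle L R X a b where
  LR := hw.LR
  LX := hw.LX
  RX := hw.RX
  roleL := role_settle_of_two hw.roleL
  roleR := role_settle_of_two hw.roleR
  roleX := by
    have hX := hw.roleX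
    have hoth : ∀ j, j ≠ X → (q.mem j).role ≠ 0 := by
      intro j hj
      rcases fin3_cases hw.LR hw.LX hw.RX j with rfl | rfl | rfl
      · simp [hw.roleL]
      · simp [hw.roleR]
      · exact absurd rfl hj
    rcases hX with h | h
    · simp only [settle_mem, Mem.settle, h, if_true, exists_mem_here]
      split
      · exact Or.inr rfl
      · rename_i h1
        split
        · rename_i h2
          exfalso
          apply h1
          left
          rcases h2 with ⟨j, hj, hp, -⟩ | ⟨j, hj, hp, -⟩ <;> exact ⟨j, hj, hp, hoth j hj⟩
        · exact Or.inl rfl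
    · right
      simp [settle_mem, Mem.settle, h]
  senseL := by rw [sense_settle_of_role_two hw.roleL, hw.senseL]
  senseR := by rw [sense_settle_of_role_two hw.roleR, hw.senseR]
  side := by simpa [settle_mem, Mem.settle, hw.roleL, hw.roleR] using hw.side
  posL := hw.posL
  posR := hw.posR
  lt := hw.lt
  visited := hw.visited
  width h := hw.width fun i => not_not.1 fun hi => dl_settle_ne_zero hi (h i)
  moves := by simpa [settle_mem, Mem.settle, hw.roleL, hw.roleR] using hw.moves
  count := by simpa [settle_mem, Mem.settle, hw.roleL, hw.roleR] using hw.count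
  jam := by simpa [settle_mem, Mem.settle, hw.roleL, hw.roleR] using hw.jam
  knownL := by
    have h1 : (q.settle.mem L).side = (q.mem L).side := by
      simp [settle_mem, Mem.settle, hw.roleL]
    have h2 : (q.settle.mem L).y = (q.mem L).y := by simp [settle_mem, Mem.settle, hw.roleL]
    rw [h1, h2]
    refine known_settle_le hw.knownL fun j hj hs => ?_
    rcases fin3_cases hw.LR hw.LX hw.RX j with rfl | rfl | rfl
    · exact le_rfl
    · exact absurd hs.symm hw.side
    · exact absurd rfl hj
  knownR := by
    have h1 : (q.settle.mem R).side = (q.mem R).side := by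
      simp [settle_mem, Mem.settle, hw.roleR]
    have h2 : (q.settle.mem R).y = (q.mem R).y := by simp [settle_mem, Mem.settle, hw.roleR]
    rw [h1, h2]
    refine known_settle_le hw.knownR fun j hj hs => ?_
    rcases fin3_cases hw.LR hw.LX hw.RX j with rfl | rfl | rfl
    · exact absurd hs hw.side
    · exact le_rfl
    · exact absurd rfl hj
  done := fun i hi => by
    obtain ⟨j, hj⟩ := dl_settle hi
    exact hw.done j hj

/-- Soundness of the certificates. A failure of `L` without a success of `R` needs both to be
blocked, hence a common outward edge, hence an arc of at least `n - 1` edges; so a known number of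
failures above the other walker's successes proves exploration. -/
theorem finish (hw : Walk chir V d L R X a b) (hV : V ⊆ V')
    (hp : ∀ i, (d.finish chir e).pos i ∈ V') :
    Walk chir V' (d.finish chir e) L R X (a - (d.moved chir e L).toNat)
      (b + (d.moved chir e R).toNat) := by
  have hpL := finish_pos_left (e := e) hw.senseL hw.posL
  have hpR := finish_pos_right (e := e) hw.senseR hw.posR
  have heL := edge_left hw.senseL hw.posL
  have heR := edge_right hw.senseR hw.posR
  have hlt := hw.lt
  have hmL : ((d.moved chir e L).toNat : ℤ) ≤ 1 := by exact_mod_cast Bool.toNat_le _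
  have hmR : ((d.moved chir e R).toNat : ℤ) ≤ 1 := by exact_mod_cast Bool.toNat_le _
  -- The outward edges start at `a - 1` and `b`, so they coincide only if the arc omits at most one
  -- edge.
  have hedge : d.edge chir R = d.edge chir L → (n : ℤ) - 1 ≤ b - a := by
    intro h
    rw [heL, heR] at h
    have := le_of_intCast_eq h.symm (by omega)
    omega
  have sideL : ((d.finish chir e).mem L).side = (d.mem L).side := by
    simp [finish_mem, Mem.observe, hw.roleL]
  have sideR : ((d.finish chir e).mem R).side = (d.mem R).side := by
    simp [finish_mem, Mem.observe, hw.roleR]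
  have xL : ((d.finish chir e).mem L).x = (d.mem L).x + (d.moved chir e L).toNat := by
    simp [finish_mem, Mem.observe, hw.roleL]
  have xR : ((d.finish chir e).mem R).x = (d.mem R).x + (d.moved chir e R).toNat := by
    simp [finish_mem, Mem.observe, hw.roleR]
  have yL : ((d.finish chir e).mem L).y = (d.mem L).y + (!d.moved chir e L).toNat := by
    simp [finish_mem, Mem.observe, hw.roleL]
  have yR : ((d.finish chir e).mem R).y = (d.mem R).y + (!d.moved chir e R).toNat := by
    simp [finish_mem, Mem.observe, hw.roleR]
  have hX2 : (d.mem X).role ≠ 2 := by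
    rcases hw.roleX with h | h <;> simp [h]
  have kX : ∀ s, ((d.finish chir e).mem X).known s = (d.mem X).known s := by
    intro s
    simp [finish_mem, Mem.observe, hX2, Mem.known]
  have hcount : ((d.finish chir e).mem L).x + ((d.finish chir e).mem L).y =
      ((d.finish chir e).mem R).x + ((d.finish chir e).mem R).y := by
    have := hw.count
    rw [xL, xR, yL, yR]
    cases d.moved chir e L <;> cases d.moved chir e R <;> (simp; omega)
  have hjam : ((d.finish chir e).mem L).y ≤ ((d.finish chir e).mem R).x ∨ (n : ℤ) - 1 ≤
      b + (d.moved chir e R).toNat - (a - (d.moved chir e L).toNat) := by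
    rcases hw.jam with h | h
    · by_cases hb : d.moved chir e L = false ∧ d.moved chir e R = false
      · right
        have := hedge (edge_eq_of_not_moved hb.2 hb.1)
        omega
      · left
        rw [xR, yL]
        cases hl : d.moved chir e L <;> cases hr : d.moved chir e R <;> (simp_all; try omega)
    · right
      omega
  refine ⟨hw.LR, hw.LX, hw.RX, ?_, ?_, ?_, ?_, ?_, ?_, hpL, hpR, by omega, ?_, ?_, ?_, hcount,
    hjam, ?_, ?_, ?_⟩
  · simp [finish_mem, Mem.observe, hw.roleL]
  · simp [finish_mem, Mem.observe, hw.roleR]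
  · rcases hw.roleX with h | h
    · simp only [finish_mem, Mem.observe, h, if_true, exists_mem_crossed]
      split
      · rename_i h1
        obtain ⟨j, hj, -, h1⟩ := h1
        rcases fin3_cases hw.LR hw.LX hw.RX j with rfl | rfl | rfl
        · simp [hw.roleL] at h1
        · simp [hw.roleR] at h1
        · exact absurd rfl hj
      · split <;> simp
    · right
      simp [finish_mem, Mem.observe, h]
  · simpa [finish_mem, Mem.observe, hw.roleL, sense] using hw.senseL
  · simpa [finish_mem, Mem.observe, hw.roleR, sense] using hw.senseR
  · rw [sideL, sideR]
    exact hw.side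
  · intro z h1 h2
    by_cases h3 : z < a
    · have : z = a - (d.moved chir e L).toNat := by omega
      rw [this, ← hpL]
      exact hp L
    by_cases h4 : b < z
    · have : z = b + (d.moved chir e R).toNat := by omega
      rw [this, ← hpR]
      exact hp R
    · exact hV (hw.visited z (by omega) (by omega))
  · intro h0
    have hw0 := hw.width fun i => not_not.1 fun hi => dl_finish_iff.2 (Or.inl hi) (h0 i)
    have hcert : ¬Cert chir e d L := fun h => dl_finish_iff.2 (Or.inr (Or.inr (Or.inr h))) (h0 L)
    by_contra hlt'
    -- An arc that outgrows `n - 1` has length `n` (same node) or `n + 1` (the walkers crossed);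
    -- either way `L` would hold a certificate.
    by_cases h1 : b + (d.moved chir e R).toNat = a - (d.moved chir e L).toNat + n
    · refine hcert ⟨hw.roleL, R, hw.LR.symm, Or.inl ⟨?_, Or.inl hw.roleR⟩⟩
      rw [hpL, hpR, h1]
      simp
    · have h2 : (d.moved chir e L).toNat = 1 := by omega
      have h3 : (d.moved chir e R).toNat = 1 := by omega
      rw [Bool.toNat_eq_one] at h2 h3
      refine hcert ⟨hw.roleL, R, hw.LR.symm, Or.inr ⟨⟨h2, h3, ?_, ?_⟩, hw.roleR⟩⟩
      · have : b = a - 1 + n := by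
          simp only [h2, h3, Bool.toNat_true] at *
          omega
        rw [heL, heR, this]
        simp
      · rw [hw.senseL, hw.senseR]
        rfl
  · have := hw.moves
    rw [xL, xR]
    push_cast
    omega
  · rw [kX, sideL, yL]
    exact hw.knownL.trans (Nat.le_add_right _ _)
  · rw [kX, sideR, yR]
    exact hw.knownR.trans (Nat.le_add_right _ _)
  · intro i hi
    have hmono : (n : ℤ) - 1 ≤ b - a → (n : ℤ) - 1 ≤
      b + (d.moved chir e R).toNat - (a - (d.moved chir e L).toNat) := by omega
    rcases dl_finish_iff.1 hi with h | ⟨j, -, -, h⟩ | ⟨j, -, -, h⟩ | ⟨hr, j, hj, h⟩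
    · exact hmono (hw.done _ h)
    · exact hmono (hw.done _ h)
    · exact hmono (hw.done _ h)
    · have hmeet : (d.finish chir e).pos L = (d.finish chir e).pos R → (n : ℤ) - 1 ≤
          b + (d.moved chir e R).toNat - (a - (d.moved chir e L).toNat) := by
        intro h
        rw [hpL, hpR] at h
        have := le_of_intCast_eq h (by omega)
        omega
      rcases fin3_cases hw.LR hw.LX hw.RX i with rfl | rfl | rfl
      · rcases fin3_cases hw.LR hw.LX hw.RX j with rfl | rfl | rfl
        · exact absurd rfl hj
        · rcases h with ⟨h1, h2⟩ | ⟨⟨-, -, h1, -⟩, -⟩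
          · exact hmeet h1.symm
          · exact hmono (hedge h1)
        · rcases h with ⟨h1, h2 | ⟨-, h2⟩⟩ | ⟨-, h1⟩
          · exact absurd h2 hX2
          · rw [← Bool.eq_not_of_ne hw.side.symm] at h2
            -- `jam` compares only `y` of `L` with `x` of `R`; since both walkers made equally many
            -- attempts (`count`), it also bounds `y` of `R` by `x` of `L`.
            have := hw.knownR
            refine hjam.resolve_left fun h3 => ?_
            rw [xR, yL] at h3
            rw [xL, xR, yL, yR] at hcount
            omega
          · exact absurd h1 hX2
      · rcases fin3_cases hw.LR hw.LX hw.RX j with rfl | rfl | rfl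
        · rcases h with ⟨h1, h2⟩ | ⟨⟨-, -, h1, -⟩, -⟩
          · exact hmeet h1
          · exact hmono (hedge h1.symm)
        · exact absurd rfl hj
        · rcases h with ⟨h1, h2 | ⟨-, h2⟩⟩ | ⟨-, h1⟩
          · exact absurd h2 hX2
          · rw [← Bool.eq_not_of_ne hw.side] at h2
            have := hw.knownL
            refine hjam.resolve_left fun h3 => ?_
            rw [xR, yL] at h3
            omega
          · exact absurd h1 hX2
      · exact absurd hr hX2

theorem round (hw : Walk chir V q L R X a b) (hV : V ⊆ V')
    (hp : ∀ i, (q.round chir e).pos i ∈ V') :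
    Walk chir V' (q.round chir e) L R X (a - (q.settle.moved chir e L).toNat)
      (b + (q.settle.moved chir e R).toNat) :=
  hw.settle.finish hV hp

end Walk

/-- No robot has met another one. -/
structure Unmet (q : Snap n) : Prop where
  role : ∀ i, (q.mem i).role = 0
  x : ∀ i, (q.mem i).x = 0
  y : ∀ i, (q.mem i).y = 0
  dl : ∀ i, (q.mem i).dl = 0

/-- Robots `i` and `j` are at the same node and do not know their relative orientation. -/
structure Paired (q : Snap n) (i j l : Fin 3) : Prop where
  ij : i ≠ j
  il : i ≠ l
  jl : j ≠ l
  rolei : (q.mem i).role = 1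
  rolej : (q.mem j).role = 1
  rolel : (q.mem l).role = 0 ∨ (q.mem l).role = 3
  pos : q.pos i = q.pos j
  side : (q.mem i).side ≠ (q.mem j).side
  x : ∀ i, (q.mem i).x = 0
  y : ∀ i, (q.mem i).y = 0
  dl : ∀ i, (q.mem i).dl = 0

theorem Paired.symm {i j l : Fin 3} (h : Paired q i j l) : Paired q j i l :=
  ⟨h.ij.symm, h.jl, h.il, h.rolej, h.rolei, h.rolel, h.pos.symm, h.side.symm, h.x, h.y, h.dl⟩

theorem maxBlocks_eq_zero (hy : ∀ i, (q.mem i).y = 0) (i : Fin 3) (b : Bool) :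
    Mem.maxBlocks (q.here i) b = 0 :=
  Nat.le_zero.1 (maxBlocks_here_le.2 fun j _ _ _ => (hy j).le)

theorem x_settle_eq_zero (hx : ∀ i, (q.mem i).x = 0) (hy : ∀ i, (q.mem i).y = 0) (i : Fin 3) :
    (q.settle.mem i).x = 0 := by
  simp [settle_mem, Mem.settle, hx, maxBlocks_eq_zero hy]

theorem y_settle_eq_zero (hy : ∀ i, (q.mem i).y = 0) (i : Fin 3) :
    (q.settle.mem i).y = 0 := by
  simp [settle_mem, Mem.settle, hy, maxBlocks_eq_zero hy]

theorem dl_settle_eq_zero (h : ∀ i, (q.mem i).dl = 0) (i : Fin 3) :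
    (q.settle.mem i).dl = 0 := by
  by_contra h'
  obtain ⟨j, hj⟩ := dl_settle h'
  exact hj (h j)

theorem Paired.settle {i j l : Fin 3} (h : Paired q i j l) : Paired q.settle i j l where
  ij := h.ij
  il := h.il
  jl := h.jl
  rolei := by simp [settle_mem, Mem.settle, h.rolei]
  rolej := by simp [settle_mem, Mem.settle, h.rolej]
  rolel := by
    have hoth : ∀ m, m ≠ l → (q.mem m).role ≠ 0 := by
      intro m hm
      rcases fin3_cases h.ij h.il h.jl m with rfl | rfl | rfl
      · simp [h.rolei]
      · simp [h.rolej]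
      · exact absurd rfl hm
    rcases h.rolel with h | h
    · simp only [settle_mem, Mem.settle, h, if_true, exists_mem_here]
      split
      · exact Or.inr rfl
      · rename_i h1
        split
        · rename_i h2
          exfalso
          apply h1
          left
          rcases h2 with ⟨j, hj, hp, -⟩ | ⟨j, hj, hp, -⟩ <;> exact ⟨j, hj, hp, hoth j hj⟩
        · exact Or.inl rfl
    · right
      simp [settle_mem, Mem.settle, h]
  pos := h.pos
  side := by simpa [settle_mem, Mem.settle, h.rolei, h.rolej] using h.side
  x := x_settle_eq_zero h.x h.y
  y := y_settle_eq_zero h.y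
  dl := dl_settle_eq_zero h.dl

theorem Paired.sense_settle {i j l : Fin 3} (h : Paired q i j l) :
    q.settle.sense chir i = q.sense chir i := by
  simp [sense, settle_mem, Mem.settle, h.rolei]

theorem x_finish_eq_zero {i : Fin 3} (hr : (d.mem i).role ≠ 2) (h : (d.mem i).x = 0) :
    ((d.finish chir e).mem i).x = 0 := by
  simp [finish_mem, Mem.observe, hr, h]

theorem y_finish_eq_zero {i : Fin 3} (hr : (d.mem i).role ≠ 2) (h : (d.mem i).y = 0) :
    ((d.finish chir e).mem i).y = 0 := by
  simp [finish_mem, Mem.observe, hr, h]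

theorem dl_finish_eq_zero {i : Fin 3} (hr : (d.mem i).role ≠ 2) (h : ∀ i, (d.mem i).dl = 0) :
    ((d.finish chir e).mem i).dl = 0 := by
  by_contra h'
  rcases dl_finish_iff.1 h' with h1 | ⟨j, -, -, h1⟩ | ⟨j, -, -, h1⟩ | ⟨h1, -⟩
  · exact h1 (h _)
  · exact h1 (h _)
  · exact h1 (h _)
  · exact hr h1

theorem Paired.role_ne_two {i j l : Fin 3} (h : Paired q i j l) (m : Fin 3) :
    (q.mem m).role ≠ 2 := by
  rcases fin3_cases h.ij h.il h.jl m with rfl | rfl | rfl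
  · simp [h.rolei]
  · simp [h.rolej]
  · rcases h.rolel with h | h <;> simp [h]

theorem Paired.rolel_finish {i j l : Fin 3} (h : Paired d i j l) :
    ((d.finish chir e).mem l).role = 0 ∨ ((d.finish chir e).mem l).role = 3 := by
  rcases h.rolel with hl | hl
  · simp only [finish_mem, Mem.observe, hl, if_true, exists_mem_crossed]
    split
    · rename_i h1
      obtain ⟨m, hm, -, h1⟩ := h1
      rcases fin3_cases h.ij h.il h.jl m with rfl | rfl | rfl
      · simp [h.rolei] at h1
      · simp [h.rolej] at h1
      · exact absurd rfl hm
    · split <;> simp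
  · right
    simp [finish_mem, Mem.observe, hl]

/-- With equal senses both robots use the same edge and stay together whatever the adversary does.
Being together reveals the agreement, and exactly the robot with `side = true` turns round. -/
theorem Paired.finish_of_sense_eq {i j l : Fin 3} (h : Paired d i j l)
    (hs : d.sense chir i = d.sense chir j) :
    Paired (d.finish chir e) i j l ∧
      (d.finish chir e).sense chir i ≠ (d.finish chir e).sense chir j := by
  have hpos : (d.finish chir e).pos i = (d.finish chir e).pos j := by
    simp only [finish_pos, moved, edge, hs, h.pos]
    rfl
  have hi : ∃ a ∈ (d.move chir e).here i, a.role = 1 :=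
    exists_mem_here_move.2 ⟨j, h.ij.symm, hpos.symm, h.rolej⟩
  have hj : ∃ a ∈ (d.move chir e).here j, a.role = 1 :=
    exists_mem_here_move.2 ⟨i, h.ij, hpos, h.rolei⟩
  refine ⟨⟨h.ij, h.il, h.jl, ?_, ?_, h.rolel_finish, hpos, ?_, ?_, ?_, ?_⟩, ?_⟩
  · simp only [finish_mem, Mem.observe, h.rolei]
    rw [if_pos hi]
    rfl
  · simp only [finish_mem, Mem.observe, h.rolej]
    rw [if_pos hj]
    rfl
  · simpa [finish_mem, Mem.observe, h.rolei, h.rolej] using h.side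
  · exact fun m => x_finish_eq_zero (h.role_ne_two m) (h.x m)
  · exact fun m => y_finish_eq_zero (h.role_ne_two m) (h.y m)
  · exact fun m => dl_finish_eq_zero (h.role_ne_two m) h.dl
  · have hside := h.side
    simp only [sense] at hs ⊢
    simp only [finish_mem, Mem.observe]
    rw [if_pos ⟨h.rolei, hi⟩, if_pos ⟨h.rolej, hj⟩]
    revert hs hside
    cases (d.mem i).dir <;> cases (d.mem j).dir <;> cases (d.mem i).side <;>
      cases (d.mem j).side <;> cases chir i <;> cases chir j <;> simp

/-- The two outward edges differ, so at least one robot moves; the distance becomes 1 or 2, which is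
less than `n`, so the separation is visible and both become walkers. -/
theorem Paired.finish_of_sense_ne {L R X : Fin 3} (hn : 3 ≤ n) (h : Paired d L R X)
    (hL : d.sense chir L = false) (hR : d.sense chir R = true)
    (hV : d.pos L ∈ V') (hp : ∀ i, (d.finish chir e).pos i ∈ V') :
    ∃ a b, Walk chir V' (d.finish chir e) L R X a b := by
  obtain ⟨c, hc⟩ := ZMod.intCast_surjective (d.pos L)
  have hcR : d.pos R = (c : ZMod n) := by rw [← h.pos, hc]
  have hpL := finish_pos_left (e := e) hL hc.symm
  have hpR := finish_pos_right (e := e) hR hcR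
  have hmL : ((d.moved chir e L).toNat : ℤ) ≤ 1 := by exact_mod_cast Bool.toNat_le _
  have hmR : ((d.moved chir e R).toNat : ℤ) ≤ 1 := by exact_mod_cast Bool.toNat_le _
  have hlt : c - (d.moved chir e L).toNat < c + (d.moved chir e R).toNat := by
    by_contra hlt
    have h1 : d.moved chir e L = false := by
      by_contra h1
      simp only [Bool.not_eq_false] at h1
      simp [h1] at hlt
    have h2 : d.moved chir e R = false := by
      by_contra h2
      simp only [Bool.not_eq_false] at h2
      simp [h2] at hlt
    have h3 := edge_eq_of_not_moved h1 h2
    rw [edge_left hL hc.symm, edge_right hR hcR] at h3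
    have := le_of_intCast_eq h3 (by omega)
    omega
  have hne : (d.finish chir e).pos L ≠ (d.finish chir e).pos R := by
    intro h1
    rw [hpL, hpR] at h1
    have := le_of_intCast_eq h1 hlt
    omega
  have hX1 : (d.mem X).role ≠ 1 := by
    rcases h.rolel with h | h <;> simp [h]
  have hhL : ¬∃ a ∈ (d.move chir e).here L, a.role = 1 := by
    rw [exists_mem_here_move]
    rintro ⟨m, hm, hpm, hr⟩
    rcases fin3_cases h.ij h.il h.jl m with rfl | rfl | rfl
    · exact hm rfl
    · exact hne hpm.symm
    · exact hX1 hr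
  have hhR : ¬∃ a ∈ (d.move chir e).here R, a.role = 1 := by
    rw [exists_mem_here_move]
    rintro ⟨m, hm, hpm, hr⟩
    rcases fin3_cases h.ij h.il h.jl m with rfl | rfl | rfl
    · exact hne hpm
    · exact hm rfl
    · exact hX1 hr
  have hx := fun m => x_finish_eq_zero (chir := chir) (e := e) (h.role_ne_two m) (h.x m)
  have hy := fun m => y_finish_eq_zero (chir := chir) (e := e) (h.role_ne_two m) (h.y m)
  refine ⟨_, _, h.ij, h.il, h.jl, ?_, ?_, h.rolel_finish, ?_, ?_, ?_, hpL, hpR, hlt, ?_,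
    fun _ => by omega, ?_, ?_, ?_, ?_, ?_, ?_⟩
  · simp only [finish_mem, Mem.observe, h.rolei]
    rw [if_neg hhL]
    rfl
  · simp only [finish_mem, Mem.observe, h.rolej]
    rw [if_neg hhR]
    rfl
  · simp only [sense, finish_mem, Mem.observe]
    rw [if_neg fun h => hhL h.2]
    exact hL
  · simp only [sense, finish_mem, Mem.observe]
    rw [if_neg fun h => hhR h.2]
    exact hR
  · simpa [finish_mem, Mem.observe, h.rolei, h.rolej] using h.side
  · intro z h1 h2
    by_cases h3 : z < c
    · have : z = c - (d.moved chir e L).toNat := by omega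
      rw [this, ← hpL]
      exact hp L
    by_cases h4 : c < z
    · have : z = c + (d.moved chir e R).toNat := by omega
      rw [this, ← hpR]
      exact hp R
    · have : z = c := by omega
      rw [this, hc]
      exact hV
  · simp only [hx, Nat.cast_zero]
    omega
  · simp [hx, hy]
  · simp [hx, hy]
  · simp [Mem.known, hx, hy]
  · simp [Mem.known, hx, hy]
  · intro i hi
    exact absurd (dl_finish_eq_zero (h.role_ne_two i) h.dl) hi

theorem Unmet.settle_of_injective (h : Unmet q) (hp : Function.Injective q.pos) :
    Unmet q.settle where
  role i := by
    have : ∀ p : Mem → Prop, ¬∃ a ∈ q.here i, p a := by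
      intro p
      rw [exists_mem_here]
      rintro ⟨j, hj, hpj, -⟩
      exact hj (hp hpj)
    simp only [settle_mem, Mem.settle, h.role, this]
    simp
  x := x_settle_eq_zero h.x h.y
  y := y_settle_eq_zero h.y
  dl := dl_settle_eq_zero h.dl

/-- If all three robots share the node, the smallest and largest codes form the pair and the middle
one becomes the messenger. -/
theorem Unmet.settle_of_pos_eq (h : Unmet q) (hc : Function.Injective fun i => (q.mem i).code)
    (hp : ¬Function.Injective q.pos) : ∃ i j l, Paired q.settle i j l := by
  have hx := x_settle_eq_zero h.x h.y
  have hy := y_settle_eq_zero h.y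
  have hdl := dl_settle_eq_zero h.dl
  have key : ∀ i j l, i ≠ j → i ≠ l → j ≠ l → q.pos i = q.pos j →
      (q.mem i).code < (q.mem j).code →
      (q.pos l = q.pos i → (q.mem i).code < (q.mem l).code ∧ (q.mem l).code < (q.mem j).code) →
      Paired q.settle i j l := by
    intro i j l hij hil hjl hpos hcode hl
    have hi : ¬∃ a ∈ q.here i, a.code < (q.mem i).code := by
      rw [exists_mem_here]
      rintro ⟨m, hm, hpm, hlt⟩
      rcases fin3_cases hij hil hjl m with rfl | rfl | rfl
      · exact hm rfl
      · omega
      · have := hl hpm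
        omega
    have hj : ¬∃ a ∈ q.here j, a.code > (q.mem j).code := by
      rw [exists_mem_here]
      rintro ⟨m, hm, hpm, hlt⟩
      rcases fin3_cases hij hil hjl m with rfl | rfl | rfl
      · omega
      · exact hm rfl
      · have := hl (hpm.trans hpos.symm)
        omega
    have hi' : ∃ a ∈ q.here i, a.code > (q.mem i).code :=
      exists_mem_here.2 ⟨j, hij.symm, hpos.symm, hcode⟩
    have hj' : ∃ a ∈ q.here j, a.code < (q.mem j).code :=
      exists_mem_here.2 ⟨i, hij, hpos, hcode⟩
    have h0 : ∀ m, ¬∃ a ∈ q.here m, a.role ≠ 0 := by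
      intro m
      rw [exists_mem_here]
      rintro ⟨m', -, -, h1⟩
      exact h1 (h.role _)
    refine ⟨hij, hil, hjl, ?_, ?_, ?_, hpos, ?_, hx, hy, hdl⟩
    · simp only [settle_mem, Mem.settle, h.role, h0, hi, hi']
      simp
    · simp only [settle_mem, Mem.settle, h.role, h0, hj, hj']
      simp
    · by_cases hpl : q.pos l = q.pos i
      · right
        have h1 : ∃ a ∈ q.here l, a.code < (q.mem l).code :=
          exists_mem_here.2 ⟨i, hil, hpl.symm, (hl hpl).1⟩
        have h2 : ∃ a ∈ q.here l, a.code > (q.mem l).code :=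
          exists_mem_here.2 ⟨j, hjl, hpos.symm.trans hpl.symm, (hl hpl).2⟩
        simp only [settle_mem, Mem.settle, h.role, if_true]
        rw [if_pos (Or.inr ⟨h1, h2⟩)]
      · left
        have : ∀ p : Mem → Prop, ¬∃ a ∈ q.here l, p a := by
          intro p
          rw [exists_mem_here]
          rintro ⟨m, hm, hpm, -⟩
          rcases fin3_cases hij hil hjl m with rfl | rfl | rfl
          · exact hpl hpm.symm
          · exact hpl (hpos.trans hpm).symm
          · exact hm rfl
        simp only [settle_mem, Mem.settle, h.role, this]
        simp
    · simp only [settle_mem, Mem.settle, h.role, hi, hj']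
      simp
  simp only [Function.Injective, not_forall] at hp
  obtain ⟨i, j, hpos, hij⟩ := hp
  have hij : i ≠ j := hij
  obtain ⟨l, hil, hjl⟩ := exists_third i j
  have h1 : (q.mem i).code ≠ (q.mem j).code := fun h => hij (hc h)
  have h2 : (q.mem i).code ≠ (q.mem l).code := fun h => hil (hc h)
  have h3 : (q.mem j).code ≠ (q.mem l).code := fun h => hjl (hc h)
  by_cases hl : q.pos l = q.pos i
  · have hl' : q.pos l = q.pos j := hl.trans hpos
    -- Six of the eight sign patterns are orderings of the three codes; the other two are
    -- contradictory.
    rcases lt_or_gt_of_ne h1 with h1 | h1 <;> rcases lt_or_gt_of_ne h2 with h2 | h2 <;>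
      rcases lt_or_gt_of_ne h3 with h3 | h3
    · exact ⟨i, l, j, key i l j hil hij hjl.symm hl.symm h2 fun _ => ⟨h1, h3⟩⟩
    · exact ⟨i, j, l, key i j l hij hil hjl hpos h1 fun _ => ⟨h2, h3⟩⟩
    · omega
    · exact ⟨l, j, i, key l j i hjl.symm hil.symm hij.symm hl' h3 fun _ => ⟨h2, h1⟩⟩
    · exact ⟨j, l, i, key j l i hjl hij.symm hil.symm hl'.symm h3 fun _ => ⟨h1, h2⟩⟩
    · omega
    · exact ⟨j, i, l, key j i l hij.symm hjl hil hpos.symm h1 fun _ => ⟨h3, h2⟩⟩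
    · exact ⟨l, i, j, key l i j hil.symm hjl.symm hij hl h2 fun _ => ⟨h3, h1⟩⟩
  · rcases lt_or_gt_of_ne h1 with h1 | h1
    · exact ⟨i, j, l, key i j l hij hil hjl hpos h1 fun h => absurd h hl⟩
    · exact ⟨j, i, l, key j i l hij.symm hjl hil hpos.symm h1
        fun h => absurd (h.trans hpos.symm) hl⟩

/-- Two robots cross in the next move. -/
def Crossing (chir : Fin 3 → Bool) (e : Option (ZMod n)) (d : Snap n) (i j : Fin 3) : Prop :=
  d.moved chir e i ∧ d.moved chir e j ∧ d.edge chir j = d.edge chir i ∧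
    d.sense chir j = !d.sense chir i

theorem Unmet.finish_of_not_crossing (h : Unmet d) (hc : ∀ i j, ¬Crossing chir e d i j) :
    Unmet (d.finish chir e) where
  role i := by
    have : ∀ p : Mem → Prop, ¬∃ a ∈ d.crossed chir e i, p a := by
      intro p
      rw [exists_mem_crossed]
      rintro ⟨j, -, hj, -⟩
      exact hc i j hj
    simp only [finish_mem, Mem.observe, h.role, this]
    simp
  x i := x_finish_eq_zero (by simp [h.role]) (h.x i)
  y i := y_finish_eq_zero (by simp [h.role]) (h.y i)
  dl i := dl_finish_eq_zero (by simp [h.role]) h.dl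

/-- Robots that cross already diverge and know that their senses are opposite, so they become
walkers at once. Injectivity of the positions keeps the third robot out: to cross one of the two it
would have to start at the node of the other. -/
theorem Unmet.finish_of_crossing (hn : 3 ≤ n) (h : Unmet d) (hp : Function.Injective d.pos)
    (hc : Function.Injective fun i => (d.mem i).code) {L R : Fin 3}
    (hcr : Crossing chir e d L R) (hL : d.sense chir L = false)
    (hV : ∀ i, (d.finish chir e).pos i ∈ V') :
    ∃ X a b, Walk chir V' (d.finish chir e) L R X a b := by
  obtain ⟨hmL, hmR, hedge, hR⟩ := hcr
  rw [hL, Bool.not_false] at hR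
  have hLR : L ≠ R := by
    rintro rfl
    simp [hL] at hR
  obtain ⟨X, hLX, hRX⟩ := exists_third L R
  obtain ⟨c, hcR⟩ := ZMod.intCast_surjective (d.pos R)
  have hcL : d.pos L = ((c + 1 : ℤ) : ZMod n) := by
    have : d.pos R = d.pos L - 1 := by simpa [edge, hL, hR] using hedge
    push_cast
    rw [hcR, this]
    ring
  have hpL := finish_pos_left (e := e) hL hcL
  have hpR := finish_pos_right (e := e) hR hcR.symm
  rw [hmL] at hpL
  rw [hmR] at hpR
  have hpL : (d.finish chir e).pos L = (c : ZMod n) := by simpa using hpL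
  have hpR : (d.finish chir e).pos R = ((c + 1 : ℤ) : ZMod n) := by simpa using hpR
  have hX : ∀ j, ¬Crossing chir e d X j ∧ ¬Crossing chir e d j X := by
    have aux : ∀ Y, X ≠ Y → ¬Crossing chir e d X Y → ¬Crossing chir e d Y X := by
      rintro Y - hY ⟨h1, h2, h3, h4⟩
      exact hY ⟨h2, h1, h3.symm, by rw [h4, Bool.not_not]⟩
    have hXL : ¬Crossing chir e d X L := by
      rintro ⟨-, -, h3, h4⟩
      apply hRX
      apply hp
      have h5 : d.sense chir X = true := by simpa [hL] using h4
      have : d.edge chir R = d.edge chir X := hedge.trans h3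
      simpa [edge, h5, hR] using this
    have hXR : ¬Crossing chir e d X R := by
      rintro ⟨-, -, h3, h4⟩
      apply hLX
      apply hp
      have h5 : d.sense chir X = false := by simpa [hR] using h4
      have : d.edge chir L = d.edge chir X := hedge.symm.trans h3
      simpa [edge, h5, hL] using this
    have hXX : ¬Crossing chir e d X X := by
      rintro ⟨-, -, -, h4⟩
      simp at h4
    intro j
    rcases fin3_cases hLR hLX hRX j with rfl | rfl | rfl
    · exact ⟨hXL, aux _ hLX.symm hXL⟩
    · exact ⟨hXR, aux _ hRX.symm hXR⟩
    · exact ⟨hXX, hXX⟩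
  have hcL' : ∀ p : Mem → Prop, (∃ a ∈ d.crossed chir e L, p a) ↔ p (d.mem R) := by
    intro p
    rw [exists_mem_crossed]
    constructor
    · rintro ⟨j, hj, hj', hpj⟩
      rcases fin3_cases hLR hLX hRX j with rfl | rfl | rfl
      · exact absurd rfl hj
      · exact hpj
      · exact absurd hj' (hX _).2
    · exact fun hpR => ⟨R, hLR.symm, ⟨hmL, hmR, hedge, by rw [hL, hR]; rfl⟩, hpR⟩
  have hcR' : ∀ p : Mem → Prop, (∃ a ∈ d.crossed chir e R, p a) ↔ p (d.mem L) := by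
    intro p
    rw [exists_mem_crossed]
    constructor
    · rintro ⟨j, hj, hj', hpj⟩
      rcases fin3_cases hLR hLX hRX j with rfl | rfl | rfl
      · exact hpj
      · exact absurd rfl hj
      · exact absurd hj' (hX _).2
    · exact fun hpL => ⟨L, hLR, ⟨hmR, hmL, hedge.symm, by rw [hL, hR]; rfl⟩, hpL⟩
  have hcX : ∀ p : Mem → Prop, ¬∃ a ∈ d.crossed chir e X, p a := by
    intro p
    rw [exists_mem_crossed]
    rintro ⟨j, -, hj, -⟩
    exact (hX j).1 hj
  have hx := fun m => x_finish_eq_zero (chir := chir) (e := e)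
    (by simp [h.role] : (d.mem m).role ≠ 2) (h.x m)
  have hy := fun m => y_finish_eq_zero (chir := chir) (e := e)
    (by simp [h.role] : (d.mem m).role ≠ 2) (h.y m)
  have hcode : (d.mem L).code ≠ (d.mem R).code := fun h => hLR (hc h)
  refine ⟨X, c, c + 1, hLR, hLX, hRX, ?_, ?_, Or.inl ?_, ?_, ?_, ?_, hpL, hpR, by omega, ?_,
    fun _ => by omega, by simp [hx], ?_, ?_, ?_, ?_, ?_⟩
  · simp only [finish_mem, Mem.observe, h.role, hcL']
    simp
  · simp only [finish_mem, Mem.observe, h.role, hcR']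
    simp
  · simp only [finish_mem, Mem.observe, h.role, hcX]
    simp
  · simpa [sense, finish_mem, Mem.observe, h.role] using hL
  · simpa [sense, finish_mem, Mem.observe, h.role] using hR
  · simp only [finish_mem, Mem.observe, h.role, hcL', hcR']
    simp only [if_true, ne_eq, decide_eq_decide]
    omega
  · intro z h1 h2
    by_cases h3 : z = c
    · rw [h3, ← hpL]
      exact hV L
    · have : z = c + 1 := by omega
      rw [this, ← hpR]
      exact hV R
  · simp [hx, hy]
  · simp [hx, hy]
  · simp [Mem.known, hx, hy]
  · simp [Mem.known, hx, hy]
  · intro i hi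
    exact absurd (dl_finish_eq_zero (by simp [h.role]) h.dl) hi

/-- The states of an execution. -/
inductive Phase (chir : Fin 3 → Bool) (V : Set (ZMod n)) (q : Snap n) : Prop
  | unmet (h : Unmet q)
  | paired (i j l : Fin 3) (h : Paired q i j l)
  | walk (L R X : Fin 3) (a b : ℤ) (h : Walk chir V q L R X a b)

theorem Paired.round {i j l : Fin 3} (hn : 3 ≤ n) (h : Paired d i j l) (hV : d.pos i ∈ V')
    (hp : ∀ i, (d.finish chir e).pos i ∈ V') :
    (Paired (d.finish chir e) i j l ∧
      (d.finish chir e).sense chir i ≠ (d.finish chir e).sense chir j ∧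
      d.sense chir i = d.sense chir j) ∨
    ∃ L R X a b, Walk chir V' (d.finish chir e) L R X a b := by
  by_cases hs : d.sense chir i = d.sense chir j
  · exact Or.inl ⟨(h.finish_of_sense_eq hs).1, (h.finish_of_sense_eq hs).2, hs⟩
  · right
    cases hi : d.sense chir i
    · have hj : d.sense chir j = true := by simpa [hi] using hs
      exact ⟨i, j, l, h.finish_of_sense_ne hn hi hj hV hp⟩
    · have hj : d.sense chir j = false := by simpa [hi] using hs
      exact ⟨j, i, l, h.symm.finish_of_sense_ne hn hj hi (h.pos ▸ hV) hp⟩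

theorem Unmet.round (hn : 3 ≤ n) (h : Unmet q) (hc : Function.Injective fun i => (q.mem i).code)
    (hV : ∀ i, q.pos i ∈ V') (hp : ∀ i, (q.round chir e).pos i ∈ V') :
    Phase chir V' (q.round chir e) := by
  by_cases hpos : Function.Injective q.pos
  · have h1 := h.settle_of_injective hpos
    by_cases hcr : ∃ i j, Crossing chir e q.settle i j
    · obtain ⟨i, j, hij⟩ := hcr
      have hc' : Function.Injective fun i => (q.settle.mem i).code := hc
      cases hi : q.settle.sense chir i
      · obtain ⟨X, a, b, hw⟩ := h1.finish_of_crossing hn hpos hc' hij hi hp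
        exact .walk _ _ _ _ _ hw
      · have hij' : Crossing chir e q.settle j i :=
          ⟨hij.2.1, hij.1, hij.2.2.1.symm, by rw [hij.2.2.2, Bool.not_not]⟩
        have hj : q.settle.sense chir j = false := by rw [hij.2.2.2, hi]; rfl
        obtain ⟨X, a, b, hw⟩ := h1.finish_of_crossing hn hpos hc' hij' hj hp
        exact .walk _ _ _ _ _ hw
    · exact .unmet (h1.finish_of_not_crossing fun i j h => hcr ⟨i, j, h⟩)
  · obtain ⟨i, j, l, h1⟩ := h.settle_of_pos_eq hc hpos
    rcases h1.round hn (hV i) hp with ⟨h2, -⟩ | ⟨L, R, X, a, b, hw⟩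
    · exact .paired _ _ _ h2
    · exact .walk _ _ _ _ _ hw

end Snap

end DynamicRing

/-! ### The jam: both walkers stuck at one missing edge -/

namespace DynamicRing

namespace Snap

variable {n : ℕ} {chir : Fin 3 → Bool} {e : Option (ZMod n)} {q d : Snap n} {V : Set (ZMod n)}

/-- Either some walker moves, or both are blocked by one edge, which then closes the arc to the
whole ring. -/
theorem Walk.progress {L R X : Fin 3} {a b : ℤ} (hw : Walk chir V d L R X a b)
    (h0 : ∀ i, ((d.finish chir e).mem i).dl = 0) :
    b - a + 1 ≤ b + (d.moved chir e R).toNat - (a - (d.moved chir e L).toNat) ∨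
      d.moved chir e L = false ∧ d.moved chir e R = false ∧ b - a = (n : ℤ) - 1 := by
  have hlt := hw.lt
  have hw0 := hw.width fun i => not_not.1 fun hi => dl_finish_iff.2 (Or.inl hi) (h0 i)
  cases hl : d.moved chir e L <;> cases hr : d.moved chir e R
  · right
    have h := edge_eq_of_not_moved hl hr
    rw [edge_left hw.senseL hw.posL, edge_right hw.senseR hw.posR] at h
    have := le_of_intCast_eq h (by omega)
    exact ⟨rfl, rfl, by omega⟩
  all_goals
    left
    simp
    try omega

/-- The direction away from the missing edge for a robot stuck in sense `b`. -/
def away (n : ℕ) (b : Bool) : ZMod n := if b then -1 else 1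

/-- The walkers are stuck at the two ends of the missing edge. -/
structure Jam (chir : Fin 3 → Bool) (e : Option (ZMod n)) (q : Snap n) (W W' X : Fin 3) :
    Prop where
  WW : W ≠ W'
  WX : W ≠ X
  WX' : W' ≠ X
  role : (q.mem W).role = 2
  role' : (q.mem W').role = 2
  roleX : (q.mem X).role = 0 ∨ (q.mem X).role = 3
  sense : q.sense chir W' = !q.sense chir W
  side : (q.mem W').side = !(q.mem W).side
  pos : q.pos W' = q.pos W - away n (q.sense chir W)
  stuck : q.settle.moved chir e W = false
  stuck' : q.settle.moved chir e W' = false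

theorem Walk.toJam {L R X : Fin 3} {a b : ℤ} (hw : Walk chir V q L R X a b)
    (hab : b - a = (n : ℤ) - 1) (hL : q.settle.moved chir e L = false)
    (hR : q.settle.moved chir e R = false) : Jam chir e q L R X where
  WW := hw.LR
  WX := hw.LX
  WX' := hw.RX
  role := hw.roleL
  role' := hw.roleR
  roleX := hw.roleX
  sense := by rw [hw.senseL, hw.senseR]; rfl
  side := Bool.eq_not_of_ne hw.side.symm
  pos := by
    have : b = a - 1 + n := by omega
    rw [hw.posL, hw.posR, hw.senseL, this]
    simp [away]
  stuck := hL
  stuck' := hR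

namespace Jam

variable {W W' X : Fin 3}

/-- Unlike `Walk`, a jam does not fix which walker is the left one, so each argument is made for one
walker only. -/
theorem symm (h : Jam chir e q W W' X) : Jam chir e q W' W X where
  WW := h.WW.symm
  WX := h.WX'
  WX' := h.WX
  role := h.role'
  role' := h.role
  roleX := h.roleX
  sense := by rw [h.sense, Bool.not_not]
  side := by rw [h.side, Bool.not_not]
  pos := by
    rw [h.pos, h.sense]
    cases q.sense chir W <;> simp [away]
  stuck := h.stuck'
  stuck' := h.stuck

theorem round_pos (h : Jam chir e q W W' X) : (q.round chir e).pos W = q.pos W := by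
  rw [Snap.round, finish_pos, h.stuck]
  rfl

theorem round_sense (h : Jam chir e q W W' X) :
    (q.round chir e).sense chir W = q.sense chir W := by
  rw [← Walk.sense_settle_of_role_two h.role]
  have := Walk.role_settle_of_two h.role
  simp [Snap.round, Snap.sense, finish_mem, Mem.observe, this]

theorem round_y (h : Jam chir e q W W' X) :
    ((q.round chir e).mem W).y = (q.mem W).y + 1 := by
  have := Walk.role_settle_of_two h.role
  have h1 : (q.settle.mem W).y = (q.mem W).y := by simp [settle_mem, Mem.settle, h.role]
  simp [Snap.round, finish_mem, Mem.observe, this, h.stuck, h1]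

theorem round_side (h : Jam chir e q W W' X) :
    ((q.round chir e).mem W).side = (q.mem W).side := by
  have := Walk.role_settle_of_two h.role
  have h1 : (q.settle.mem W).side = (q.mem W).side := by simp [settle_mem, Mem.settle, h.role]
  simp [Snap.round, finish_mem, Mem.observe, this, h1]

/-- In a jam, with `b` the sense of `W`, `k` measures the position of `X` along the path left by the
missing edge: `W` sits at `0` and `W'` at `n - 1`. -/
theorem exists_dist [NeZero n] (q : Snap n) (W X : Fin 3) (b : Bool) :
    ∃ k < n, q.pos X = q.pos W + away n b * (k : ℕ) := by
  refine ⟨(away n b * (q.pos X - q.pos W)).val, ZMod.val_lt _, ?_⟩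
  rw [ZMod.natCast_zmod_val]
  cases b <;> simp [away]

theorem pos_eq_iff {k : ℕ} (hk : k < n)
    (hp : q.pos X = q.pos W + away n (q.sense chir W) * (k : ℕ)) :
    q.pos X = q.pos W ↔ k = 0 := by
  rw [hp]
  constructor
  · intro h1
    have h2 : (k : ZMod n) = 0 := by
      revert h1
      cases q.sense chir W <;> simp [away]
    rw [ZMod.natCast_eq_zero_iff] at h2
    exact Nat.eq_zero_of_dvd_of_lt h2 hk
  · rintro rfl
    simp

theorem natCast_succ_eq_zero {k : ℕ} (hk : k < n) : ((k : ZMod n) + 1 = 0) ↔ k = n - 1 := by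
  rw [← Nat.cast_succ, ZMod.natCast_eq_zero_iff]
  constructor
  · intro h
    have := Nat.le_of_dvd (Nat.succ_pos k) h
    omega
  · rintro rfl
    rw [Nat.succ_eq_add_one, Nat.sub_add_cancel (by omega)]

theorem pos_eq_iff' (h : Jam chir e q W W' X) {k : ℕ} (hk : k < n)
    (hp : q.pos X = q.pos W + away n (q.sense chir W) * (k : ℕ)) :
    q.pos X = q.pos W' ↔ k = n - 1 := by
  rw [hp, h.pos, ← natCast_succ_eq_zero hk]
  cases q.sense chir W
  · simp only [away, Bool.false_eq_true, if_false, one_mul, sub_eq_add_neg, add_right_inj]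
    rw [eq_neg_iff_add_eq_zero]
  · simp only [away, if_true, sub_eq_add_neg, add_right_inj, neg_mul, one_mul, neg_neg]
    rw [neg_eq_iff_add_eq_zero]

theorem missing (h : Jam chir e q W W' X) :
    e = some (if q.sense chir W then q.pos W else q.pos W - 1) := by
  have h1 := h.stuck
  simp only [moved, ne_eq, decide_not, Bool.not_eq_false', decide_eq_true_eq] at h1
  rw [h1, edge, Walk.sense_settle_of_role_two h.role]
  rfl

/-- The missing edge joins distances `n - 1` and `0`, so it cannot hinder a robot between them. -/
theorem round_pos_away (h : Jam chir e q W W' X) {k : ℕ} (hk : k + 1 < n)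
    (hp : q.pos X = q.pos W + away n (q.sense chir W) * (k : ℕ))
    (hs : q.settle.sense chir X = !q.sense chir W) :
    (q.round chir e).pos X =
      (q.round chir e).pos W + away n ((q.round chir e).sense chir W) * (k + 1 : ℕ) := by
  have h0 : ¬(k : ZMod n) + 1 = 0 := by
    rw [natCast_succ_eq_zero (by omega)]
    omega
  have hm : q.settle.moved chir e X = true := by
    simp only [moved, ne_eq, decide_not, Bool.not_eq_true', decide_eq_false_iff_not, edge, hs,
      settle_pos]
    rw [h.missing, hp, Option.some_inj]
    intro h1
    apply h0
    revert h1
    cases q.sense chir W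
    · simp only [away, reduceCtorEq, if_true, if_false]
      intro h1
      linear_combination -h1
    · simp only [away, reduceCtorEq, if_true, if_false]
      intro h1
      linear_combination h1
  rw [h.round_pos, h.round_sense, Snap.round, finish_pos, hm, hs, settle_pos, hp]
  cases q.sense chir W <;> simp [away] <;> ring

/-- At `k = 0` the robot pushes against the missing edge and stays, which is what the truncated `k -
1` says. -/
theorem round_pos_toward (h : Jam chir e q W W' X) {k : ℕ} (hk : k < n)
    (hp : q.pos X = q.pos W + away n (q.sense chir W) * (k : ℕ))
    (hs : q.settle.sense chir X = q.sense chir W) :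
    (q.round chir e).pos X =
      (q.round chir e).pos W + away n ((q.round chir e).sense chir W) * (k - 1 : ℕ) := by
  rcases Nat.eq_zero_or_pos k with rfl | hk0
  · have hm : q.settle.moved chir e X = false := by
      simp only [moved, ne_eq, decide_not, Bool.not_eq_false', decide_eq_true_eq, edge, hs,
        settle_pos]
      rw [h.missing, hp]
      simp
    rw [h.round_pos, h.round_sense, Snap.round, finish_pos, hm, settle_pos, hp]
    rfl
  · have h0 : ¬(k : ZMod n) = 0 := by
      rw [ZMod.natCast_eq_zero_iff]
      exact Nat.not_dvd_of_pos_of_lt hk0 hk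
    have hm : q.settle.moved chir e X = true := by
      simp only [moved, ne_eq, decide_not, Bool.not_eq_true', decide_eq_false_iff_not, edge, hs,
        settle_pos]
      rw [h.missing, hp, Option.some_inj]
      intro h1
      apply h0
      revert h1
      cases q.sense chir W
      · simp only [away, reduceCtorEq, if_false]
        intro h1
        linear_combination -h1
      · simp only [away, if_true]
        intro h1
        linear_combination h1
    rw [h.round_pos, h.round_sense, Snap.round, finish_pos, hm, hs, settle_pos, hp]
    obtain ⟨k, rfl⟩ : ∃ k', k = k' + 1 := ⟨k - 1, by omega⟩
    cases q.sense chir W <;> simp [away] <;> ring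

theorem roleX_settle (h : Jam chir e q W W' X) :
    (q.settle.mem X).role = 0 ∨ (q.settle.mem X).role = 3 := by
  have hoth : ∀ m, m ≠ X → (q.mem m).role ≠ 0 := by
    intro m hm
    rcases fin3_cases h.WW h.WX h.WX' m with rfl | rfl | rfl
    · simp [h.role]
    · simp [h.role']
    · exact absurd rfl hm
  rcases h.roleX with h | h
  · simp only [settle_mem, Mem.settle, h, if_true, exists_mem_here]
    split
    · exact Or.inr rfl
    · rename_i h1
      split
      · rename_i h2
        exfalso
        apply h1
        left
        rcases h2 with ⟨j, hj, hp, -⟩ | ⟨j, hj, hp, -⟩ <;> exact ⟨j, hj, hp, hoth j hj⟩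
      · exact Or.inl rfl
  · right
    simp [settle_mem, Mem.settle, h]

/-- Stuck walkers traverse no edge, so `X` can interact with them only by standing at their nodes.
-/
theorem crossedX (h : Jam chir e q W W' X) (p : Mem → Prop) :
    ¬∃ a ∈ q.settle.crossed chir e X, p a := by
  rw [exists_mem_crossed]
  rintro ⟨m, hm, ⟨-, h1, -⟩, -⟩
  rcases fin3_cases h.WW h.WX h.WX' m with rfl | rfl | rfl
  · rw [h.stuck] at h1
    simp at h1
  · rw [h.stuck'] at h1
    simp at h1
  · exact hm rfl

theorem round_role (h : Jam chir e q W W' X) :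
    ((q.round chir e).mem X).role = (q.settle.mem X).role := by
  rcases h.roleX_settle with h1 | h1
  · simp only [Snap.round, finish_mem, Mem.observe, h1, h.crossedX]
    simp
  · simp [Snap.round, finish_mem, Mem.observe, h1]

theorem round_senseX (h : Jam chir e q W W' X) :
    (q.round chir e).sense chir X = q.settle.sense chir X := by
  have : (q.settle.mem X).role ≠ 1 := by
    rcases h.roleX_settle with h1 | h1 <;> simp [h1]
  simp [Snap.round, Snap.sense, finish_mem, Mem.observe, this]

theorem round_known (h : Jam chir e q W W' X) (b : Bool) :
    ((q.round chir e).mem X).known b = (q.settle.mem X).known b := by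
  have : (q.settle.mem X).role ≠ 2 := by
    rcases h.roleX_settle with h1 | h1 <;> simp [h1]
  simp [Snap.round, finish_mem, Mem.observe, this, Mem.known]

theorem role_settle_of_three (h : (q.mem X).role = 3) : (q.settle.mem X).role = 3 := by
  simp [settle_mem, Mem.settle, h]

theorem not_here (h : Jam chir e q W W' X) (h1 : q.pos X ≠ q.pos W) (h2 : q.pos X ≠ q.pos W')
    (p : Mem → Prop) : ¬∃ a ∈ q.here X, p a := by
  rw [exists_mem_here]
  rintro ⟨m, hm, hpm, -⟩
  rcases fin3_cases h.WW h.WX h.WX' m with rfl | rfl | rfl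
  · exact h1 hpm.symm
  · exact h2 hpm.symm
  · exact hm rfl

theorem sense_settle_alone (h : Jam chir e q W W' X) (h3 : (q.mem X).role = 3)
    (h1 : q.pos X ≠ q.pos W) (h2 : q.pos X ≠ q.pos W') :
    q.settle.sense chir X = q.sense chir X := by
  simp only [Snap.sense, settle_mem, Mem.settle, h3, h.not_here h1 h2]
  simp

theorem role_settle_alone (h : Jam chir e q W W' X) (h0 : (q.mem X).role = 0)
    (h1 : q.pos X ≠ q.pos W) (h2 : q.pos X ≠ q.pos W') : (q.settle.mem X).role = 0 := by
  simp only [settle_mem, Mem.settle, h0, h.not_here h1 h2]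
  simp

theorem role_settle_at (h : Jam chir e q W W' X)
    (h1 : q.pos X = q.pos W ∨ q.pos X = q.pos W') : (q.settle.mem X).role = 3 := by
  have hh : ∃ a ∈ q.here X, a.role ≠ 0 := by
    rw [exists_mem_here]
    rcases h1 with h1 | h1
    · exact ⟨W, h.WX, h1.symm, by simp [h.role]⟩
    · exact ⟨W', h.WX', h1.symm, by simp [h.role']⟩
  rcases h.roleX with h0 | h0
  · simp only [settle_mem, Mem.settle, h0, if_true]
    rw [if_pos (Or.inl hh)]
  · exact role_settle_of_three h0

theorem sense_settle_at (h : Jam chir e q W W' X) (h3 : (q.mem X).role = 3)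
    (h1 : q.pos X = q.pos W) : q.settle.sense chir X = !q.sense chir X := by
  have hh : ∃ a ∈ q.here X, a.role ≠ 0 :=
    exists_mem_here.2 ⟨W, h.WX, h1.symm, by simp [h.role]⟩
  simp only [Snap.sense, settle_mem, Mem.settle]
  rw [if_neg (by simp [h3]), if_pos ⟨h3, hh⟩]
  cases (q.mem X).dir <;> cases chir X <;> rfl

theorem known_le_settle (h3 : (q.mem X).role = 3) (b : Bool) :
    (q.mem X).known b ≤ (q.settle.mem X).known b := by
  simp only [settle_mem, Mem.settle, Mem.known, h3]
  cases b <;> simp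

theorem le_known_settle (h : Jam chir e q W W' X) (h3 : (q.mem X).role = 3)
    (h1 : q.pos X = q.pos W) : (q.mem W).y ≤ (q.settle.mem X).known (q.mem W).side := by
  have := (maxBlocks_here_le (q := q) (i := X) (b := (q.mem W).side)).1 le_rfl W h.WX h1.symm rfl
  simp only [settle_mem, Mem.settle, Mem.known, h3]
  cases hs : (q.mem W).side <;> simp [hs] at this ⊢ <;> omega

end Jam

end Snap

open Snap

/-- Properties of the snapshots of an execution. -/
structure Execution {n : ℕ} (chir : Fin 3 → Bool) (adv : ℕ → Option (ZMod n)) (E : ℕ → Snap n)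
    (code : Fin 3 → ℕ) (len : ℕ) : Prop where
  three_le : 3 ≤ n
  step : ∀ s, E (s + 1) = (E s).round chir (adv s)
  unmet : Unmet (E 0)
  clock : ∀ s i, ((E s).mem i).clock = 2 * s
  code_eq : ∀ s i, ((E s).mem i).code = code i
  len_eq : ∀ s i, ((E s).mem i).len = len
  injective : Function.Injective code

/-- The nodes visited in the first `s` snapshots. -/
def visited {n : ℕ} (E : ℕ → Snap n) (s : ℕ) : Set (ZMod n) :=
  {v | ∃ s' ≤ s, ∃ i, (E s').pos i = v}

namespace Execution

variable {n : ℕ} {chir : Fin 3 → Bool} {adv : ℕ → Option (ZMod n)} {E : ℕ → Snap n}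
  {code : Fin 3 → ℕ} {len : ℕ} {W W' X : Fin 3}

theorem jam_const (hE : Execution chir adv E code len) {s₀ T : ℕ}
    (hj : ∀ t < T, Jam chir (adv (s₀ + t)) (E (s₀ + t)) W W' X) {t : ℕ} (ht : t ≤ T) :
    (E (s₀ + t)).pos W = (E s₀).pos W ∧ (E (s₀ + t)).sense chir W = (E s₀).sense chir W ∧
      ((E (s₀ + t)).mem W).side = ((E s₀).mem W).side ∧
      ((E (s₀ + t)).mem W).y = ((E s₀).mem W).y + t := by
  induction t with
  | zero => simp
  | succ t ih =>
    obtain ⟨h1, h2, h3, h4⟩ := ih (by omega)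
    have h := hj t (by omega)
    rw [← add_assoc, hE.step, h.round_pos, h.round_sense, h.round_side, h.round_y, h1, h2, h3, h4]
    exact ⟨rfl, rfl, rfl, by ring⟩

/-- With a constant sense the distance from `W` changes by one each time, so it reaches `0` or `n -
1` within `n` steps. -/
theorem approach_of_sense (hE : Execution chir adv E code len) {s₀ : ℕ}
    (hj : ∀ t ≤ n, Jam chir (adv (s₀ + t)) (E (s₀ + t)) W W' X) {c : Bool}
    (hs : ∀ t ≤ n, (E (s₀ + t)).settle.sense chir X = c) :
    ∃ t ≤ n, (E (s₀ + t)).pos X = (E (s₀ + t)).pos W ∨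
      (E (s₀ + t)).pos X = (E (s₀ + t)).pos W' := by
  have : NeZero n := ⟨by have := hE.three_le; omega⟩
  by_contra! hne
  obtain ⟨k, hk, hp⟩ := Jam.exists_dist (E s₀) W X ((E s₀).sense chir W)
  have hc : ∀ t ≤ n, (E (s₀ + t)).sense chir W = (E s₀).sense chir W := fun t ht =>
    (hE.jam_const (T := n) (fun t ht => hj t ht.le) ht).2.1
  by_cases hcW : c = (E s₀).sense chir W
  · have key : ∀ t ≤ n, ∃ k', k' + t = k ∧ (E (s₀ + t)).pos X = (E (s₀ + t)).pos W +
        away n ((E (s₀ + t)).sense chir W) * (k' : ℕ) := by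
      intro t
      induction t with
      | zero => exact fun _ => ⟨k, rfl, hp⟩
      | succ t ih =>
        intro ht
        obtain ⟨k', hk', hp'⟩ := ih (by omega)
        have h := hj t (by omega)
        have h0 : k' ≠ 0 := fun h0 =>
          (hne t (by omega)).1 ((Jam.pos_eq_iff (by omega) hp').2 h0)
        refine ⟨k' - 1, by omega, ?_⟩
        rw [← add_assoc, hE.step]
        exact h.round_pos_toward (by omega) hp'
          (by rw [hs t (by omega), hcW, hc t (by omega)])
    obtain ⟨k', hk', -⟩ := key n le_rfl
    omega
  · have key : ∀ t ≤ n, k + t < n ∧ (E (s₀ + t)).pos X = (E (s₀ + t)).pos W +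
        away n ((E (s₀ + t)).sense chir W) * (k + t : ℕ) := by
      intro t
      induction t with
      | zero => exact fun _ => ⟨hk, hp⟩
      | succ t ih =>
        intro ht
        obtain ⟨hk', hp'⟩ := ih (by omega)
        have h := hj t (by omega)
        have h0 : k + t ≠ n - 1 := fun h0 =>
          (hne t (by omega)).2 ((h.pos_eq_iff' hk' hp').2 h0)
        refine ⟨by omega, ?_⟩
        rw [← add_assoc, ← add_assoc, hE.step]
        exact h.round_pos_away (by omega) hp'
          (by rw [hs t (by omega), Bool.eq_not_of_ne hcW, hc t (by omega)])
    have := (key n le_rfl).1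
    omega

/-- Until it reaches a walker, `X` does not turn: a messenger turns only in company, and a lone
robot follows its schedule, which is constant here. -/
theorem approach (hE : Execution chir adv E code len) {s₀ : ℕ}
    (hj : ∀ t ≤ n, Jam chir (adv (s₀ + t)) (E (s₀ + t)) W W' X)
    (hs : ((E s₀).mem X).role = 3 ∨
      ∀ t ≤ n, Mem.sched (code X) len (s₀ + t) = Mem.sched (code X) len s₀) :
    ∃ t ≤ n, (E (s₀ + t)).pos X = (E (s₀ + t)).pos W ∨
      (E (s₀ + t)).pos X = (E (s₀ + t)).pos W' := by
  by_contra! hne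
  have hr : (((E s₀).mem X).role = 3 → ∀ t ≤ n, ((E (s₀ + t)).mem X).role = 3 ∧
      (E (s₀ + t)).settle.sense chir X = (E s₀).settle.sense chir X) := by
    intro h3 t
    induction t with
    | zero => exact fun _ => ⟨h3, rfl⟩
    | succ t ih =>
      intro ht
      obtain ⟨h4, h5⟩ := ih (by omega)
      have h := hj t (by omega)
      have h' := hj (t + 1) ht
      have h6 : ((E (s₀ + (t + 1))).mem X).role = 3 := by
        rw [← add_assoc, hE.step, h.round_role]
        exact Jam.role_settle_of_three h4
      refine ⟨h6, ?_⟩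
      rw [h'.sense_settle_alone h6 (hne _ ht).1 (hne _ ht).2, ← h5, ← add_assoc, hE.step,
        h.round_senseX]
  rcases (hj 0 (Nat.zero_le n)).roleX with h0 | h0
  · have hrole : ∀ t ≤ n, ((E (s₀ + t)).mem X).role = 0 := by
      intro t
      induction t with
      | zero => exact fun _ => h0
      | succ t ih =>
        intro ht
        have h := hj t (by omega)
        rw [← add_assoc, hE.step, h.round_role]
        exact h.role_settle_alone (ih (by omega)) (hne t (by omega)).1 (hne t (by omega)).2
    have hs := hs.resolve_left (by
      have : ((E s₀).mem X).role = 0 := h0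
      omega)
    obtain ⟨t, ht, h⟩ := hE.approach_of_sense hj (c := Mem.sched (code X) len s₀ == chir X) (by
      intro t ht
      simp only [Snap.sense, settle_mem, Mem.settle, hrole t ht, if_true, hE.code_eq, hE.len_eq,
        hE.clock]
      rw [Nat.mul_div_cancel_left _ (by norm_num), hs t ht])
    rcases h with h | h
    · exact (hne t ht).1 h
    · exact (hne t ht).2 h
  · obtain ⟨t, ht, h⟩ := hE.approach_of_sense hj fun t ht => (hr h0 t ht).2
    rcases h with h | h
    · exact (hne t ht).1 h
    · exact (hne t ht).2 h

/-- The messenger reads the failures of `W` before leaving and keeps maxima, so it still knows at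
least that number on arrival at `W'`. -/
theorem traverse (hE : Execution chir adv E code len) {s₀ : ℕ}
    (hj : ∀ t ≤ n, Jam chir (adv (s₀ + t)) (E (s₀ + t)) W W' X)
    (h3 : ((E s₀).mem X).role = 3) (hp : (E s₀).pos X = (E s₀).pos W) :
    ∃ t ≤ n, 0 < t ∧ (E (s₀ + t)).pos X = (E (s₀ + t)).pos W' ∧
      ((E (s₀ + t)).mem X).role = 3 ∧
      ((E s₀).mem W).y ≤ ((E (s₀ + t)).mem X).known ((E s₀).mem W).side := by
  have hn := hE.three_le
  have hrole : ∀ t ≤ n, ((E (s₀ + t)).mem X).role = 3 := by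
    intro t
    induction t with
    | zero => exact fun _ => h3
    | succ t ih =>
      intro ht
      rw [← add_assoc, hE.step, (hj t (by omega)).round_role]
      exact Jam.role_settle_of_three (ih (by omega))
  have hknown : ∀ t ≤ n, 0 < t →
      ((E s₀).mem W).y ≤ ((E (s₀ + t)).mem X).known ((E s₀).mem W).side := by
    intro t
    induction t with
    | zero => exact fun _ h => absurd h (lt_irrefl 0)
    | succ t ih =>
      intro ht _
      rw [← add_assoc, hE.step, (hj t (by omega)).round_known]
      rcases Nat.eq_zero_or_pos t with rfl | ht0
      · exact (hj 0 (Nat.zero_le n)).le_known_settle h3 hp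
      · exact (ih (by omega) ht0).trans (Jam.known_le_settle (hrole t (by omega)) _)
  have hc : ∀ t ≤ n, (E (s₀ + t)).sense chir W = (E s₀).sense chir W := fun t ht =>
    (hE.jam_const (T := n) (fun t ht => hj t ht.le) ht).2.1
  -- The automatic reversal may point the messenger at the missing edge; it then stays, reverses
  -- again and leaves one double round later. With the `n - 2` further steps the trip still fits
  -- into `n`.
  have hstart : ∃ t₁, 1 ≤ t₁ ∧ t₁ ≤ 2 ∧ (E (s₀ + t₁)).sense chir X = !(E s₀).sense chir W ∧
      (E (s₀ + t₁)).pos X = (E (s₀ + t₁)).pos W +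
        away n ((E (s₀ + t₁)).sense chir W) * (1 : ℕ) := by
    have h0 := hj 0 (Nat.zero_le n)
    rw [add_zero] at h0
    have hp0 : (E s₀).pos X = (E s₀).pos W + away n ((E s₀).sense chir W) * (0 : ℕ) := by
      simp [hp]
    by_cases hs : (E s₀).settle.sense chir X = (E s₀).sense chir W
    · have hp1 := h0.round_pos_toward (by omega) hp0 hs
      rw [← hE.step] at hp1
      have h1 := hj 1 (by omega)
      have hs1 : (E (s₀ + 1)).sense chir X = (E s₀).sense chir W := by
        rw [hE.step, h0.round_senseX, hs]
      have hs2 := h1.sense_settle_at (hrole 1 (by omega)) (by simpa using hp1)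
      rw [hs1] at hs2
      refine ⟨2, by omega, le_rfl, ?_, ?_⟩
      · rw [← hs2, hE.step, h1.round_senseX]
      · have := h1.round_pos_away (k := 0) (by omega) (by simpa using hp1)
          (by rw [hs2, hc 1 (by omega)])
        rw [← hE.step] at this
        exact this
    · refine ⟨1, le_rfl, by omega, ?_, ?_⟩
      · rw [hE.step, h0.round_senseX]
        exact Bool.eq_not_of_ne hs
      · have := h0.round_pos_away (k := 0) (by omega) hp0 (Bool.eq_not_of_ne hs)
        rw [← hE.step] at this
        exact this
  obtain ⟨t₁, ht₁, ht₂, hs₁, hp₁⟩ := hstart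
  have key : ∀ t, t + 2 ≤ n → (E (s₀ + (t₁ + t))).sense chir X = !(E s₀).sense chir W ∧
      (E (s₀ + (t₁ + t))).pos X = (E (s₀ + (t₁ + t))).pos W +
        away n ((E (s₀ + (t₁ + t))).sense chir W) * (t + 1 : ℕ) := by
    intro t
    induction t with
    | zero => exact fun _ => ⟨hs₁, hp₁⟩
    | succ t ih =>
      intro ht
      obtain ⟨h1, h2⟩ := ih (by omega)
      have h := hj (t₁ + t) (by omega)
      have hsense : (E (s₀ + (t₁ + t))).settle.sense chir X = !(E s₀).sense chir W := by
        rw [← h1]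
        refine h.sense_settle_alone (hrole _ (by omega)) ?_ ?_
        · rw [Ne, Jam.pos_eq_iff (by omega) h2]
          omega
        · rw [Ne, h.pos_eq_iff' (by omega) h2]
          omega
      rw [← add_assoc, ← add_assoc, hE.step]
      refine ⟨?_, ?_⟩
      · rw [← hsense, add_assoc, h.round_senseX]
      · rw [add_assoc]
        exact h.round_pos_away (by omega) h2 (by rw [hsense, hc _ (by omega)])
  obtain ⟨-, h2⟩ := key (n - 2) (by omega)
  refine ⟨t₁ + (n - 2), by omega, by omega, ?_, hrole _ (by omega), hknown _ (by omega) (by omega)⟩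
  exact ((hj _ (by omega)).pos_eq_iff' (by omega) h2).2 (by omega)

end Execution

end DynamicRing

/-! ### Robots meet in a long enough phase -/

namespace DynamicRing

namespace Snap

variable {n : ℕ} {chir : Fin 3 → Bool} {e : Option (ZMod n)} {q d : Snap n} {V : Set (ZMod n)}

theorem Crossing.symm {i j : Fin 3} (h : Crossing chir e d i j) : Crossing chir e d j i :=
  ⟨h.2.1, h.1, h.2.2.1.symm, by rw [h.2.2.2, Bool.not_not]⟩

/-- A gap between approaching robots drops by at most 2, so it can only stop being positive through
a common node (`0`) or a crossing (from `1` to `-1`). -/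
theorem gap_step {A B : Fin 3} {g : ℤ} (hA : d.sense chir A = true) (hB : d.sense chir B = false)
    (hp : d.pos B = d.pos A + g) (hg : 0 < g) (hc : ¬Crossing chir e d A B)
    (hne : (d.finish chir e).pos A ≠ (d.finish chir e).pos B) :
    0 < g - (d.moved chir e A).toNat - (d.moved chir e B).toNat ∧
      (d.finish chir e).pos B = (d.finish chir e).pos A +
        ((g - (d.moved chir e A).toNat - (d.moved chir e B).toNat : ℤ) : ZMod n) := by
  obtain ⟨c, hcA⟩ := ZMod.intCast_surjective (d.pos A)
  have hcB : d.pos B = ((c + g : ℤ) : ZMod n) := by rw [hp, ← hcA]; push_cast; rfl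
  have hpA := finish_pos_right (e := e) hA hcA.symm
  have hpB := finish_pos_left (e := e) hB hcB
  have heq : (d.finish chir e).pos B = (d.finish chir e).pos A +
      ((g - (d.moved chir e A).toNat - (d.moved chir e B).toNat : ℤ) : ZMod n) := by
    rw [hpA, hpB, ← Int.cast_add]
    congr 1
    ring
  refine ⟨?_, heq⟩
  have hmA := Bool.toNat_le (d.moved chir e A)
  have hmB := Bool.toNat_le (d.moved chir e B)
  by_contra hlt
  by_cases h0 : g - (d.moved chir e A).toNat - (d.moved chir e B).toNat = 0
  · rw [h0] at heq
    exact hne (by simpa using heq.symm)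
  · have h1 : (d.moved chir e A).toNat = 1 := by omega
    have h2 : (d.moved chir e B).toNat = 1 := by omega
    have h3 : g = 1 := by omega
    rw [Bool.toNat_eq_one] at h1 h2
    refine hc ⟨h1, h2, ?_, by rw [hA, hB]; rfl⟩
    rw [edge_left hB hcB, edge_right hA hcA.symm, h3]
    simp

theorem exists_gap [NeZero n] (A B : Fin 3) (h : d.pos A ≠ d.pos B) :
    ∃ g : ℤ, 0 < g ∧ g < n ∧ d.pos B = d.pos A + (g : ZMod n) := by
  refine ⟨(d.pos B - d.pos A).val, ?_, ?_, ?_⟩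
  · have : (d.pos B - d.pos A).val ≠ 0 := by
      rw [Ne, ZMod.val_eq_zero, sub_eq_zero]
      exact h.symm
    omega
  · exact_mod_cast ZMod.val_lt _
  · simp

/-- Both walkers see the encounter in the same round. The two bounds on the new arc are what
`squeeze` starts from. -/
theorem Walk.meet {L R X : Fin 3} {a b : ℤ} (hw : Walk chir V d L R X a b)
    (hab : b - a ≤ (n : ℤ) - 1)
    (h : (d.finish chir e).pos L = (d.finish chir e).pos R ∨ Crossing chir e d L R) :
    ((d.finish chir e).mem L).dl ≠ 0 ∧ ((d.finish chir e).mem R).dl ≠ 0 ∧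
      (n : ℤ) ≤ b + (d.moved chir e R).toNat - (a - (d.moved chir e L).toNat) ∧
      b + (d.moved chir e R).toNat - (a - (d.moved chir e L).toNat) ≤ (n : ℤ) + 1 := by
  have hlt := hw.lt
  have hmL := Bool.toNat_le (d.moved chir e L)
  have hmR := Bool.toNat_le (d.moved chir e R)
  refine ⟨?_, ?_, ?_, by omega⟩
  · refine dl_finish_iff.2 (Or.inr (Or.inr (Or.inr ⟨hw.roleL, R, hw.LR.symm, ?_⟩)))
    rcases h with h | h
    · exact Or.inl ⟨h.symm, Or.inl hw.roleR⟩
    · exact Or.inr ⟨h, hw.roleR⟩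
  · refine dl_finish_iff.2 (Or.inr (Or.inr (Or.inr ⟨hw.roleR, L, hw.LR, ?_⟩)))
    rcases h with h | h
    · exact Or.inl ⟨h, Or.inl hw.roleL⟩
    · exact Or.inr ⟨h.symm, hw.roleL⟩
  · rcases h with h | ⟨h1, h2, h3, -⟩
    · rw [finish_pos_left hw.senseL hw.posL, finish_pos_right hw.senseR hw.posR] at h
      exact le_of_intCast_eq h (by omega)
    · rw [edge_left hw.senseL hw.posL, edge_right hw.senseR hw.posR] at h3
      have := le_of_intCast_eq h3.symm (by omega)
      rw [h1, h2]
      simp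
      omega

theorem Walk.meet_or_le {L R X : Fin 3} {a b : ℤ} (hw : Walk chir V d L R X a b)
    (hab : b - a ≤ (n : ℤ) - 1) :
    ((d.finish chir e).pos L = (d.finish chir e).pos R ∨ Crossing chir e d L R) ∨
      b + (d.moved chir e R).toNat - (a - (d.moved chir e L).toNat) ≤ (n : ℤ) - 1 := by
  by_contra! hcon
  obtain ⟨⟨h1, h2⟩, h3⟩ := hcon
  have hmL := Bool.toNat_le (d.moved chir e L)
  have hmR := Bool.toNat_le (d.moved chir e R)
  by_cases h4 : b + (d.moved chir e R).toNat = a - (d.moved chir e L).toNat + n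
  · apply h1
    rw [finish_pos_left hw.senseL hw.posL, finish_pos_right hw.senseR hw.posR, h4]
    simp
  · have h5 : (d.moved chir e L).toNat = 1 := by omega
    have h6 : (d.moved chir e R).toNat = 1 := by omega
    have h7 : b = a - 1 + n := by omega
    rw [Bool.toNat_eq_one] at h5 h6
    refine h2 ⟨h5, h6, ?_, by rw [hw.senseL, hw.senseR]; rfl⟩
    rw [edge_left hw.senseL hw.posL, edge_right hw.senseR hw.posR, h7]
    simp

/-- When the walkers are separated by one edge, they get stuck or cross. -/
theorem Walk.stuck_or_crossing {L R X : Fin 3} {a b : ℤ} (hw : Walk chir V d L R X a b)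
    (hab : b - a = (n : ℤ) - 1) :
    d.moved chir e L = false ∧ d.moved chir e R = false ∨ Crossing chir e d L R := by
  have h7 : b = a - 1 + n := by omega
  have hedge : d.edge chir R = d.edge chir L := by
    rw [edge_left hw.senseL hw.posL, edge_right hw.senseR hw.posR, h7]
    simp
  have hm : d.moved chir e R = d.moved chir e L := by simp [moved, hedge]
  cases h : d.moved chir e L
  · exact Or.inl ⟨rfl, hm.trans h⟩
  · exact Or.inr ⟨h, hm.trans h, hedge, by rw [hw.senseL, hw.senseR]; rfl⟩

end Snap

open Snap

namespace Execution

variable {n : ℕ} {chir : Fin 3 → Bool} {adv : ℕ → Option (ZMod n)} {E : ℕ → Snap n}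
  {code : Fin 3 → ℕ} {len : ℕ} {W W' L R X : Fin 3}

theorem pos_mem_visited {s' s : ℕ} (h : s' ≤ s) (i : Fin 3) : (E s').pos i ∈ visited E s :=
  ⟨s', h, i, rfl⟩

theorem visited_mono {s' s : ℕ} (h : s' ≤ s) : visited E s' ⊆ visited E s :=
  fun _ ⟨u, hu, i, hi⟩ => ⟨u, hu.trans h, i, hi⟩

theorem walk_succ (hE : Execution chir adv E code len) {s : ℕ} {a b : ℤ}
    (hw : Walk chir (visited E s) (E s) L R X a b) :
    Walk chir (visited E (s + 1)) (E (s + 1)) L R X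
      (a - ((E s).settle.moved chir (adv s) L).toNat)
      (b + ((E s).settle.moved chir (adv s) R).toNat) := by
  have := hw.round (e := adv s) (V' := visited E (s + 1)) (visited_mono (Nat.le_succ s)) (by
    intro i
    rw [← hE.step]
    exact pos_mem_visited le_rfl i)
  rw [← hE.step] at this
  exact this

theorem walk_of_le (hE : Execution chir adv E code len) {s : ℕ}
    (hw : ∃ a b, Walk chir (visited E s) (E s) L R X a b) (t : ℕ) :
    ∃ a b, Walk chir (visited E (s + t)) (E (s + t)) L R X a b := by
  induction t with
  | zero => exact hw
  | succ t ih =>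
    obtain ⟨a, b, h⟩ := ih
    exact ⟨_, _, hE.walk_succ h⟩

theorem finish_mem_visited (hE : Execution chir adv E code len) (s : ℕ) (i : Fin 3) :
    ((E s).settle.finish chir (adv s)).pos i ∈ visited E (s + 1) := by
  have := pos_mem_visited (E := E) (le_refl (s + 1)) i
  rw [hE.step] at this
  exact this

theorem phase (hE : Execution chir adv E code len) (s : ℕ) :
    Phase chir (visited E s) (E s) := by
  induction s with
  | zero => exact .unmet hE.unmet
  | succ s ih =>
    rcases ih with h | ⟨i, j, l, h⟩ | ⟨L, R, X, a, b, h⟩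
    · rw [hE.step]
      refine h.round hE.three_le ?_ (fun i => pos_mem_visited (Nat.le_succ s) i)
        (hE.finish_mem_visited s)
      simpa only [hE.code_eq] using hE.injective
    · rcases h.settle.round (e := adv s) hE.three_le (pos_mem_visited (Nat.le_succ s) i)
        (hE.finish_mem_visited s) with ⟨h2, -⟩ | ⟨L, R, X, a, b, hw⟩
      · rw [← Snap.round, ← hE.step] at h2
        exact .paired _ _ _ h2
      · rw [← Snap.round, ← hE.step] at hw
        exact .walk _ _ _ _ _ hw
    · exact .walk _ _ _ _ _ (hE.walk_succ h)

theorem dl_succ (hE : Execution chir adv E code len) {s : ℕ} {i : Fin 3}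
    (h : ((E s).mem i).dl ≠ 0) : ((E (s + 1)).mem i).dl = ((E s).mem i).dl := by
  have h1 : ((E s).settle.mem i).dl = ((E s).mem i).dl := by
    simp [settle_mem, Mem.settle, h]
  have h2 : ((E s).settle.mem i).dl ≠ 0 := h1 ▸ h
  rw [hE.step, Snap.round, finish_mem]
  simp only [Mem.observe, h2, false_and, if_false]
  exact h1

theorem dl_add (hE : Execution chir adv E code len) {s : ℕ} {i : Fin 3}
    (h : ((E s).mem i).dl ≠ 0) (t : ℕ) : ((E (s + t)).mem i).dl = ((E s).mem i).dl := by
  induction t with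
  | zero => rfl
  | succ t ih => rw [← add_assoc, hE.dl_succ (ih ▸ h), ih]

theorem dl_ne_zero_of_le (hE : Execution chir adv E code len) {s s' : ℕ} {i : Fin 3}
    (h : ((E s).mem i).dl ≠ 0) (hs : s ≤ s') : ((E s').mem i).dl ≠ 0 := by
  obtain ⟨t, rfl⟩ := Nat.exists_eq_add_of_le hs
  rw [hE.dl_add h]
  exact h

/-- Two values are possible because knowledge may arrive in the even round or in the odd one. -/
theorem dl_new (hE : Execution chir adv E code len) {s : ℕ} {i : Fin 3}
    (h : ((E s).mem i).dl = 0) (h' : ((E (s + 1)).mem i).dl ≠ 0) :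
    ((E (s + 1)).mem i).dl = 64 * (2 * s + 1) ∨ ((E (s + 1)).mem i).dl = 64 * (2 * s + 2) := by
  have hc : ((E s).settle.mem i).clock = 2 * s + 1 := by
    rw [settle_mem]
    simp only [Mem.settle, hE.clock]
  rw [hE.step, Snap.round, finish_mem] at h' ⊢
  simp only [Mem.observe, hc] at h' ⊢
  split at h'
  · rename_i h1
    rw [if_pos h1]
    exact Or.inr rfl
  · rename_i h1
    rw [if_neg h1]
    rw [settle_mem] at h' ⊢
    simp only [Mem.settle, hE.clock] at h' ⊢
    split at h'
    · rename_i h2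
      rw [if_pos h2]
      exact Or.inl rfl
    · exact absurd h h'

theorem unmet_succ (hE : Execution chir adv E code len) {s : ℕ} (h : Unmet (E s))
    (h' : Unmet (E (s + 1))) : Function.Injective (E s).pos ∧
      (∀ i j, ¬Crossing chir (adv s) (E s).settle i j) ∧
      ∀ i, (E s).settle.sense chir i = (Mem.sched (code i) len s == chir i) := by
  have hc : Function.Injective fun i => ((E s).mem i).code := by
    simpa only [hE.code_eq] using hE.injective
  have hinj : Function.Injective (E s).pos := by
    by_contra hinj
    obtain ⟨i, j, l, hp⟩ := h.settle_of_pos_eq hc hinj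
    have h1 := h'.role i
    rw [hE.step, Snap.round, finish_mem] at h1
    simp only [Mem.observe, hp.rolei] at h1
    split at h1
    · simp_all
    · split at h1
      · split at h1 <;> simp at h1
      · simp at h1
  have h2 := h.settle_of_injective hinj
  refine ⟨hinj, fun i j hij => ?_, fun i => ?_⟩
  · have key : ∀ i j, Crossing chir (adv s) (E s).settle i j →
        (E s).settle.sense chir i = false → False := by
      intro i j hij hi
      obtain ⟨X, a, b, hw⟩ := h2.finish_of_crossing hE.three_le hinj hc hij hi
        (V' := Set.univ) fun _ => trivial
      have h1 := h'.role i
      rw [hE.step, Snap.round, hw.roleL] at h1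
      simp at h1
    cases hi : (E s).settle.sense chir i
    · exact key i j hij hi
    · exact key j i hij.symm (by rw [hij.2.2.2, hi]; rfl)
  · simp only [Snap.sense, settle_mem, Mem.settle, h.role, if_true, hE.code_eq, hE.len_eq,
      hE.clock]
    rw [Nat.mul_div_cancel_left _ (by norm_num)]

/-- The third robot has the sense of `A` or of `B`, so one robot faces two. The two gaps sum to at
most `2 * n` initially and their sum shrinks each time, because the two robots of equal sense cannot
both be blocked. -/
theorem not_unmet_of_sched (hE : Execution chir adv E code len) {s₀ : ℕ} {A B : Fin 3}
    (hs : ∀ t ≤ 2 * n, ∀ i, Mem.sched (code i) len (s₀ + t) = Mem.sched (code i) len s₀)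
    (hA : (Mem.sched (code A) len s₀ == chir A) = true)
    (hB : (Mem.sched (code B) len s₀ == chir B) = false) :
    ∃ t ≤ 2 * n + 1, ¬Unmet (E (s₀ + t)) := by
  by_contra! hun
  have : NeZero n := ⟨by have := hE.three_le; omega⟩
  have hsucc := fun t (ht : t ≤ 2 * n) => hE.unmet_succ (hun t (by omega)) (hun (t + 1) (by omega))
  have hAB : A ≠ B := by
    rintro rfl
    simp [hA] at hB
  obtain ⟨C, hAC, hBC⟩ := exists_third A B
  have hsA : ∀ t ≤ 2 * n, (E (s₀ + t)).settle.sense chir A = true := fun t ht => by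
    rw [(hsucc t ht).2.2, hs t ht, hA]
  have hsB : ∀ t ≤ 2 * n, (E (s₀ + t)).settle.sense chir B = false := fun t ht => by
    rw [(hsucc t ht).2.2, hs t ht, hB]
  have hsC : ∀ t ≤ 2 * n, (E (s₀ + t)).settle.sense chir C =
      (Mem.sched (code C) len s₀ == chir C) := fun t ht => by
    rw [(hsucc t ht).2.2, hs t ht]
  have hne : ∀ t, t + 1 ≤ 2 * n → ∀ i j, i ≠ j →
      ((E (s₀ + t)).settle.finish chir (adv (s₀ + t))).pos i ≠
      ((E (s₀ + t)).settle.finish chir (adv (s₀ + t))).pos j := by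
    intro t ht i j hij h
    rw [← Snap.round, ← hE.step] at h
    exact hij ((hsucc (t + 1) ht).1 h)
  have hinj : ∀ i j, i ≠ j → (E s₀).pos i ≠ (E s₀).pos j := fun i j hij h =>
    hij ((hsucc 0 (Nat.zero_le _)).1 h)
  cases hC : (Mem.sched (code C) len s₀ == chir C)
  · have key : ∀ t ≤ 2 * n, ∃ g g' : ℤ, 0 < g ∧ 0 < g' ∧ g + g' + t ≤ 2 * n ∧
        (E (s₀ + t)).pos B = (E (s₀ + t)).pos A + (g : ZMod n) ∧
        (E (s₀ + t)).pos C = (E (s₀ + t)).pos A + (g' : ZMod n) := by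
      intro t
      induction t with
      | zero =>
        intro _
        obtain ⟨g, h1, h2, h3⟩ := exists_gap A B (hinj A B hAB)
        obtain ⟨g', h1', h2', h3'⟩ := exists_gap A C (hinj A C hAC)
        exact ⟨g, g', h1, h1', by push_cast; omega, h3, h3'⟩
      | succ t ih =>
        intro ht
        obtain ⟨g, g', h1, h2, h3, h4, h5⟩ := ih (by omega)
        obtain ⟨h6, h7⟩ := gap_step (hsA t (by omega)) (hsB t (by omega)) h4 h1
          ((hsucc t (by omega)).2.1 A B) (hne t ht A B hAB)
        obtain ⟨h8, h9⟩ := gap_step (hsA t (by omega)) ((hsC t (by omega)).trans hC) h5 h2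
          ((hsucc t (by omega)).2.1 A C) (hne t ht A C hAC)
        refine ⟨_, _, h6, h8, ?_, ?_, ?_⟩
        -- No decrease would mean that `B` and `C` are blocked by one edge; having equal senses,
        -- they would stand at one node.
        · by_contra hcon
          have hmB : ((E (s₀ + t)).settle.moved chir (adv (s₀ + t)) B).toNat = 0 := by
            push_cast at hcon
            omega
          have hmC : ((E (s₀ + t)).settle.moved chir (adv (s₀ + t)) C).toNat = 0 := by
            push_cast at hcon
            omega
          rw [Bool.toNat_eq_zero] at hmB hmC
          have hedge := edge_eq_of_not_moved hmB hmC
          simp only [edge, hsB t (by omega), (hsC t (by omega)).trans hC] at hedge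
          exact hBC ((hsucc t (by omega)).1 (by simpa [settle_pos] using hedge))
        · rw [← add_assoc, hE.step]
          exact h7
        · rw [← add_assoc, hE.step]
          exact h9
    obtain ⟨g, g', h1, h2, h3, -⟩ := key (2 * n) le_rfl
    push_cast at h3
    omega
  · have key : ∀ t ≤ 2 * n, ∃ g g' : ℤ, 0 < g ∧ 0 < g' ∧ g + g' + t ≤ 2 * n ∧
        (E (s₀ + t)).pos B = (E (s₀ + t)).pos A + (g : ZMod n) ∧
        (E (s₀ + t)).pos B = (E (s₀ + t)).pos C + (g' : ZMod n) := by
      intro t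
      induction t with
      | zero =>
        intro _
        obtain ⟨g, h1, h2, h3⟩ := exists_gap A B (hinj A B hAB)
        obtain ⟨g', h1', h2', h3'⟩ := exists_gap C B (hinj C B hBC.symm)
        exact ⟨g, g', h1, h1', by push_cast; omega, h3, h3'⟩
      | succ t ih =>
        intro ht
        obtain ⟨g, g', h1, h2, h3, h4, h5⟩ := ih (by omega)
        obtain ⟨h6, h7⟩ := gap_step (hsA t (by omega)) (hsB t (by omega)) h4 h1
          ((hsucc t (by omega)).2.1 A B) (hne t ht A B hAB)
        obtain ⟨h8, h9⟩ := gap_step ((hsC t (by omega)).trans hC) (hsB t (by omega)) h5 h2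
          ((hsucc t (by omega)).2.1 C B) (hne t ht C B hBC.symm)
        refine ⟨_, _, h6, h8, ?_, ?_, ?_⟩
        · by_contra hcon
          have hmA : ((E (s₀ + t)).settle.moved chir (adv (s₀ + t)) A).toNat = 0 := by
            push_cast at hcon
            omega
          have hmC : ((E (s₀ + t)).settle.moved chir (adv (s₀ + t)) C).toNat = 0 := by
            push_cast at hcon
            omega
          rw [Bool.toNat_eq_zero] at hmA hmC
          have hedge := edge_eq_of_not_moved hmA hmC
          simp only [edge, hsA t (by omega), (hsC t (by omega)).trans hC] at hedge
          exact hAC ((hsucc t (by omega)).1 (by simpa [settle_pos] using hedge))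
        · rw [← add_assoc, hE.step]
          exact h7
        · rw [← add_assoc, hE.step]
          exact h9
    obtain ⟨g, g', h1, h2, h3, -⟩ := key (2 * n) le_rfl
    push_cast at h3
    omega

/-- A pair with equal senses corrects itself in one double round and separates in the next, hence
the bound 2. -/
theorem exists_walk_of_not_unmet (hE : Execution chir adv E code len) {s : ℕ}
    (h : ¬Unmet (E s)) : ∃ t ≤ 2, ∃ L R X a b,
      Walk chir (visited E (s + t)) (E (s + t)) L R X a b := by
  rcases hE.phase s with h1 | ⟨i, j, l, h1⟩ | ⟨L, R, X, a, b, h1⟩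
  · exact absurd h1 h
  · rcases h1.settle.round (e := adv s) hE.three_le (pos_mem_visited (Nat.le_succ s) i)
      (hE.finish_mem_visited s) with ⟨h2, h3, -⟩ | hw
    · rw [← Snap.round, ← hE.step] at h2 h3
      rcases h2.settle.round (e := adv (s + 1)) hE.three_le
        (pos_mem_visited (Nat.le_succ (s + 1)) i) (hE.finish_mem_visited (s + 1)) with
        ⟨-, -, h4⟩ | hw
      · rw [h2.sense_settle, h2.symm.sense_settle] at h4
        exact absurd h4 h3
      · rw [← Snap.round, ← hE.step] at hw
        exact ⟨2, le_rfl, hw⟩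
    · rw [← Snap.round, ← hE.step] at hw
      exact ⟨1, by omega, hw⟩
  · exact ⟨0, by omega, L, R, X, a, b, h1⟩

end Execution

end DynamicRing

/-! ### A certificate appears, and the knowledge spreads -/

namespace DynamicRing

open Snap

namespace Execution

variable {n : ℕ} {chir : Fin 3 → Bool} {adv : ℕ → Option (ZMod n)} {E : ℕ → Snap n}
  {code : Fin 3 → ℕ} {len : ℕ} {W W' L R X : Fin 3}

/-- A messenger that leaves a walker which has been stuck for long makes the other one notice that
the ring is explored. -/
theorem bounce (hE : Execution chir adv E code len) {s₀ : ℕ}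
    (hj : ∀ t ≤ n, Jam chir (adv (s₀ + t)) (E (s₀ + t)) W W' X)
    (h3 : ((E s₀).mem X).role = 3) (hp : (E s₀).pos X = (E s₀).pos W)
    (hx : ∀ t ≤ n, ((E (s₀ + t)).mem W').x < ((E s₀).mem W).y) :
    ∃ t ≤ n, ((E (s₀ + t)).mem W').dl ≠ 0 := by
  obtain ⟨t, ht, ht0, hpt, hrt, hkt⟩ := hE.traverse hj h3 hp
  obtain ⟨u, rfl⟩ : ∃ u, t = u + 1 := ⟨t - 1, by omega⟩
  have h := hj u (by omega)
  have hside := (hE.jam_const (T := n + 1) (fun t ht => hj t (by omega)) (t := u) (by omega)).2.2.1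
  refine ⟨u + 1, ht, ?_⟩
  rw [← add_assoc] at hpt hrt hkt ⊢
  rw [hE.step] at hpt hrt hkt ⊢
  refine dl_finish_iff.2 (Or.inr (Or.inr (Or.inr ?_)))
  refine ⟨Walk.role_settle_of_two h.role', X, h.WX'.symm, Or.inl ⟨hpt, Or.inr ⟨?_, ?_⟩⟩⟩
  · rw [← h.round_role]
    exact hrt
  · have h1 : ((E (s₀ + u)).settle.mem W').x = ((E (s₀ + u)).mem W').x := by
      simp [settle_mem, Mem.settle, h.role']
    have h2 : ((E (s₀ + u)).settle.mem W').side = ((E (s₀ + u)).mem W').side := by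
      simp [settle_mem, Mem.settle, h.role']
    rw [h1, h2, h.side, Bool.not_not, hside, h.stuck', ← h.round_known]
    exact (hx u (by omega)).trans_le hkt

/-- Without a certificate the arc has length `n - 1` after `n` double rounds and the walkers stay
jammed. The next long phase brings the third robot to a walker, which makes it a messenger; one trip
with a failure count of at least `n` beats the successes of the other walker. -/
theorem exists_done (hE : Execution chir adv E code len) {s₁ : ℕ}
    (hw : ∃ a b, Walk chir (visited E s₁) (E s₁) L R X a b) :
    ∃ s ≤ 2 * s₁ + 8 * n, ∃ i, ((E s).mem i).dl ≠ 0 := by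
  by_contra! h0
  have hn := hE.three_le
  have hwt : ∀ t, s₁ + t ≤ 2 * s₁ + 8 * n → ∃ a b,
      Walk chir (visited E (s₁ + t)) (E (s₁ + t)) L R X a b ∧ b - a ≤ (n : ℤ) - 1 ∧
        ((t : ℤ) ≤ b - a ∨ b - a = (n : ℤ) - 1) := by
    intro t
    induction t with
    | zero =>
      intro ht
      obtain ⟨a, b, h⟩ := hw
      have := h.lt
      exact ⟨a, b, h, h.width (h0 _ ht), Or.inl (by push_cast; omega)⟩
    | succ t ih =>
      intro ht
      obtain ⟨a, b, h, h1, h2⟩ := ih (by omega)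
      have h3 := hE.walk_succ h
      have h4 := h3.width (h0 _ ht)
      refine ⟨_, _, h3, h4, ?_⟩
      rcases h2 with h2 | h2
      · rcases h.settle.progress (e := adv (s₁ + t)) (by
          intro i
          have := h0 _ ht i
          rw [← add_assoc, hE.step] at this
          exact this) with h5 | ⟨h5, h6, h7⟩
        · left
          push_cast
          omega
        · right
          rw [h5, h6]
          simpa using h7
      · right
        omega
  have hj : ∀ s, s₁ + n ≤ s → s + 1 ≤ 2 * s₁ + 8 * n → Jam chir (adv s) (E s) L R X ∧
      ((E s).mem L).x < n ∧ ((E s).mem R).x < n := by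
    intro s hs hs'
    obtain ⟨t, rfl⟩ := Nat.exists_eq_add_of_le (show s₁ ≤ s by omega)
    obtain ⟨a, b, h, h1, h2⟩ := hwt t (by omega)
    have hab : b - a = (n : ℤ) - 1 := by omega
    have h4 := (hE.walk_succ h).width (h0 _ hs')
    have hm := h.moves
    refine ⟨?_, by omega, by omega⟩
    rcases h.settle.progress (e := adv (s₁ + t)) (by
      intro i
      have := h0 _ hs' i
      rw [hE.step] at this
      exact this) with h5 | ⟨h5, h6, h7⟩
    · omega
    · exact h.toJam hab h5 h6
  -- The phase from `2 ^ m` is longer than `n`, and it starts late enough for the jam to have lasted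
  -- more than `n` double rounds.
  set m := Nat.log 2 (s₁ + 2 * n) + 1 with hm
  have hm1 : s₁ + 2 * n < 2 ^ m := Nat.lt_pow_succ_log_self (by norm_num) _
  have hm2 : 2 ^ m ≤ 2 * (s₁ + 2 * n) := by
    rw [hm, pow_succ]
    have := Nat.pow_log_le_self 2 (x := s₁ + 2 * n) (by omega)
    omega
  clear_value m
  have hsched : ∀ t ≤ n, Mem.sched (code X) len (2 ^ m + t) = Mem.sched (code X) len (2 ^ m) := by
    intro t ht
    have h1 : Nat.log 2 (2 ^ m + t) = m :=
      Nat.log_eq_of_pow_le_of_lt_pow (by omega) (by rw [pow_succ]; omega)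
    have h2 : Nat.log 2 (2 ^ m) = m := Nat.log_pow (by norm_num) m
    simp only [Mem.sched, h1, h2]
  obtain ⟨t, ht, hpt⟩ := hE.approach (W := L) (W' := R)
    (fun t ht => (hj (2 ^ m + t) (by omega) (by omega)).1) (Or.inr hsched)
  have hr : ((E (2 ^ m + t + 1)).mem X).role = 3 := by
    have h := (hj (2 ^ m + t) (by omega) (by omega)).1
    rw [hE.step, h.round_role]
    exact h.role_settle_at hpt
  -- The first visit only turns `X` into a messenger; `bounce` needs one that already has this role
  -- on arrival.
  obtain ⟨u, hu, hpu⟩ := hE.approach (s₀ := 2 ^ m + t + 1) (W := L) (W' := R)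
    (fun u hu => (hj (2 ^ m + t + 1 + u) (by omega) (by omega)).1) (Or.inl hr)
  have hru : ((E (2 ^ m + t + 1 + u)).mem X).role = 3 := by
    have : ∀ v ≤ u, ((E (2 ^ m + t + 1 + v)).mem X).role = 3 := by
      intro v
      induction v with
      | zero => exact fun _ => hr
      | succ v ih =>
        intro hv
        rw [← add_assoc, hE.step,
          (hj (2 ^ m + t + 1 + v) (by omega) (by omega)).1.round_role]
        exact Jam.role_settle_of_three (ih (by omega))
    exact this u le_rfl
  have hy : ∀ W W', (∀ s, s₁ + n ≤ s → s + 1 ≤ 2 * s₁ + 8 * n →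
      Jam chir (adv s) (E s) W W' X) → n ≤ ((E (2 ^ m + t + 1 + u)).mem W).y := by
    intro W W' hj
    obtain ⟨v, hv⟩ := Nat.exists_eq_add_of_le (show s₁ + n ≤ 2 ^ m + t + 1 + u by omega)
    have := (hE.jam_const (s₀ := s₁ + n) (T := v)
      (fun t ht => hj (s₁ + n + t) (by omega) (by omega)) le_rfl).2.2.2
    rw [hv, this]
    omega
  rcases hpu with hpu | hpu
  · obtain ⟨v, hv, h⟩ := hE.bounce (s₀ := 2 ^ m + t + 1 + u) (W := L) (W' := R)
      (fun v hv => (hj (2 ^ m + t + 1 + u + v) (by omega) (by omega)).1) hru hpu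
      (fun v hv => (hj (2 ^ m + t + 1 + u + v) (by omega) (by omega)).2.2.trans_le
        (hy L R fun s hs hs' => (hj s hs hs').1))
    exact h (h0 _ (by omega) _)
  · obtain ⟨v, hv, h⟩ := hE.bounce (s₀ := 2 ^ m + t + 1 + u) (W := R) (W' := L)
      (fun v hv => (hj (2 ^ m + t + 1 + u + v) (by omega) (by omega)).1.symm) hru hpu
      (fun v hv => (hj (2 ^ m + t + 1 + u + v) (by omega) (by omega)).2.1.trans_le
        (hy R L fun s hs hs' => (hj s hs hs').1.symm))
    exact h (h0 _ (by omega) _)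

theorem dl_of_here (hE : Execution chir adv E code len) {s : ℕ} {i j : Fin 3} (hij : j ≠ i)
    (hp : (E s).pos j = (E s).pos i) (h : ((E s).mem j).dl ≠ 0) :
    ((E s).settle.mem i).dl ≠ 0 ∧ ((E (s + 1)).mem i).dl ≠ 0 := by
  have h1 : ((E s).settle.mem i).dl ≠ 0 := by
    have hh : ∃ a ∈ (E s).here i, a.dl ≠ 0 := exists_mem_here.2 ⟨j, hij, hp, h⟩
    by_cases h0 : ((E s).mem i).dl = 0
    · rw [settle_mem]
      simp only [Mem.settle]
      rw [if_pos ⟨h0, hh⟩]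
      omega
    · exact dl_settle_ne_zero h0
  refine ⟨h1, ?_⟩
  rw [hE.step]
  exact dl_finish_iff.2 (Or.inl h1)

/-- Two walkers that know that the ring is explored and walk away from each other tell the third
robot. -/
theorem squeeze (hE : Execution chir adv E code len) {s₀ : ℕ} {a b : ℤ}
    (hw : Walk chir (visited E s₀) (E s₀) L R X a b) (hn : (n : ℤ) ≤ b - a)
    (hn' : b - a ≤ (n : ℤ) + 1) (hL : ((E s₀).mem L).dl ≠ 0) (hR : ((E s₀).mem R).dl ≠ 0) :
    ((E (s₀ + n + 1)).mem X).dl ≠ 0 := by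
  intro hX
  have hn3 := hE.three_le
  have : NeZero n := ⟨by omega⟩
  have hX0 : ∀ t ≤ n + 1, ((E (s₀ + t)).mem X).dl = 0 := fun t ht => by
    by_contra h
    exact hE.dl_ne_zero_of_le h (show s₀ + t ≤ s₀ + n + 1 by omega) hX
  have hLt : ∀ t, ((E (s₀ + t)).mem L).dl ≠ 0 := fun t => hE.dl_ne_zero_of_le hL (by omega)
  have hRt : ∀ t, ((E (s₀ + t)).mem R).dl ≠ 0 := fun t => hE.dl_ne_zero_of_le hR (by omega)
  have hpL : ∀ t ≤ n, (E (s₀ + t)).pos X ≠ (E (s₀ + t)).pos L := fun t ht h =>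
    (hE.dl_of_here hw.LX h.symm (hLt t)).2 (hX0 (t + 1) (by omega))
  have hpR : ∀ t ≤ n, (E (s₀ + t)).pos X ≠ (E (s₀ + t)).pos R := fun t ht h =>
    (hE.dl_of_here hw.RX h.symm (hRt t)).2 (hX0 (t + 1) (by omega))
  have hcr : ∀ Y, Y ≠ X → (∀ t, ((E (s₀ + t)).mem Y).dl ≠ 0) → ∀ t ≤ n,
      ¬Crossing chir (adv (s₀ + t)) (E (s₀ + t)).settle X Y := by
    intro Y hYX hY t ht h
    have h1 := hX0 (t + 1) (by omega)
    rw [← add_assoc, hE.step] at h1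
    exact dl_finish_iff.2 (Or.inr (Or.inr (Or.inl ⟨Y, hYX, h, dl_settle_ne_zero (hY t)⟩))) h1
  have hsL : ∀ t, (E (s₀ + t)).settle.sense chir L = false := fun t => by
    obtain ⟨_, _, h⟩ := hE.walk_of_le ⟨a, b, hw⟩ t
    exact h.settle.senseL
  have hsR : ∀ t, (E (s₀ + t)).settle.sense chir R = true := fun t => by
    obtain ⟨_, _, h⟩ := hE.walk_of_le ⟨a, b, hw⟩ t
    exact h.settle.senseR
  have key : ∀ t ≤ n, ∃ g g' : ℤ, 0 < g ∧ 0 < g' ∧ g + g' + t ≤ n ∧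
      (E (s₀ + t)).pos X = (E (s₀ + t)).pos R + (g : ZMod n) ∧
      (E (s₀ + t)).pos L = (E (s₀ + t)).pos X + (g' : ZMod n) := by
    intro t
    induction t with
    | zero =>
      intro _
      obtain ⟨g, h1, h2, h3⟩ := exists_gap R X (hpR 0 (by omega)).symm
      have h3' : (E s₀).pos X = (E s₀).pos R + (g : ZMod n) := h3
      -- After the encounter the walkers approach each other along an arc of `2 * n - (b - a)` edges
      -- containing `X`. This is at most `n`, and at least `n - 1`, so the second gap is not
      -- negative.
      have h4 : (E s₀).pos L = (E s₀).pos X + ((2 * n - (b - a) - g : ℤ) : ZMod n) := by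
        rw [h3', hw.posL, hw.posR]
        push_cast
        rw [ZMod.natCast_self]
        ring
      have h5 : 2 * (n : ℤ) - (b - a) - g ≠ 0 := by
        intro h5
        rw [h5] at h4
        exact hpL 0 (by omega) (by simpa using h4.symm)
      exact ⟨g, _, h1, by omega, by push_cast; omega, h3, h4⟩
    | succ t ih =>
      intro ht
      obtain ⟨g, g', h1, h2, h3, h4, h5⟩ := ih (by omega)
      have hnL := hpL (t + 1) ht
      have hnR := hpR (t + 1) ht
      rw [← add_assoc, hE.step] at hnL hnR ⊢
      -- With `X` strictly between them the walkers use different edges, so the sum of the gaps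
      -- drops whatever `X` does.
      have hmove : ¬(((E (s₀ + t)).settle.moved chir (adv (s₀ + t)) L).toNat = 0 ∧
          ((E (s₀ + t)).settle.moved chir (adv (s₀ + t)) R).toNat = 0) := by
        rintro ⟨hmL, hmR⟩
        rw [Bool.toNat_eq_zero] at hmL hmR
        have hedge := edge_eq_of_not_moved hmL hmR
        simp only [edge, hsL t, hsR t, settle_pos] at hedge
        have h6 : ((0 : ℤ) : ZMod n) = ((g + g' - 1 : ℤ) : ZMod n) := by
          rw [h5, h4] at hedge
          push_cast
          simp only [Bool.false_eq_true, if_false, if_true] at hedge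
          linear_combination -hedge
        have := le_of_intCast_eq h6 (by omega)
        omega
      obtain ⟨c, hc⟩ := ZMod.intCast_surjective ((E (s₀ + t)).settle.pos X)
      cases hs : (E (s₀ + t)).settle.sense chir X
      · obtain ⟨h6, h7⟩ := gap_step (hsR t) hs h4 h1
          (fun h => hcr R hw.RX hRt t (by omega) h.symm) hnR.symm
        have hqL : (E (s₀ + t)).settle.pos L = ((c + g' : ℤ) : ZMod n) := by
          rw [settle_pos, h5, ← settle_pos, ← hc]
          push_cast
          rfl
        have h8 : ((E (s₀ + t)).round chir (adv (s₀ + t))).pos L =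
            ((E (s₀ + t)).round chir (adv (s₀ + t))).pos X +
            ((g' + ((E (s₀ + t)).settle.moved chir (adv (s₀ + t)) X).toNat -
              ((E (s₀ + t)).settle.moved chir (adv (s₀ + t)) L).toNat : ℤ) : ZMod n) := by
          rw [Snap.round, finish_pos_left (hsL t) hqL, finish_pos_left hs hc.symm, ← Int.cast_add]
          congr 1
          ring
        have hbL := Bool.toNat_le ((E (s₀ + t)).settle.moved chir (adv (s₀ + t)) L)
        have h9 : g' + ((E (s₀ + t)).settle.moved chir (adv (s₀ + t)) X).toNat -
              ((E (s₀ + t)).settle.moved chir (adv (s₀ + t)) L).toNat ≠ 0 := by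
          intro h9
          rw [h9] at h8
          exact hnL (by simpa using h8.symm)
        exact ⟨_, _, h6, by omega, by push_cast; omega, h7, h8⟩
      · obtain ⟨h6, h7⟩ := gap_step hs (hsL t) h5 h2 (hcr L hw.LX hLt t (by omega)) hnL
        have hqX : (E (s₀ + t)).settle.pos R = ((c - g : ℤ) : ZMod n) := by
          have : (E (s₀ + t)).settle.pos X = (E (s₀ + t)).settle.pos R + (g : ZMod n) := h4
          push_cast
          rw [hc, this]
          ring
        have h8 : ((E (s₀ + t)).round chir (adv (s₀ + t))).pos X =
            ((E (s₀ + t)).round chir (adv (s₀ + t))).pos R +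
            ((g + ((E (s₀ + t)).settle.moved chir (adv (s₀ + t)) X).toNat -
              ((E (s₀ + t)).settle.moved chir (adv (s₀ + t)) R).toNat : ℤ) : ZMod n) := by
          rw [Snap.round, finish_pos_right (hsR t) hqX, finish_pos_right hs hc.symm,
            ← Int.cast_add]
          congr 1
          ring
        have hbR := Bool.toNat_le ((E (s₀ + t)).settle.moved chir (adv (s₀ + t)) R)
        have h9 : g + ((E (s₀ + t)).settle.moved chir (adv (s₀ + t)) X).toNat -
              ((E (s₀ + t)).settle.moved chir (adv (s₀ + t)) R).toNat ≠ 0 := by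
          intro h9
          rw [h9] at h8
          exact hnR (by simpa using h8)
        exact ⟨_, _, by omega, h6, by push_cast; omega, h8, h7⟩
  obtain ⟨g, g', h1, h2, h3, -⟩ := key n le_rfl
  omega

theorem all_done_of_three (hE : Execution chir adv E code len) {s s' : ℕ} {i j l : Fin 3}
    (h₁ : i ≠ j) (h₂ : i ≠ l) (h₃ : j ≠ l) (hs : s ≤ s') (hi : ((E s).mem i).dl ≠ 0)
    (hj : ((E s).mem j).dl ≠ 0) (hl : ((E s).mem l).dl ≠ 0) (m : Fin 3) :
    ((E s').mem m).dl ≠ 0 := by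
  rcases fin3_cases h₁ h₂ h₃ m with rfl | rfl | rfl
  · exact hE.dl_ne_zero_of_le hi hs
  · exact hE.dl_ne_zero_of_le hj hs
  · exact hE.dl_ne_zero_of_le hl hs

/-- A messenger that knows that the ring is explored tells the other walker. -/
theorem jam_done (hE : Execution chir adv E code len) {s₀ : ℕ}
    (hj : ∀ t ≤ n, Jam chir (adv (s₀ + t)) (E (s₀ + t)) W W' X)
    (h3 : ((E s₀).mem X).role = 3) (hp : (E s₀).pos X = (E s₀).pos W)
    (hd : ((E s₀).mem W).dl ≠ 0) : ((E (s₀ + n)).mem W').dl ≠ 0 := by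
  obtain ⟨t, ht, ht0, hpt, -⟩ := hE.traverse hj h3 hp
  obtain ⟨u, rfl⟩ : ∃ u, t = u + 1 := ⟨t - 1, by omega⟩
  have hX := hE.dl_of_here (hj 0 (Nat.zero_le n)).WX hp.symm hd
  have hXu : ((E (s₀ + u)).settle.mem X).dl ≠ 0 := by
    rcases Nat.eq_zero_or_pos u with rfl | hu
    · exact hX.1
    · exact dl_settle_ne_zero (hE.dl_ne_zero_of_le hX.2 (by omega))
  refine hE.dl_ne_zero_of_le (s := s₀ + (u + 1)) ?_ (by omega)
  rw [← add_assoc, hE.step] at hpt ⊢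
  exact dl_finish_iff.2 (Or.inr (Or.inl
    ⟨X, (hj 0 (Nat.zero_le n)).WX'.symm, hpt, hXu⟩))

/-- If a walker at the node of the messenger knows that the ring is explored, then all robots will
know it. -/
theorem all_done_of_messenger (hE : Execution chir adv E code len) {s₀ : ℕ} {a b : ℤ}
    (hw : Walk chir (visited E s₀) (E s₀) L R X a b) (hab : b - a = (n : ℤ) - 1)
    (h3 : ((E s₀).mem X).role = 3)
    (hd : (E s₀).pos X = (E s₀).pos L ∧ ((E s₀).mem L).dl ≠ 0 ∨
      (E s₀).pos X = (E s₀).pos R ∧ ((E s₀).mem R).dl ≠ 0) (m : Fin 3) :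
    ((E (s₀ + n + 1)).mem m).dl ≠ 0 := by
  have hX : ((E (s₀ + 1)).mem X).dl ≠ 0 := by
    rcases hd with ⟨h1, h2⟩ | ⟨h1, h2⟩
    · exact (hE.dl_of_here hw.LX h1.symm h2).2
    · exact (hE.dl_of_here hw.RX h1.symm h2).2
  have hstuck : ∀ t, (∀ u < t, ¬Crossing chir (adv (s₀ + u)) (E (s₀ + u)).settle L R) →
      ∃ a b, Walk chir (visited E (s₀ + t)) (E (s₀ + t)) L R X a b ∧ b - a = (n : ℤ) - 1 := by
    intro t
    induction t with
    | zero => exact fun _ => ⟨a, b, hw, hab⟩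
    | succ t ih =>
      intro hu
      obtain ⟨a, b, h1, h2⟩ := ih fun u hu' => hu u (by omega)
      have h3 := hE.walk_succ h1
      rcases h1.settle.stuck_or_crossing (e := adv (s₀ + t)) h2 with ⟨h5, h6⟩ | h5
      · rw [h5, h6] at h3
        exact ⟨_, _, h3, by simpa using h2⟩
      · exact absurd h5 (hu t (by omega))
  -- Either the adversary releases the edge and the walkers certify by crossing, or the jam lasts
  -- long enough for the messenger to arrive.
  by_cases hc : ∃ t, t ≤ n ∧ Crossing chir (adv (s₀ + t)) (E (s₀ + t)).settle L R
  · classical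
    have hmin := fun u (hu : u < Nat.find hc) => Nat.find_min hc hu
    obtain ⟨ht, hct⟩ := Nat.find_spec hc
    obtain ⟨a, b, h1, h2⟩ := hstuck (Nat.find hc) fun u hu h => hmin u hu ⟨by omega, h⟩
    obtain ⟨h5, h6, -⟩ := h1.settle.meet (e := adv (s₀ + Nat.find hc)) h2.le (Or.inr hct)
    rw [← Snap.round, ← hE.step] at h5 h6
    exact hE.all_done_of_three hw.LR hw.LX hw.RX (by omega) h5 h6
      (hE.dl_ne_zero_of_le hX (by omega)) m
  · push Not at hc
    have hj : ∀ t ≤ n, Jam chir (adv (s₀ + t)) (E (s₀ + t)) L R X := by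
      intro t ht
      obtain ⟨a, b, h1, h2⟩ := hstuck t fun u hu => hc u (by omega)
      rcases h1.settle.stuck_or_crossing (e := adv (s₀ + t)) h2 with ⟨h5, h6⟩ | h5
      · exact h1.toJam h2 h5 h6
      · exact absurd h5 (hc t ht)
    have hn := hE.three_le
    rcases hd with ⟨h1, h2⟩ | ⟨h1, h2⟩
    · exact hE.all_done_of_three (s := s₀ + n) hw.LR hw.LX hw.RX (by omega)
        (hE.dl_ne_zero_of_le h2 (by omega)) (hE.jam_done hj h3 h1 h2)
        (hE.dl_ne_zero_of_le hX (by omega)) m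
    · exact hE.all_done_of_three (s := s₀ + n) hw.LR hw.LX hw.RX (by omega)
        (hE.jam_done (fun t ht => (hj t ht).symm) h3 h1 h2)
        (hE.dl_ne_zero_of_le h2 (by omega)) (hE.dl_ne_zero_of_le hX (by omega)) m

/-- Once a robot knows that the ring is explored, all robots soon know it. -/
theorem all_done (hE : Execution chir adv E code len) {s : ℕ} {a b : ℤ}
    (hw : Walk chir (visited E s) (E s) L R X a b) (h0 : ∀ i, ((E s).mem i).dl = 0)
    (h1 : ∃ i, ((E (s + 1)).mem i).dl ≠ 0) (m : Fin 3) :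
    ((E (s + 1 + n + 1)).mem m).dl ≠ 0 := by
  have hd := hw.settle
  have hw' := hE.walk_succ hw
  have h0' : ∀ i, ((E s).settle.mem i).dl = 0 := dl_settle_eq_zero h0
  have hab := hd.width h0'
  by_cases hmeet : ((E s).settle.finish chir (adv s)).pos L =
      ((E s).settle.finish chir (adv s)).pos R ∨ Crossing chir (adv s) (E s).settle L R
  · obtain ⟨h2, h3, h4, h5⟩ := hd.meet hab hmeet
    rw [← Snap.round, ← hE.step] at h2 h3
    have hX := hE.squeeze hw' h4 h5 h2 h3
    exact hE.all_done_of_three hw.LR hw.LX hw.RX le_rfl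
      (hE.dl_ne_zero_of_le h2 (by omega)) (hE.dl_ne_zero_of_le h3 (by omega)) hX m
  · have hab' := (hd.meet_or_le (e := adv s) hab).resolve_left hmeet
    obtain ⟨i, hi⟩ := h1
    have hab'' := hw'.done i hi
    have hi' := hi
    rw [hE.step] at hi'
    have hcert : Cert chir (adv s) (E s).settle i := by
      rcases dl_finish_iff.1 hi' with h | ⟨j, -, -, h⟩ | ⟨j, -, -, h⟩ | h
      · exact absurd (h0' _) h
      · exact absurd (h0' _) h
      · exact absurd (h0' _) h
      · exact h
    have hX2 : ((E s).settle.mem X).role ≠ 2 := by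
      rcases hd.roleX with h | h <;> simp [h]
    -- A first certificate that is not an encounter of the walkers comes from a messenger at the
    -- certifying walker's node.
    have main : ∀ W, W = L ∨ W = R → i = W → ∀ j, j ≠ W → j ≠ X → ((E (s + 1)).mem X).role = 3 ∧
        (E (s + 1)).pos X = (E (s + 1)).pos W := by
      rintro W hWLR rfl j hj hjX
      obtain ⟨-, j', hj', h2⟩ := hcert
      have hj'X : j' = X := by
        by_contra hj'X
        apply hmeet
        rcases hWLR with rfl | rfl
        · have : j' = R := by
            rcases fin3_cases hw.LR hw.LX hw.RX j' with h | h | h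
            · exact absurd h hj'
            · exact h
            · exact absurd h hj'X
          subst this
          rcases h2 with ⟨h2, -⟩ | ⟨h2, -⟩
          · exact Or.inl h2.symm
          · exact Or.inr h2
        · have : j' = L := by
            rcases fin3_cases hw.LR hw.LX hw.RX j' with h | h | h
            · exact h
            · exact absurd h hj'
            · exact absurd h hj'X
          subst this
          rcases h2 with ⟨h2, -⟩ | ⟨h2, -⟩
          · exact Or.inl h2
          · exact Or.inr (Crossing.symm h2)
      subst hj'X
      rcases h2 with ⟨h2, h3 | ⟨h3, -⟩⟩ | ⟨-, h3⟩
      · exact absurd h3 hX2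
      · rw [hE.step]
        refine ⟨?_, h2⟩
        rw [Snap.round, finish_mem]
        simp [Mem.observe, h3]
      · exact absurd h3 hX2
    refine hE.all_done_of_messenger hw' (by omega) ?_ ?_ m
    all_goals
      rcases fin3_cases hw.LR hw.LX hw.RX i with hiW | hiW | hiW
    · exact (main L (Or.inl rfl) hiW R hw.LR.symm hw.RX).1
    · exact (main R (Or.inr rfl) hiW L hw.LR hw.LX).1
    · exact absurd hcert.1 (hiW ▸ hX2)
    · exact Or.inl ⟨(main L (Or.inl rfl) hiW R hw.LR.symm hw.RX).2, hiW ▸ hi⟩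
    · exact Or.inr ⟨(main R (Or.inr rfl) hiW L hw.LR hw.LX).2, hiW ▸ hi⟩
    · exact absurd hcert.1 (hiW ▸ hX2)

end Execution

end DynamicRing

/-! ### Time bounds -/

namespace DynamicRing

open Snap

/-- This serves twice: as the lower bound of the theorem, and to bound `n` by the time already spent
when a deadline is fixed. -/
theorem le_of_forall_visited {n T : ℕ} [NeZero n] {f : ℕ → Fin 3 → ZMod n}
    (h : ∀ v, ∃ s ≤ T, ∃ i, f s i = v) : n ≤ 3 * (T + 1) := by
  have h1 : (Finset.univ : Finset (ZMod n)) ⊆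
      (Finset.range (T + 1) ×ˢ (Finset.univ : Finset (Fin 3))).image fun x => f x.1 x.2 := by
    intro v _
    obtain ⟨s, hs, i, hi⟩ := h v
    rw [Finset.mem_image]
    exact ⟨(s, i), by simp; omega, hi⟩
  have h2 := (Finset.card_le_card h1).trans Finset.card_image_le
  rw [Finset.card_univ, ZMod.card, Finset.card_product, Finset.card_range, Finset.card_univ,
    Fintype.card_fin] at h2
  omega

namespace Mem

/-- In particular the bit with index `id.length` is `0` in every code, as `exists_bit` requires. -/
theorem start_code_lt (id : List Bool) : (start id).code < 2 ^ id.length := by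
  simp only [start]
  induction id with
  | nil => simp
  | cons b l ih =>
    have := Bool.toNat_le b
    rw [List.foldr_cons, List.length_cons, pow_succ]
    omega

theorem start_code_injective {l l' : List Bool} (hl : l.length = l'.length)
    (h : (start l).code = (start l').code) : l = l' := by
  simp only [start] at h
  induction l generalizing l' with
  | nil => exact (List.length_eq_zero_iff.1 hl.symm).symm
  | cons b l ih =>
    cases l' with
    | nil => simp at hl
    | cons b' l' =>
      rw [List.foldr_cons, List.foldr_cons] at h
      have h1 := Bool.toNat_le b
      have h2 := Bool.toNat_le b'
      have h3 : b.toNat = b'.toNat := by omega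
      have h4 : b = b' := by
        revert h3
        cases b <;> cases b' <;> simp
      rw [h4, ih (by simpa using hl) (by omega)]

end Mem

/-- In some phase of the schedule there are two robots that move in opposite senses. -/
theorem exists_bit {code : Fin 3 → ℕ} {len : ℕ} (hinj : Function.Injective code)
    (hlt : ∀ i, code i < 2 ^ len) (chir : Fin 3 → Bool) :
    ∃ b < len + 1, ∃ A B, ((code A).testBit b == chir A) = true ∧
      ((code B).testBit b == chir B) = false := by
  by_contra! hcon
  have heq : ∀ b < len + 1, ∀ A B, ((code A).testBit b == chir A) =
      ((code B).testBit b == chir B) := by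
    intro b hb A B
    have h1 := hcon b hb A B
    have h2 := hcon b hb B A
    revert h1 h2
    cases ((code A).testBit b == chir A) <;> cases ((code B).testBit b == chir B) <;> simp
  -- Bit `len` of every code is `0`; if it yields no opposite senses, the orientations agree, and
  -- the remaining bits would then force equal codes.
  have h0 : chir 0 = chir 1 := by
    have := heq len (by omega) 0 1
    rw [Nat.testBit_lt_two_pow (hlt 0), Nat.testBit_lt_two_pow (hlt 1)] at this
    revert this
    cases chir 0 <;> cases chir 1 <;> simp
  refine absurd (hinj (Nat.eq_of_testBit_eq fun b => ?_) : (0 : Fin 3) = 1) (by decide)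
  by_cases hb : b < len + 1
  · have := heq b hb 0 1
    rw [h0] at this
    revert this
    cases (code 0).testBit b <;> cases (code 1).testBit b <;> cases chir 1 <;> simp
  · rw [Nat.testBit_lt_two_pow, Nat.testBit_lt_two_pow]
    · exact (hlt 1).trans_le (Nat.pow_le_pow_right (by norm_num) (by omega))
    · exact (hlt 0).trans_le (Nat.pow_le_pow_right (by norm_num) (by omega))

namespace Execution

variable {n : ℕ} {chir : Fin 3 → Bool} {adv : ℕ → Option (ZMod n)} {E : ℕ → Snap n}
  {code : Fin 3 → ℕ} {len : ℕ}

theorem exists_done_le (hE : Execution chir adv E code len) (hlt : ∀ i, code i < 2 ^ len) :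
    ∃ s ≤ (16 * 2 ^ len + 10) * n, ∃ i, ((E s).mem i).dl ≠ 0 := by
  have hn := hE.three_le
  obtain ⟨b, hb, A, B, hA, hB⟩ := exists_bit hE.injective hlt chir
  set M := Nat.log 2 n + 2 with hM
  obtain ⟨m, hm1, hm2, hm3⟩ : ∃ m, M ≤ m ∧ m ≤ M + len ∧ m % (len + 1) = b := by
    -- The first phase index from `M` on that is congruent to `b`; adding `(len + 1) * M` keeps the
    -- subtraction from truncating.
    refine ⟨M + (b + (len + 1) * M - M) % (len + 1), by omega, ?_, ?_⟩
    · have := Nat.mod_lt (b + (len + 1) * M - M) (by omega : 0 < len + 1)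
      omega
    · have : M ≤ (len + 1) * M := Nat.le_mul_of_pos_left M (by omega)
      rw [Nat.add_mod_mod, show M + (b + (len + 1) * M - M) = b + (len + 1) * M by omega,
        Nat.add_mul_mod_self_left, Nat.mod_eq_of_lt hb]
  have hM1 : 2 * n < 2 ^ M := by
    have := Nat.lt_pow_succ_log_self (b := 2) (by norm_num) n
    rw [hM, pow_succ]
    rw [Nat.succ_eq_add_one] at this
    omega
  have hM2 : 2 ^ M ≤ 4 * n := by
    have := Nat.pow_log_le_self 2 (x := n) (by omega)
    rw [hM, pow_add]
    omega
  have h1 : 2 * n < 2 ^ m := hM1.trans_le (Nat.pow_le_pow_right (by norm_num) hm1)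
  have h2 : 2 ^ m ≤ 4 * n * 2 ^ len :=
    (Nat.pow_le_pow_right (by norm_num) hm2).trans (by
      rw [pow_add]
      exact Nat.mul_le_mul_right _ hM2)
  have hlog : ∀ t ≤ 2 * n, Nat.log 2 (2 ^ m + t) = m := fun t ht =>
    Nat.log_eq_of_pow_le_of_lt_pow (by omega) (by rw [pow_succ]; omega)
  have hs : ∀ t ≤ 2 * n, ∀ i, Mem.sched (code i) len (2 ^ m + t) = (code i).testBit b := by
    intro t ht i
    rw [Mem.sched, hlog t ht, hm3]
  have hs0 : ∀ i, Mem.sched (code i) len (2 ^ m) = (code i).testBit b := hs 0 (Nat.zero_le _)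
  obtain ⟨t, ht, hun⟩ := hE.not_unmet_of_sched (s₀ := 2 ^ m) (A := A) (B := B)
    (fun t ht i => by rw [hs t ht, hs0]) (by rw [hs0]; exact hA) (by rw [hs0]; exact hB)
  obtain ⟨u, hu, L, R, X, a, b, hw⟩ := hE.exists_walk_of_not_unmet hun
  obtain ⟨s, hs, hd⟩ := hE.exists_done ⟨a, b, hw⟩
  refine ⟨s, ?_, hd⟩
  calc s ≤ 4 * 2 ^ m + 10 * n := by omega
    _ ≤ 4 * (4 * n * 2 ^ len) + 10 * n := by omega
    _ = (16 * 2 ^ len + 10) * n := by ring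

theorem exists_first_done (hE : Execution chir adv E code len) (hlt : ∀ i, code i < 2 ^ len) :
    ∃ u, u + 1 ≤ (16 * 2 ^ len + 10) * n ∧ (∀ s ≤ u, ∀ i, ((E s).mem i).dl = 0) ∧
      (∀ v, v ∈ visited E (u + 1)) ∧ ∀ i, ((E (u + 1 + n + 1)).mem i).dl ≠ 0 := by
  classical
  have hex : ∃ s, ∃ i, ((E s).mem i).dl ≠ 0 := by
    obtain ⟨s, -, h⟩ := hE.exists_done_le hlt
    exact ⟨s, h⟩
  have hmin : ∀ s < Nat.find hex, ∀ i, ((E s).mem i).dl = 0 := fun s hs i => by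
    by_contra h
    exact Nat.find_min hex hs ⟨i, h⟩
  have hle : Nat.find hex ≤ (16 * 2 ^ len + 10) * n := by
    obtain ⟨s, hs, h⟩ := hE.exists_done_le hlt
    exact (Nat.find_min' hex h).trans hs
  have hspec := Nat.find_spec hex
  obtain ⟨u, hu⟩ : ∃ u, Nat.find hex = u + 1 := by
    refine ⟨Nat.find hex - 1, ?_⟩
    have : Nat.find hex ≠ 0 := by
      intro h0
      rw [h0] at hspec
      obtain ⟨i, hi⟩ := hspec
      exact hi (hE.unmet.dl i)
    omega
  rw [hu] at hspec hmin hle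
  have h0 := hmin u (by omega)
  obtain ⟨L, R, X, a, b, hw⟩ : ∃ L R X a b, Walk chir (visited E u) (E u) L R X a b := by
    obtain ⟨i, hi⟩ := hspec
    rw [hE.step] at hi
    have h0' := dl_settle_eq_zero h0
    -- Nobody could pass on the first knowledge, so it is a walker's own certificate; hence the
    -- walking phase has begun.
    have hr : ((E u).settle.mem i).role = 2 := by
      rcases dl_finish_iff.1 hi with h | ⟨j, -, -, h⟩ | ⟨j, -, -, h⟩ | h
      · exact absurd (h0' _) h
      · exact absurd (h0' _) h
      · exact absurd (h0' _) h
      · exact h.1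
    have hr' : ((E u).mem i).role = 2 := by
      rw [settle_mem] at hr
      simp only [Mem.settle] at hr
      split at hr
      · split at hr
        · simp at hr
        · split at hr <;> simp at hr
      · exact hr
    rcases hE.phase u with h | ⟨i', j, l, h⟩ | ⟨L, R, X, a, b, h⟩
    · rw [h.role] at hr'
      simp at hr'
    · exact absurd hr' (h.role_ne_two i)
    · exact ⟨L, R, X, a, b, h⟩
  refine ⟨u, hle, fun s hs => hmin s (by omega), ?_, hE.all_done hw h0 hspec⟩
  have hw' := hE.walk_succ hw
  obtain ⟨i, hi⟩ := hspec
  have hab := hw'.done i hi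
  have hn := hE.three_le
  have : NeZero n := ⟨by omega⟩
  intro v
  set a' := a - (((E u).settle.moved chir (adv u) L).toNat : ℤ) with ha'
  have hv : v = ((a' + (v - (a' : ZMod n)).val : ℤ) : ZMod n) := by simp
  rw [hv]
  have := ZMod.val_lt (v - (a' : ZMod n))
  exact hw'.visited _ (by omega) (by omega)

/-- The lower bound keeps every robot alive until all know; the upper bound gives the round by which
all have stopped. -/
theorem dl_bounds (hE : Execution chir adv E code len) {u : ℕ}
    (h0 : ∀ s ≤ u, ∀ i, ((E s).mem i).dl = 0) (s : ℕ) (i : Fin 3) (h : ((E s).mem i).dl ≠ 0) :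
    64 * (2 * u + 1) ≤ ((E s).mem i).dl ∧ ((E s).mem i).dl ≤ 128 * s := by
  induction s with
  | zero => exact absurd (hE.unmet.dl i) h
  | succ s ih =>
    by_cases h1 : ((E s).mem i).dl = 0
    · have hs : u ≤ s := by
        by_contra hs
        exact h (h0 (s + 1) (by omega) i)
      rcases hE.dl_new h1 h with h2 | h2 <;> omega
    · rw [hE.dl_succ h1]
      have := ih h1
      omega

end Execution

/-! ### Memory bounds -/

namespace Mem

/-- Bounds on the numbers in the memory in round `t`. -/
structure Bounded (k t : ℕ) (s : Mem) : Prop where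
  clock : s.clock = t
  code : s.code < 2 ^ k
  len : s.len = k
  role : s.role ≤ 3
  x : s.x ≤ t
  y : s.y ≤ t
  dl : s.dl ≤ 64 * t

variable {k t : ℕ} {s : Mem} {h c : Multiset Mem} {m : Bool}

theorem Bounded.settle (hs : s.Bounded k t) (hh : ∀ a ∈ h, Bounded k t a) :
    (s.settle h).Bounded k (t + 1) := by
  have hmax : ∀ b, maxBlocks h b ≤ t := by
    intro b
    simp only [maxBlocks, Multiset.sup_le, Multiset.mem_map]
    rintro _ ⟨a, ha, rfl⟩
    split
    · exact (hh a ha).y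
    · exact Nat.zero_le _
  obtain ⟨h1, h2, h3, h4, h5, h6, h7⟩ := hs
  refine ⟨by simp [Mem.settle, h1], h2, h3, ?_, ?_, ?_, ?_⟩
  · simp only [Mem.settle]
    split
    · split
      · exact le_rfl
      · split <;> omega
    · exact h4
  · simp only [Mem.settle]
    have := hmax false
    split <;> omega
  · simp only [Mem.settle]
    have := hmax true
    split <;> omega
  · simp only [Mem.settle]
    split <;> omega

theorem Bounded.observe (hs : s.Bounded k t) : (s.observe m h c).Bounded k (t + 1) := by
  obtain ⟨h1, h2, h3, h4, h5, h6, h7⟩ := hs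
  have hm := Bool.toNat_le m
  have hm' := Bool.toNat_le (!m)
  refine ⟨by simp [Mem.observe, h1], h2, h3, ?_, ?_, ?_, ?_⟩
  · simp only [Mem.observe]
    split
    · split
      · omega
      · split <;> omega
    · split
      · split <;> omega
      · exact h4
  · simp only [Mem.observe]
    split <;> omega
  · simp only [Mem.observe]
    split <;> omega
  · simp only [Mem.observe]
    split <;> omega

theorem dl_settle_of_ne_zero (hd : s.dl ≠ 0) : (s.settle h).dl = s.dl := by
  simp [Mem.settle, hd]

theorem dl_observe_of_ne_zero (hd : s.dl ≠ 0) : (s.observe m h c).dl = s.dl := by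
  simp [Mem.observe, hd]

/-- Each pairing at most doubles the bit bound. Nine fields need eight pairings, whence the factor
`256 = 2 ^ 8` in `encode_lt`. -/
theorem pair_lt_two_pow {a b p q : ℕ} (ha : a < 2 ^ p) (hb : b < 2 ^ q) (hpq : p ≤ q) :
    Nat.pair a b < 2 ^ (2 * q) := by
  have ha' : a < 2 ^ q := ha.trans_le (Nat.pow_le_pow_right (by norm_num) hpq)
  refine (Nat.pair_lt_max_add_one_sq a b).trans_le ?_
  rw [mul_comm, pow_mul]
  exact Nat.pow_le_pow_left (max_lt ha' hb) 2

theorem encode_eq : Encodable.encode s = Nat.pair s.clock (Nat.pair s.code (Nat.pair s.len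
    (Nat.pair s.role (Nat.pair (Encodable.encode s.side) (Nat.pair (Encodable.encode s.dir)
    (Nat.pair s.x (Nat.pair s.y s.dl))))))) := by
  change @Encodable.encode _ (Encodable.ofEquiv _ equivTuple) s = _
  rw [Encodable.encode_ofEquiv]
  simp only [equivTuple, Equiv.coe_fn_mk, Encodable.encode_prod_val, Encodable.encode_nat]

theorem encode_lt {p : ℕ} (h1 : s.clock < 2 ^ p) (h2 : s.code < 2 ^ p) (h3 : s.len < 2 ^ p)
    (h4 : s.role < 2 ^ p) (h7 : s.x < 2 ^ p) (h8 : s.y < 2 ^ p) (h9 : s.dl < 2 ^ p)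
    (hp : 1 ≤ p) : Encodable.encode s < 2 ^ (256 * p) := by
  have hb : ∀ b : Bool, Encodable.encode b < 2 ^ p := by
    intro b
    have : 2 ^ 1 ≤ 2 ^ p := Nat.pow_le_pow_right (by norm_num) hp
    cases b
    · simp
    · simp
      omega
  have e1 := pair_lt_two_pow h8 h9 le_rfl
  have e2 := pair_lt_two_pow h7 e1 (by omega)
  have e3 := pair_lt_two_pow (hb s.dir) e2 (by omega)
  have e4 := pair_lt_two_pow (hb s.side) e3 (by omega)
  have e5 := pair_lt_two_pow h4 e4 (by omega)
  have e6 := pair_lt_two_pow h3 e5 (by omega)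
  have e7 := pair_lt_two_pow h2 e6 (by omega)
  have e8 := pair_lt_two_pow h1 e7 (by omega)
  rw [show 256 * p = 2 * (2 * (2 * (2 * (2 * (2 * (2 * (2 * p))))))) by ring, encode_eq]
  exact e8

end Mem

/-! ### Return to the real run -/

section Run

variable {n k : ℕ} {id : Fin 3 → List Bool} {chir : Fin 3 → Bool} {start : Fin 3 → ZMod n}
  {adv : ℕ → Option (ZMod n)}

theorem mem_run_succ (t : ℕ) (i : Fin 3) (s' : Mem)
    (h : (run explorer id chir start adv (t + 1)).mem i = some s') :
    ∃ s m hs c, (run explorer id chir start adv t).mem i = some s ∧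
      (∀ a ∈ hs, ∃ j, (run explorer id chir start adv t).mem j = some a) ∧
      ((s.clock % 2 = 0 ∧ ¬(s.dl ≠ 0 ∧ s.dl ≤ s.clock) ∧ s' = s.settle hs) ∨
        (s.clock % 2 ≠ 0 ∧ s' = s.observe m hs c)) := by
  have h1 : (decision explorer (run explorer id chir start adv t) i).map Prod.fst = some s' := h
  obtain ⟨⟨a, d⟩, h3, h2⟩ := Option.map_eq_some_iff.1 h1
  obtain rfl : a = s' := h2
  obtain ⟨s, hs, h1⟩ := Option.bind_eq_some_iff.1 h3
  refine ⟨s, ((run explorer id chir start adv t).trav i).isSome,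
    (run explorer id chir start adv t).here i, (run explorer id chir start adv t).crossed i,
    hs, ?_, ?_⟩
  · intro a ha
    have ha' : a ∈ (run explorer id chir start adv t).here i := ha
    rw [Config.here, Multiset.mem_filterMap] at ha'
    obtain ⟨j, -, hj⟩ := ha'
    exact ⟨j, hj⟩
  · have h2 : Mem.step s _ _ _ = some (a, d) := h1
    simp only [Mem.step] at h2
    split at h2
    · split at h2
      · simp at h2
      · rename_i h3 h4
        exact Or.inl ⟨h3, h4, (Prod.ext_iff.1 (Option.some.inj h2)).1.symm⟩
    · rename_i h3
      exact Or.inr ⟨h3, (Prod.ext_iff.1 (Option.some.inj h2)).1.symm⟩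

theorem run_bounded (hk : ∀ i, (id i).length = k) (t : ℕ) (i : Fin 3) (s : Mem)
    (h : (run explorer id chir start adv t).mem i = some s) : s.Bounded k t := by
  induction t generalizing i s with
  | zero =>
    have h1 : Mem.start (id i) = s := Option.some.inj h
    subst h1
    exact ⟨rfl, hk i ▸ Mem.start_code_lt _, hk i, by simp [Mem.start], le_rfl, le_rfl, le_rfl⟩
  | succ t ih =>
    obtain ⟨s₀, m, hs, c, h1, h2, ⟨-, -, rfl⟩ | ⟨-, rfl⟩⟩ := mem_run_succ t i s h
    · exact (ih i s₀ h1).settle fun a ha => (h2 a ha).elim fun j hj => ih j a hj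
    · exact (ih i s₀ h1).observe

/-- Deadlines never change. This holds for the run itself, hence also after some robots have stopped
and snapshots no longer describe it. -/
theorem run_mem_add (t₀ t : ℕ) (i : Fin 3) (s : Mem)
    (h : (run explorer id chir start adv (t₀ + t)).mem i = some s) :
    ∃ s₀, (run explorer id chir start adv t₀).mem i = some s₀ ∧
      (s₀.dl ≠ 0 → s.dl = s₀.dl) := by
  induction t generalizing s with
  | zero => exact ⟨s, h, fun _ => rfl⟩
  | succ t ih =>
    obtain ⟨s₁, m, hs, c, h1, h2, h3⟩ := mem_run_succ (t₀ + t) i s h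
    obtain ⟨s₀, h4, h5⟩ := ih s₁ h1
    refine ⟨s₀, h4, fun h0 => ?_⟩
    have h6 := h5 h0
    rw [← h6] at h0 ⊢
    rcases h3 with ⟨-, -, rfl⟩ | ⟨-, rfl⟩
    · exact Mem.dl_settle_of_ne_zero h0
    · exact Mem.dl_observe_of_ne_zero h0

theorem execution (hn : 3 ≤ n) (hid : Function.Injective id) (hk : ∀ i, (id i).length = k) :
    Execution chir (fun s => adv (2 * s)) (snaps id chir start adv)
      (fun i => (Mem.start (id i)).code) k where
  three_le := hn
  step _ := rfl
  unmet := ⟨fun _ => rfl, fun _ => rfl, fun _ => rfl, fun _ => rfl⟩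
  clock := snaps_clock id chir start adv
  code_eq := snaps_code id chir start adv
  len_eq s i := (snaps_len id chir start adv s i).trans (hk i)
  injective i j h := hid (Mem.start_code_injective ((hk i).trans (hk j).symm) h)

theorem explored_mono {S : Type} {E : ℕ → Config S n} {t t' : ℕ} (ht : t ≤ t')
    (h : Explored E t) : Explored E t' := fun v => by
  obtain ⟨s, hs, i, hi⟩ := h v
  exact ⟨s, hs.trans ht, i, hi⟩

/-- The execution is described by two times: everything is visited at time `t₁`, nobody terminates
up to time `t₁`, and everybody has terminated at time `t₂`. -/
theorem exists_times (hn : 3 ≤ n) (hid : Function.Injective id) (hk : ∀ i, (id i).length = k) :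
    ∃ t₁ t₂, t₂ ≤ 128 * (16 * 2 ^ k + 13) * n ∧ Explored (run explorer id chir start adv) t₁ ∧
      (∀ t ≤ t₁, ∀ i, ¬Terminated (run explorer id chir start adv) t i) ∧
      t₁ ≤ t₂ ∧ ∀ i, Terminated (run explorer id chir start adv) t₂ i := by
  have hE := execution (chir := chir) (start := start) (adv := adv) hn hid hk
  have : NeZero n := ⟨by omega⟩
  obtain ⟨u, hu, h0, hvis, hdone⟩ := hE.exists_first_done fun i => hk i ▸ Mem.start_code_lt (id i)
  have hnu : n ≤ 3 * (u + 1 + 1) := le_of_forall_visited hvis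
  set D := u + 1 + n + 1 with hD
  -- From `n ≤ 3 * (u + 2)` it follows that `2 * D ≤ 8 * u + 16`, which is below every possible
  -- deadline.
  have hal : ∀ s' ≤ D, ∀ i, ((snaps id chir start adv s').mem i).dl ≠ 0 →
      2 * s' < ((snaps id chir start adv s').mem i).dl := by
    intro s' hs' i hi
    have := (hE.dl_bounds h0 s' i hi).1
    omega
  have heven : ∀ s ≤ D, run explorer id chir start adv (2 * s) =
      (snaps id chir start adv s).toConfig fun _ => none := fun s hs =>
    run_even id chir start adv s fun s' hs' => hal s' (by omega)
  -- At double round `D` all deadlines are fixed and at most `128 * D`; this number is even, so a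
  -- robot still alive then terminates in that very round.
  refine ⟨2 * (u + 1), 128 * D + 1, ?_, ?_, ?_, by omega, ?_⟩
  · have : 128 * D + 1 ≤ 128 * (u + 1) + 128 * (3 * n) := by omega
    calc 128 * D + 1 ≤ 128 * (u + 1) + 128 * (3 * n) := this
      _ ≤ 128 * ((16 * 2 ^ k + 10) * n) + 128 * (3 * n) := by omega
      _ = _ := by ring
  · intro v
    obtain ⟨s, hs, i, hi⟩ := hvis v
    refine ⟨2 * s, by omega, i, ?_⟩
    rw [heven s (by omega)]
    exact hi
  · intro t ht i hterm
    have hterm : (run explorer id chir start adv t).mem i = none := hterm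
    obtain ⟨s, rfl | rfl⟩ : ∃ s, t = 2 * s ∨ t = 2 * s + 1 := ⟨t / 2, by omega⟩
    · rw [heven s (by omega)] at hterm
      exact absurd hterm (by simp [toConfig])
    · rw [run_odd id chir start adv s fun s' hs' => hal s' (by omega)] at hterm
      exact absurd hterm (by simp [toConfig])
  · intro i
    by_contra hterm
    obtain ⟨s', hs'⟩ := Option.ne_none_iff_exists'.1 hterm
    obtain ⟨s, m, hs, c, h1, -, h2⟩ := mem_run_succ (128 * D) i s' hs'
    have hclock := (run_bounded hk _ i s h1).clock
    obtain ⟨s₀, h3, h4⟩ := run_mem_add (2 * D) (126 * D) i s (by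
      rw [show 2 * D + 126 * D = 128 * D by ring]
      exact h1)
    rw [heven D le_rfl] at h3
    have h5 : (snaps id chir start adv D).mem i = s₀ := Option.some.inj h3
    subst h5
    have h6 := h4 (hdone i)
    have h7 := (hE.dl_bounds h0 D i (hdone i)).2
    rcases h2 with ⟨-, h2, -⟩ | ⟨h2, -⟩
    · exact h2 ⟨h6 ▸ hdone i, by omega⟩
    · omega

end Run

end DynamicRing

theorem mainTheorem2 :
    (∃ P : DynamicRing.RobotAlgorithm, ∀ k : ℕ, ∃ C M : ℕ, ∀ n : ℕ, 3 ≤ n →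
      ∀ id : Fin 3 → List Bool, Function.Injective id → (∀ i, (id i).length = k) →
      ∀ (chir : Fin 3 → Bool) (start : Fin 3 → ZMod n) (adv : ℕ → Option (ZMod n)),
        DynamicRing.ExploresWithTermination (DynamicRing.run P id chir start adv) (C * n) ∧
        DynamicRing.UsesMemory (DynamicRing.run P id chir start adv) (M * Nat.log 2 n)) ∧
    (∃ c : ℝ, 0 < c ∧ ∃ N : ℕ, ∀ P : DynamicRing.RobotAlgorithm, ∀ n : ℕ, N ≤ n →
      ∀ (id : Fin 3 → List Bool) (chir : Fin 3 → Bool) (start : Fin 3 → ZMod n)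
        (adv : ℕ → Option (ZMod n)) (T : ℕ),
        DynamicRing.Explored (DynamicRing.run P id chir start adv) T → c * (n : ℝ) ≤ (T : ℝ)) := by
  -- From `n ≤ 3 * (T + 1)` one gets `T ≥ n / 3 - 1`, which is at least `n / 6` once `n ≥ 6`.
  refine ⟨⟨DynamicRing.explorer, fun k => ?_⟩, 1 / 6, by norm_num, 6, ?_⟩
  · set C := 128 * (16 * 2 ^ k + 13) with hC
    set F := 64 * C + 2 ^ k + k + 4 with hF
    refine ⟨C, 256 * (F + 2), fun n hn id hid hk chir start adv => ?_⟩
    obtain ⟨t₁, t₂, h1, h2, h3, h4, h5⟩ := DynamicRing.exists_times (chir := chir)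
      (start := start) (adv := adv) hn hid hk
    have h1 : t₂ ≤ C * n := h1
    refine ⟨⟨⟨t₂, h1, DynamicRing.explored_mono h4 h2, h5⟩, fun t i ht => ?_⟩, ?_⟩
    · refine DynamicRing.explored_mono ?_ h2
      by_contra hlt
      exact h3 t (by omega) i ht
    · intro t i s hs
      have hs : (DynamicRing.run DynamicRing.explorer id chir start adv t).mem i = some s := hs
      have ht : t < t₂ := by
        by_contra hlt
        obtain ⟨t', rfl⟩ := Nat.exists_eq_add_of_le (not_lt.1 hlt)
        obtain ⟨s₀, h6, -⟩ := DynamicRing.run_mem_add t₂ t' i s hs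
        have h7 : (DynamicRing.run DynamicRing.explorer id chir start adv t₂).mem i = none := h5 i
        rw [h7] at h6
        exact absurd h6 (by simp)
      obtain ⟨b1, b2, b3, b4, b5, b6, b7⟩ := DynamicRing.run_bounded hk t i s hs
      have hlog : 1 ≤ Nat.log 2 n := Nat.log_pos (by norm_num) (by omega)
      -- Since the logarithm is at least 1, the additive `F + 1` in the exponent is absorbed into
      -- the factor `F + 2`.
      have hFn : F * n < 2 ^ ((F + 2) * Nat.log 2 n) := by
        calc F * n < 2 ^ F * 2 ^ (Nat.log 2 n + 1) :=
              Nat.mul_lt_mul'' Nat.lt_two_pow_self (Nat.lt_pow_succ_log_self (by norm_num) n)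
          _ = 2 ^ (F + (Nat.log 2 n + 1)) := (pow_add _ _ _).symm
          _ ≤ 2 ^ ((F + 2) * Nat.log 2 n) := by
            refine Nat.pow_le_pow_right (by norm_num) ?_
            nlinarith
      have hle : 64 * (C * n) + 2 ^ k + k + 4 ≤ F * n := by
        have : 2 ^ k + k + 4 ≤ (2 ^ k + k + 4) * n := Nat.le_mul_of_pos_right _ (by omega)
        calc 64 * (C * n) + 2 ^ k + k + 4 ≤ 64 * (C * n) + (2 ^ k + k + 4) * n := by omega
          _ = F * n := by rw [hF]; ring
      rw [Nat.size_le]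
      have := DynamicRing.Mem.encode_lt (s := s) (p := (F + 2) * Nat.log 2 n)
        (by omega) (by omega) (by omega) (by omega) (by omega) (by omega) (by omega)
        (Nat.mul_pos (by omega) hlog)
      rw [mul_assoc]
      exact this
  · intro P n hn id chir start adv T h
    have : NeZero n := ⟨by omega⟩
    have h1 := DynamicRing.le_of_forall_visited
      (f := fun s => (DynamicRing.run P id chir start adv s).pos) h
    have h2 : (n : ℝ) ≤ 3 * (T + 1) := by exact_mod_cast h1
    have h3 : (6 : ℝ) ≤ n := by exact_mod_cast hn
    linarith
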